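/- Let $k$ be a perfect field with algebraic closure $\bar k$. A *$d$-point* of $\mathbb{P}^2$ is an orbit of $d$ elements of $\mathbb{P}^2(\bar k)$ under $\mathrm{Gal}(\bar k/k)$; its *residue field* is the extension of $k$ generated by the quotients of the homogeneous coordinates of one of these elements (well defined up to $k$-isomorphism). Let $q_1,q_2\in k[x,y,z]$ be two linearly independent homogeneous polynomials of degree $2$, put $\pi=[q_1:q_2]\colon\mathbb{P}^2\dashrightarrow\mathbb{P}^1$ and let $\mathrm{Bir}_k(\mathbb{P}^2/\pi)$ be the group of all birational self-maps $f$ of $\mathbb{P}^2$ defined over $k$ with $\pi\circ f=\pi$. Let $q=q_1+tq_2$, regarded as a quadratic form on the vector space $k(t)^3$ over $k(t)$, and let $E^\perp\subset k(t)^3$ be the kernel of its polar form $q(x+y)-q(x)-q(y)$. We write $\mathrm{SO}(k(t)^3,q)$ for the group of linear automorphisms of $k(t)^3$ of determinant $1$ that preserve $q$. Assume that one of the following holds: 1. (type $4$) $q_1,q_2$ span the space of all degree $2$ forms over $k$ vanishing on a $4$-point, with residue field $F$, no three of whose geometric points are collinear; write then $\pi=\pi_F$ and $q=q_F$; 2.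 (type $2+2$) $q_1,q_2$ span the space of all degree $2$ forms over $k$ vanishing on two disjoint $2$-points, with residue fields $L$ and $L'$, such that no three of the four geometric points are collinear; write then $\pi=\pi_{L,L'}$ and $q=q_{L,L'}$. Then: - $q$ is anisotropic, i.e. $q(v)\neq0$ for every nonzero $v\in k(t)^3$; - $q$ is non-degenerate ($E^\perp=0$) if $\operatorname{char}k\neq2$, and has defect $1$ ($\dim E^\perp=1$ and $q$ is anisotropic on $E^\perp$) if $\operatorname{char}k=2$; - there is a group isomorphism $\mathrm{Bir}_k(\mathbb{P}^2/\pi)\simeq\mathrm{SO}(k(t)^3,q)$; - each element of $\mathrm{Bir}_k(\mathbb{P}^2/\pi)$ is a product of at most three involutions (elements of order two) of this group, and of at most two involutions if $\operatorname{char}k\neq2$. -/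

import Mathlib

open MvPolynomial
open scoped LinearAlgebra.Projectivization

noncomputable section

/-! ### Rational maps between projective spaces over a field -/

section RationalMaps

variable {k : Type*} [Field k]

/-- Scaling the argument of a form of degree `d` by `c` multiplies its value by `c ^ d`. -/
theorem aeval_mul_of_isHomogeneous {σ A : Type*} [Fintype σ] [CommRing A]
    [Algebra k A] {d : ℕ} {G : MvPolynomial σ k} (hG : G.IsHomogeneous d) (c : A) (F : σ → A) :
    aeval (fun i => c * F i) G = c ^ d * aeval F G := by
  rw [aeval_def, aeval_def, eval₂_eq', eval₂_eq', Finset.mul_sum]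
  refine Finset.sum_congr rfl fun m hm => ?_
  have hdeg : ∑ i, m i = d := by
    have h := hG (mem_support_iff.mp hm)
    rw [← h, Finsupp.weight_apply, Finsupp.sum_fintype _ _ (by simp)]
    simp
  simp_rw [mul_pow]
  rw [Finset.prod_mul_distrib, Finset.prod_pow_eq_pow_sum, hdeg]
  ring

/-- A representative `[F₀ : ⋯ : Fₙ]` of a rational map `ℙᵐ ⇢ ℙⁿ` defined over `k`: homogeneous
polynomials over `k` of one common degree, in `m + 1` variables, which are not all zero. -/
structure RatRep (k : Type*) [Field k] (m n : ℕ) where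
  coord : Fin (n + 1) → MvPolynomial (Fin (m + 1)) k
  deg : ℕ
  homogeneous : ∀ i, (coord i).IsHomogeneous deg
  exists_ne_zero : ∃ i, coord i ≠ 0

/-- Two representatives define the same rational map iff they are proportional as vectors over
the field of rational functions, that is, iff all `2 × 2` minors vanish. -/
def RatRep.Equiv {m n : ℕ} (F G : RatRep k m n) : Prop :=
  ∀ i j, F.coord i * G.coord j = F.coord j * G.coord i

theorem RatRep.Equiv.symm {m n : ℕ} {F G : RatRep k m n} (h : F.Equiv G) : G.Equiv F :=
  fun i j => by linear_combination - h i j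

theorem RatRep.Equiv.trans {m n : ℕ} {F G H : RatRep k m n} (h₁ : F.Equiv G) (h₂ : G.Equiv H) :
    F.Equiv H := by
  obtain ⟨l, hl⟩ := G.exists_ne_zero
  intro i j
  apply mul_left_cancel₀ hl
  linear_combination H.coord j * h₁ i l + F.coord l * h₂ i j - H.coord i * h₁ j l

theorem RatRep.Equiv.exists_ne_zero {m n : ℕ} {F G : RatRep k m n} (h : F.Equiv G) :
    ∃ l, F.coord l ≠ 0 ∧ G.coord l ≠ 0 := by
  obtain ⟨l, hl⟩ := G.exists_ne_zero
  refine ⟨l, fun h0 => ?_, hl⟩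
  obtain ⟨i, hi⟩ := F.exists_ne_zero
  have := h i l
  rw [h0, zero_mul] at this
  exact (mul_ne_zero hi hl) this

instance RatRep.setoid (k : Type*) [Field k] (m n : ℕ) : Setoid (RatRep k m n) where
  r := RatRep.Equiv
  iseqv := ⟨fun _ _ _ => mul_comm _ _, RatRep.Equiv.symm, RatRep.Equiv.trans⟩

/-- Rational maps `ℙᵐ ⇢ ℙⁿ` defined over `k`. -/
def RatMap (k : Type*) [Field k] (m n : ℕ) : Type _ := Quotient (RatRep.setoid k m n)

theorem RatRep.Equiv.bind₁ {m n : ℕ} {F F' : RatRep k m n} (h : F.Equiv F') {d : ℕ}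
    {G : MvPolynomial (Fin (n + 1)) k} (hG : G.IsHomogeneous d) (l : Fin (n + 1)) :
    F'.coord l ^ d * bind₁ F.coord G = F.coord l ^ d * bind₁ F'.coord G := by
  have h₁ := aeval_mul_of_isHomogeneous hG (F'.coord l) F.coord
  have h₂ := aeval_mul_of_isHomogeneous hG (F.coord l) F'.coord
  have h₃ : (fun i => F'.coord l * F.coord i) = fun i => F.coord l * F'.coord i :=
    funext fun i => by linear_combination h i l
  rw [h₃] at h₁
  exact h₁.symm.trans h₂

/-- A representative of a dominant rational map: no nonzero form on the target vanishes
identically on the image, that is, the image is not contained in a hypersurface. -/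
structure DomRatRep (k : Type*) [Field k] (m n : ℕ) extends RatRep k m n where
  dominant : ∀ (d : ℕ) (H : MvPolynomial (Fin (n + 1)) k), H.IsHomogeneous d → H ≠ 0 →
    bind₁ coord H ≠ 0

instance DomRatRep.setoid (k : Type*) [Field k] (m n : ℕ) : Setoid (DomRatRep k m n) :=
  (RatRep.setoid k m n).comap DomRatRep.toRatRep

/-- Dominant rational maps `ℙᵐ ⇢ ℙⁿ` defined over `k`. -/
def DomRatMap (k : Type*) [Field k] (m n : ℕ) : Type _ := Quotient (DomRatRep.setoid k m n)

/-- The composition `G ∘ F`, obtained by substituting the coordinates of the dominant map `F`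
into those of `G`. -/
def RatRep.comp {m n p : ℕ} (G : RatRep k n p) (F : DomRatRep k m n) : RatRep k m p where
  coord i := bind₁ F.coord (G.coord i)
  deg := F.deg * G.deg
  homogeneous i := (G.homogeneous i).aeval _ F.homogeneous
  exists_ne_zero := G.exists_ne_zero.imp fun i hi => F.dominant _ _ (G.homogeneous i) hi

theorem RatRep.comp_equiv {m n p : ℕ} {G G' : RatRep k n p} {F F' : DomRatRep k m n}
    (hG : G.Equiv G') (hF : F.toRatRep.Equiv F'.toRatRep) :
    (G.comp F).Equiv (G'.comp F') := by
  intro i j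
  obtain ⟨l, hl, -⟩ := hF.exists_ne_zero
  have h₁ := congrArg (MvPolynomial.bind₁ F.coord) (hG i j)
  rw [map_mul, map_mul] at h₁
  have hi := hF.bind₁ (G'.homogeneous i) l
  have hj := hF.bind₁ (G'.homogeneous j) l
  apply mul_left_cancel₀ (pow_ne_zero G'.deg hl)
  change _ * (MvPolynomial.bind₁ F.coord (G.coord i) * MvPolynomial.bind₁ F'.coord (G'.coord j)) =
    _ * (MvPolynomial.bind₁ F.coord (G.coord j) * MvPolynomial.bind₁ F'.coord (G'.coord i))
  linear_combination (F'.coord l) ^ G'.deg * h₁ -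
    MvPolynomial.bind₁ F.coord (G.coord i) * hj + MvPolynomial.bind₁ F.coord (G.coord j) * hi

/-- The composition `g ∘ f` of a rational map `g` with a dominant rational map `f`. -/
def RatMap.comp {m n p : ℕ} : RatMap k n p → DomRatMap k m n → RatMap k m p :=
  Quotient.map₂ RatRep.comp fun _ _ hG _ _ hF => RatRep.comp_equiv hG hF

/-- The composition of two dominant maps is dominant. -/
def DomRatRep.comp {m n p : ℕ} (G : DomRatRep k n p) (F : DomRatRep k m n) : DomRatRep k m p where
  toRatRep := G.toRatRep.comp F
  dominant d H hH h0 := by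
    change bind₁ (fun i => bind₁ F.coord (G.coord i)) H ≠ 0
    rw [← bind₁_bind₁]
    exact F.dominant _ _ (hH.aeval _ G.homogeneous) (G.dominant d H hH h0)

/-- The identity map of `ℙⁿ`. -/
def DomRatRep.id (k : Type*) [Field k] (n : ℕ) : DomRatRep k n n where
  coord := X
  deg := 1
  homogeneous i := isHomogeneous_X k i
  exists_ne_zero := ⟨0, X_ne_zero 0⟩
  dominant d H _ h0 := by
    rw [show (bind₁ X : MvPolynomial (Fin (n + 1)) k →ₐ[k] _) = AlgHom.id k _ from aeval_X_left]
    exact h0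

/-- Dominant rational self-maps of `ℙⁿ` form a monoid under composition, `f * g = f ∘ g`. -/
instance DomRatMap.monoid (k : Type*) [Field k] (n : ℕ) : Monoid (DomRatMap k n n) where
  mul := Quotient.map₂ DomRatRep.comp fun _ _ hG _ _ hF => RatRep.comp_equiv hG hF
  one := Quotient.mk _ (DomRatRep.id k n)
  mul_assoc f g h := by
    induction f using Quotient.inductionOn
    induction g using Quotient.inductionOn
    induction h using Quotient.inductionOn
    rename_i H G F
    refine Quotient.sound fun i j => ?_
    change bind₁ F.coord (bind₁ G.coord (H.coord i)) *
        bind₁ (fun l => bind₁ F.coord (G.coord l)) (H.coord j) =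
      bind₁ F.coord (bind₁ G.coord (H.coord j)) *
        bind₁ (fun l => bind₁ F.coord (G.coord l)) (H.coord i)
    rw [bind₁_bind₁, bind₁_bind₁, mul_comm]
  one_mul f := by
    induction f using Quotient.inductionOn
    rename_i F
    refine Quotient.sound fun i j => ?_
    change bind₁ F.coord (X i) * F.coord j = bind₁ F.coord (X j) * F.coord i
    rw [bind₁_X_right, bind₁_X_right, mul_comm]
  mul_one f := by
    induction f using Quotient.inductionOn
    rename_i F
    refine Quotient.sound fun i j => ?_
    change bind₁ X (F.coord i) * F.coord j = bind₁ X (F.coord j) * F.coord i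
    rw [show (bind₁ X : MvPolynomial (Fin (n + 1)) k →ₐ[k] _) = AlgHom.id k _ from aeval_X_left]
    exact mul_comm _ _

theorem RatMap.comp_one {n p : ℕ} (g : RatMap k n p) : g.comp (1 : DomRatMap k n n) = g := by
  induction g using Quotient.inductionOn
  rename_i G
  refine Quotient.sound fun i j => ?_
  change bind₁ X (G.coord i) * G.coord j = bind₁ X (G.coord j) * G.coord i
  rw [show (bind₁ X : MvPolynomial (Fin (n + 1)) k →ₐ[k] _) = AlgHom.id k _ from aeval_X_left]
  exact mul_comm _ _

theorem RatMap.comp_mul {n p : ℕ} (g : RatMap k n p) (f₁ f₂ : DomRatMap k n n) :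
    g.comp (f₁ * f₂) = (g.comp f₁).comp f₂ := by
  induction g using Quotient.inductionOn
  induction f₁ using Quotient.inductionOn
  induction f₂ using Quotient.inductionOn
  rename_i H G F
  refine Quotient.sound fun i j => ?_
  change bind₁ (fun l => bind₁ F.coord (G.coord l)) (H.coord i) *
      bind₁ F.coord (bind₁ G.coord (H.coord j)) =
    bind₁ (fun l => bind₁ F.coord (G.coord l)) (H.coord j) *
      bind₁ F.coord (bind₁ G.coord (H.coord i))
  rw [bind₁_bind₁, bind₁_bind₁, mul_comm]

/-- The group `Bir_k(ℙⁿ)` of birational self-maps of `ℙⁿ` defined over `k`: the dominant rational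
self-maps which have a rational inverse. -/
abbrev Bir (k : Type*) [Field k] (n : ℕ) : Type _ := (DomRatMap k n n)ˣ

/-- The group `Bir_k(ℙⁿ/π)` of all `f ∈ Bir_k(ℙⁿ)` with `π ∘ f = π`. -/
def birFixing {n p : ℕ} (π : RatMap k n p) : Subgroup (Bir k n) where
  carrier := {f | π.comp (f : DomRatMap k n n) = π}
  one_mem' := π.comp_one
  mul_mem' {f g} hf hg := by
    change π.comp ((f : DomRatMap k n n) * (g : DomRatMap k n n)) = π
    rw [RatMap.comp_mul, show π.comp (f : DomRatMap k n n) = π from hf]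
    exact hg
  inv_mem' {f} hf := by
    change π.comp ((f⁻¹ : Bir k n) : DomRatMap k n n) = π
    conv_lhs => rw [← show π.comp (f : DomRatMap k n n) = π from hf]
    rw [← RatMap.comp_mul, Units.mul_inv, RatMap.comp_one]

end RationalMaps

/-! ### Quadratic forms -/

section QuadraticForms

variable {K : Type*} [Field K]

theorem exists_companion_of_isHomogeneous_two {n : ℕ} (Q : MvPolynomial (Fin n) K)
    (hQ : Q.IsHomogeneous 2) :
    ∃ B : LinearMap.BilinMap K (Fin n → K) K,
      ∀ x y, eval (x + y) Q = eval x Q + eval y Q + B x y := by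
  have key : ∀ d ∈ Q.support, ∃ B : LinearMap.BilinMap K (Fin n → K) K, ∀ x y : Fin n → K,
      eval (x + y) (monomial d (coeff d Q)) = eval x (monomial d (coeff d Q)) +
        eval y (monomial d (coeff d Q)) + B x y := by
    intro d hd
    have h2 : d.degree = 2 := by
      have h := hQ (mem_support_iff.mp hd)
      rw [Finsupp.degree_eq_weight_one]
      exact h
    obtain ⟨i, hi⟩ : ∃ i, d i ≠ 0 := by
      by_contra! h
      have : d = 0 := Finsupp.ext h
      simp [this] at h2
    obtain ⟨e, rfl⟩ : ∃ e, d = Finsupp.single i 1 + e :=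
      ⟨d - Finsupp.single i 1, by
        rw [add_tsub_cancel_of_le]
        simpa using Nat.one_le_iff_ne_zero.mpr hi⟩
    have h1 : e.degree = 1 := by
      rw [map_add, Finsupp.degree_single] at h2
      omega
    obtain ⟨j, hj⟩ : ∃ j, e = Finsupp.single j 1 := by
      obtain ⟨j, hj⟩ : ∃ j, e j ≠ 0 := by
        by_contra! h
        have : e = 0 := Finsupp.ext h
        simp [this] at h1
      have hle : Finsupp.single j 1 ≤ e := by
        simpa using Nat.one_le_iff_ne_zero.mpr hj
      have h0 : (e - Finsupp.single j 1).degree = 0 := by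
        have h := congrArg Finsupp.degree (add_tsub_cancel_of_le hle)
        rw [map_add, Finsupp.degree_single] at h
        omega
      refine ⟨j, ?_⟩
      rw [← add_tsub_cancel_of_le hle, (Finsupp.degree_eq_zero_iff _).mp h0, add_zero]
    subst hj
    refine ⟨coeff (Finsupp.single i 1 + Finsupp.single j 1) Q •
      LinearMap.mk₂ K (fun x y : Fin n → K => x i * y j + x j * y i) ?_ ?_ ?_ ?_, ?_⟩
    · intros; simp only [Pi.add_apply]; ring
    · intros; simp only [Pi.smul_apply, smul_eq_mul]; ring
    · intros; simp only [Pi.add_apply]; ring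
    · intros; simp only [Pi.smul_apply, smul_eq_mul]; ring
    · intro x y
      have hm : ∀ z : Fin n → K, eval z (monomial (Finsupp.single i 1 + Finsupp.single j 1)
          (coeff (Finsupp.single i 1 + Finsupp.single j 1) Q)) =
          coeff (Finsupp.single i 1 + Finsupp.single j 1) Q * (z i * z j) := by
        intro z
        rw [eval_monomial, Finsupp.prod_add_index' (by simp) (by intros; rw [pow_add])]
        simp
      rw [hm, hm, hm]
      simp only [Pi.add_apply, LinearMap.smul_apply, LinearMap.mk₂_apply, smul_eq_mul]
      ring
  choose! B hB using key
  refine ⟨∑ d ∈ Q.support, B d, fun x y => ?_⟩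
  have hs : ∀ z : Fin n → K, eval z Q = ∑ d ∈ Q.support, eval z (monomial d (coeff d Q)) := by
    intro z
    conv_lhs => rw [Q.as_sum]
    rw [map_sum]
  rw [hs, hs x, hs y, Finset.sum_congr rfl fun d hd => hB d hd x y]
  simp [Finset.sum_add_distrib]

/-- The quadratic form `v ↦ Q(v)` on `Kⁿ` given by a homogeneous polynomial of degree two. -/
def quadraticFormOfPoly {n : ℕ} (Q : MvPolynomial (Fin n) K) (hQ : Q.IsHomogeneous 2) :
    QuadraticForm K (Fin n → K) where
  toFun v := eval v Q
  toFun_smul a v := by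
    have h := aeval_mul_of_isHomogeneous hQ a v
    rw [sq] at h
    exact h
  exists_companion' := exists_companion_of_isHomogeneous_two Q hQ

variable {E : Type*} [AddCommGroup E] [Module K E]

/-- The subspace `E^⊥` of all `x` with `b(x, y) = 0` for all `y`, where `b` is the polar form
`b(x, y) = q(x + y) - q(x) - q(y)`. (Dividing `b` by `2` when that is possible does not change
`E^⊥`.) -/
def quadPerp (q : QuadraticForm K E) : Submodule K E := LinearMap.ker q.polarBilin

/-- The polar form of `q` is non-degenerate. -/
def IsNondegenerateQuad (q : QuadraticForm K E) : Prop := quadPerp q = ⊥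

/-- `q` has defect `d ≥ 1`: `E^⊥` has dimension `d` and `q` is anisotropic on `E^⊥`. -/
def HasDefect (q : QuadraticForm K E) (d : ℕ) : Prop :=
  1 ≤ d ∧ Module.finrank K (quadPerp q) = d ∧ ∀ x ∈ quadPerp q, q x = 0 → x = 0

/-- The orthogonal group `O(E, q)`. -/
def orthogonalGroupQuad (q : QuadraticForm K E) : Subgroup (E ≃ₗ[K] E) where
  carrier := {f | ∀ x, q (f x) = q x}
  one_mem' _ := rfl
  mul_mem' {f g} hf hg x := (hf (g x)).trans (hg x)
  inv_mem' {f} hf x := by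
    have h := hf (f⁻¹ x)
    rw [← LinearEquiv.mul_apply, mul_inv_cancel] at h
    exact h.symm

/-- The special orthogonal group `SO(E, q)`: the elements of `O(E, q)` of determinant `1`. -/
def specialOrthogonalGroupQuad (q : QuadraticForm K E) : Subgroup (E ≃ₗ[K] E) :=
  orthogonalGroupQuad q ⊓ (LinearEquiv.det : (E ≃ₗ[K] E) →* Kˣ).ker

end QuadraticForms

/-! ### Points of the plane over the algebraic closure -/

section Points

variable {k : Type*} [Field k]

/-- The geometric points of `ℙ²`, i.e. its points over an algebraic closure of `k`. -/
abbrev GeomPoint (k : Type*) [Field k] : Type _ :=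
  ℙ (AlgebraicClosure k) (Fin 3 → AlgebraicClosure k)

/-- A `k`-automorphism of the algebraic closure acting on coordinate vectors. -/
def galoisVec (g : Gal(AlgebraicClosure k/k)) :
    (Fin 3 → AlgebraicClosure k) →ₛₗ[(g : AlgebraicClosure k →+* AlgebraicClosure k)]
      (Fin 3 → AlgebraicClosure k) where
  toFun v i := g (v i)
  map_add' v w := funext fun i => map_add g (v i) (w i)
  map_smul' c v := funext fun i => map_mul g c (v i)

/-- The Galois action on geometric points, `[a : b : c] ↦ [g a : g b : g c]`. -/
def galoisPoint (g : Gal(AlgebraicClosure k/k)) : GeomPoint k → GeomPoint k :=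
  Projectivization.map (galoisVec g) fun _ _ h => funext fun i => g.injective (congrFun h i)

/-- A `d`-point of `ℙ²`: a Galois orbit of `d` geometric points. -/
def IsDPoint (d : ℕ) (p : Set (GeomPoint k)) : Prop :=
  (∃ x, p = Set.range fun g : Gal(AlgebraicClosure k/k) => galoisPoint g x) ∧ p.ncard = d

/-- The residue field of a geometric point: the extension of `k` generated by the quotients of its
homogeneous coordinates. -/
def residueFieldOf (x : GeomPoint k) : IntermediateField k (AlgebraicClosure k) :=
  IntermediateField.adjoin k
    {a | ∃ i j, x.rep j ≠ 0 ∧ a = x.rep i / x.rep j}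

/-- `F/k` is (up to `k`-isomorphism) the residue field of the `d`-point `p`, i.e. of one of its
geometric components. -/
def HasResidueField (F : Type*) [Field F] [Algebra k F] (p : Set (GeomPoint k)) : Prop :=
  ∃ x ∈ p, Nonempty (F ≃ₐ[k] residueFieldOf x)

/-- No three distinct points of `S` are collinear. -/
def NoThreeCollinear (S : Set (GeomPoint k)) : Prop :=
  ∀ x ∈ S, ∀ y ∈ S, ∀ z ∈ S, x ≠ y → x ≠ z → y ≠ z → Projectivization.Independent ![x, y, z]

end Points

/-! ### Pencils of conics -/

/-- Two linearly independent forms of degree two over `k`, spanning a pencil of conics. -/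
structure ConicPencil (k : Type*) [Field k] where
  q₁ : MvPolynomial (Fin 3) k
  q₂ : MvPolynomial (Fin 3) k
  homogeneous₁ : q₁.IsHomogeneous 2
  homogeneous₂ : q₂.IsHomogeneous 2
  linearIndependent : LinearIndependent k ![q₁, q₂]

namespace ConicPencil

variable {k : Type*} [Field k]

/-- The rational fibration `π = [q₁ : q₂] : ℙ² ⇢ ℙ¹`. -/
def fibration (P : ConicPencil k) : RatMap k 2 1 :=
  Quotient.mk _
    { coord := ![P.q₁, P.q₂]
      deg := 2
      homogeneous := by
        intro i
        fin_cases i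
        · exact P.homogeneous₁
        · exact P.homogeneous₂
      exists_ne_zero := ⟨0, P.linearIndependent.ne_zero 0⟩ }

/-- The quadratic form `q = q₁ + t q₂` on `k(t)³`. -/
def quadForm (P : ConicPencil k) : QuadraticForm (RatFunc k) (Fin 3 → RatFunc k) :=
  quadraticFormOfPoly
    (map (algebraMap k (RatFunc k)) P.q₁ +
      C (RatFunc.X : RatFunc k) * map (algebraMap k (RatFunc k)) P.q₂)
    ((P.homogeneous₁.map _).add (by
      simpa using (isHomogeneous_C (Fin 3) (RatFunc.X : RatFunc k)).mul (P.homogeneous₂.map _)))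

/-- `P` is the pencil of all conics through the points of `S`: a conic over `k` passes through `S`
iff it is a member of the pencil. -/
def IsThrough (P : ConicPencil k) (S : Set (GeomPoint k)) : Prop :=
  ∀ q : MvPolynomial (Fin 3) k, q.IsHomogeneous 2 →
    ((∀ x ∈ S, aeval x.rep q = 0) ↔ q ∈ Submodule.span k {P.q₁, P.q₂})

/-- The pencil of conics through a general `4`-point with residue field `F`. -/
def IsType4 (P : ConicPencil k) (F : Type*) [Field F] [Algebra k F] : Prop :=
  ∃ p : Set (GeomPoint k), IsDPoint 4 p ∧ NoThreeCollinear p ∧ HasResidueField F p ∧ P.IsThrough p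

/-- The pencil of conics through two general `2`-points with residue fields `L` and `L'`. -/
def IsType22 (P : ConicPencil k) (L L' : Type*) [Field L] [Algebra k L] [Field L'] [Algebra k L'] :
    Prop :=
  ∃ p p' : Set (GeomPoint k), IsDPoint 2 p ∧ IsDPoint 2 p' ∧ Disjoint p p' ∧
    NoThreeCollinear (p ∪ p') ∧ HasResidueField L p ∧ HasResidueField L' p' ∧
    P.IsThrough (p ∪ p')

end ConicPencil

/-- `g` is a product of at most `n` involutions, i.e. elements of order two, of the group `G`. -/
def IsProdOfInvolutions {G : Type*} [Group G] (n : ℕ) (g : G) : Prop :=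
  ∃ l : List G, l.length ≤ n ∧ (∀ s ∈ l, orderOf s = 2) ∧ l.prod = g

end

/-! Substituting `t = -q₁/q₂` puts the generic point `[x : y : z]` of the plane on the conic `q = 0`
over `k(t)`, so this conic is the generic fibre of `π`, and a birational map over `π` is an
automorphism of it. Automorphisms of a conic are linear: they are similitudes of `q` up to scalars.
In dimension three each similitude has exactly one multiple in the special orthogonal group, whence
the isomorphism.

Both types enter only through `GeneralBase`: four base points, no three collinear, with Galois
orbits of even size. Over the algebraic closure they become the coordinate points and `[1 : 1 : 1]`,
so every form of the pencil is explicit, the base locus is exactly these points, and `q₁`, `q₂` are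
coprime (`GeneralBase.exists_frame`, `GeneralBase.coprimeForms`).

Anisotropy (`GeneralBase.anisotropic`): an isotropic vector is a polynomial curve `p` of some degree
`d` with `q₁(p) = -t q₂(p)`. As there is no rational base point, `q₂(p)` has odd degree `2d - 1`;
but its zeros are the parameters at which `p` meets the base locus, and they are even in number,
counted with multiplicity, by Galois invariance. Degeneracy is then read off the polar form, which
is nonzero.

Linearity: over the closure the conic is parametrized by a coordinate `u`, on which the map acts by
a Möbius transformation; quadratic polynomials in `u` are linear forms on the conic
(`exists_linear_of_conic`, `PencilFrame.exists_matrix`). The matrix descends to `k(t)` because the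
equations defining it are linear with coefficients over `k` (`CoprimeForms.exists_matrix_of_map`).
Forms vanishing at the generic point are multiples of `q` (`CoprimeForms.dvd_of_eval₂_eq_zero`);
this makes the matrix a similitude, and makes it unique in the special orthogonal group
(`eq_one_of_minors`).

Involutions: half-turns about anisotropic vectors generate enough. Away from characteristic two an
isometry of determinant one has an axis, and a half-turn about a vector orthogonal to the axis turns
it into an element of square one. In characteristic two the radical is fixed pointwise, and two
reflections bring two further independent vectors back. In both cases two involutions suffice. -/

noncomputable section

/-! ### Anisotropic ternary forms: half-turns and products of involutions -/

section Ternary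

variable {K : Type*} [Field K]

theorem polarBilin_self (q : QuadraticForm K (Fin 3 → K)) (x : Fin 3 → K) :
    q.polarBilin x x = 2 * q x := by
  simp [QuadraticMap.polar_self]

theorem polarBilin_symm (q : QuadraticForm K (Fin 3 → K)) (x y : Fin 3 → K) :
    q.polarBilin x y = q.polarBilin y x := by
  simp [QuadraticMap.polar_comm]

theorem map_add_polarBilin (q : QuadraticForm K (Fin 3 → K)) (x y : Fin 3 → K) :
    q (x + y) = q x + q y + q.polarBilin x y := by
  simp [QuadraticMap.polar]

theorem polarBilin_map {q : QuadraticForm K (Fin 3 → K)} {g : (Fin 3 → K) ≃ₗ[K] (Fin 3 → K)}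
    (hg : ∀ x, q (g x) = q x) (x y : Fin 3 → K) :
    q.polarBilin (g x) (g y) = q.polarBilin x y := by
  simp only [QuadraticMap.polarBilin_apply_apply, QuadraticMap.polar, ← map_add, hg]

/-- Half-turns are the negatives of reflections; in characteristic two they are the reflections. -/
def halfTurnMap (q : QuadraticForm K (Fin 3 → K)) (u : Fin 3 → K) :
    (Fin 3 → K) →ₗ[K] (Fin 3 → K) :=
  ((q u)⁻¹ • q.polarBilin u).smulRight u - LinearMap.id

theorem halfTurnMap_apply (q : QuadraticForm K (Fin 3 → K)) (u x : Fin 3 → K) :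
    halfTurnMap q u x = ((q u)⁻¹ * q.polarBilin u x) • u - x := rfl

theorem halfTurnMap_halfTurnMap {q : QuadraticForm K (Fin 3 → K)} {u : Fin 3 → K} (hu : q u ≠ 0)
    (x : Fin 3 → K) : halfTurnMap q u (halfTurnMap q u x) = x := by
  rw [halfTurnMap_apply, halfTurnMap_apply, map_sub, map_smul, polarBilin_self, smul_eq_mul]
  have : (q u)⁻¹ * ((q u)⁻¹ * q.polarBilin u x * (2 * q u) - q.polarBilin u x) =
      (q u)⁻¹ * q.polarBilin u x := by
    field_simp
    ring
  rw [this]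
  abel

/-- The half-turn about a vector `u` with `q u ≠ 0`. -/
def halfTurn (q : QuadraticForm K (Fin 3 → K)) {u : Fin 3 → K} (hu : q u ≠ 0) :
    (Fin 3 → K) ≃ₗ[K] (Fin 3 → K) :=
  LinearEquiv.ofInvolutive (halfTurnMap q u) (halfTurnMap_halfTurnMap hu)

theorem halfTurn_apply (q : QuadraticForm K (Fin 3 → K)) {u : Fin 3 → K} (hu : q u ≠ 0)
    (x : Fin 3 → K) : halfTurn q hu x = ((q u)⁻¹ * q.polarBilin u x) • u - x := rfl

theorem halfTurn_mul_self (q : QuadraticForm K (Fin 3 → K)) {u : Fin 3 → K} (hu : q u ≠ 0) :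
    halfTurn q hu * halfTurn q hu = 1 :=
  LinearEquiv.ext (halfTurnMap_halfTurnMap hu)

theorem map_halfTurn (q : QuadraticForm K (Fin 3 → K)) {u : Fin 3 → K} (hu : q u ≠ 0)
    (x : Fin 3 → K) : q (halfTurn q hu x) = q x := by
  rw [halfTurn_apply, sub_eq_add_neg, map_add_polarBilin, QuadraticMap.map_neg,
    QuadraticMap.map_smul, map_neg, map_smul, LinearMap.smul_apply]
  simp only [smul_eq_mul]
  field_simp
  ring

/-- In dimension three, `f(·)u - id` has determinant `f(u) - 1`, and here `f(u) = b(u, u) / q(u) =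
2`. This is valid in every characteristic. -/
theorem det_halfTurn (q : QuadraticForm K (Fin 3 → K)) {u : Fin 3 → K} (hu : q u ≠ 0) :
    LinearEquiv.det (halfTurn q hu) = 1 := by
  ext
  rw [LinearEquiv.coe_det, ← LinearMap.det_toMatrix', Matrix.det_fin_three]
  have hf := polarBilin_self q u
  have hs : u = u 0 • Pi.single 0 1 + u 1 • Pi.single 1 1 + u 2 • Pi.single 2 1 := by
    ext i; fin_cases i <;> simp
  rw [show q.polarBilin u u = q.polarBilin u (u 0 • Pi.single 0 1 + u 1 • Pi.single 1 1 +
    u 2 • Pi.single 2 1) by rw [← hs]] at hf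
  simp only [map_add, map_smul, smul_eq_mul] at hf
  have e : ∀ i j, LinearMap.toMatrix' (halfTurn q hu : (Fin 3 → K) →ₗ[K] (Fin 3 → K)) i j =
      (q u)⁻¹ * q.polarBilin u (Pi.single j 1) * u i - (Pi.single j 1 : Fin 3 → K) i := by
    intro i j
    simp only [LinearMap.toMatrix'_apply, LinearEquiv.coe_coe, halfTurn_apply]
    simp
  simp only [e]
  generalize q.polarBilin u (Pi.single 0 1) = f0 at *
  generalize q.polarBilin u (Pi.single 1 1) = f1 at *
  generalize q.polarBilin u (Pi.single 2 1) = f2 at *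
  simp
  linear_combination (q u)⁻¹ * hf + 2 * inv_mul_cancel₀ hu

theorem halfTurn_mem (q : QuadraticForm K (Fin 3 → K)) {u : Fin 3 → K} (hu : q u ≠ 0) :
    halfTurn q hu ∈ specialOrthogonalGroupQuad q :=
  ⟨map_halfTurn q hu, MonoidHom.mem_ker.mpr (det_halfTurn q hu)⟩

theorem halfTurn_ne_one {q : QuadraticForm K (Fin 3 → K)} {u : Fin 3 → K} (hu : q u ≠ 0)
    {x : Fin 3 → K} (hx : halfTurn q hu x ≠ x) : halfTurn q hu ≠ 1 := by
  rintro h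
  rw [h] at hx
  exact hx rfl

/-- Write `g = s * (s * g)`; the second factor is an involution or trivial. -/
theorem isProdOfInvolutions_two_of_mul_self {G : Type*} [Group G] {g s : G} (hs : orderOf s = 2)
    (h : (s * g) * (s * g) = 1) : IsProdOfInvolutions 2 g := by
  have hss : s * s = 1 := by rw [← sq, ← hs, pow_orderOf_eq_one]
  by_cases h1 : s * g = 1
  · refine ⟨[s], by simp, by simpa using hs, ?_⟩
    simpa using (mul_left_cancel (h1.trans hss.symm)).symm
  · refine ⟨[s, s * g], by simp, ?_, by simp [← mul_assoc, hss]⟩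
    simp only [List.mem_cons, List.not_mem_nil, or_false, forall_eq_or_imp, forall_eq]
    exact ⟨hs, orderOf_eq_prime (by rw [sq, h]) h1⟩

theorem orderOf_halfTurn {q : QuadraticForm K (Fin 3 → K)} {u : Fin 3 → K} (hu : q u ≠ 0)
    {x : Fin 3 → K} (hx : halfTurn q hu x ≠ x) :
    orderOf (⟨halfTurn q hu, halfTurn_mem q hu⟩ : specialOrthogonalGroupQuad q) = 2 := by
  refine orderOf_eq_prime (Subtype.ext ?_) fun h => halfTurn_ne_one hu hx (congrArg Subtype.val h)
  rw [sq]
  exact halfTurn_mul_self q hu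

theorem exists_ne_zero_orthogonal (q : QuadraticForm K (Fin 3 → K)) (v w : Fin 3 → K) :
    ∃ y, y ≠ 0 ∧ q.polarBilin v y = 0 ∧ q.polarBilin w y = 0 := by
  have h : LinearMap.ker ((q.polarBilin v).prod (q.polarBilin w)) ≠ ⊥ := by
    apply LinearMap.ker_ne_bot_of_finrank_lt
    simp
  obtain ⟨y, hy, hy0⟩ := Submodule.exists_mem_ne_zero_of_ne_bot h
  rw [LinearMap.mem_ker] at hy
  exact ⟨y, hy0, congrArg Prod.fst hy, congrArg Prod.snd hy⟩

/-- An orthogonal basis. -/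
theorem exists_eq_combination_of_orthogonal (h2 : (2 : K) ≠ 0)
    {q : QuadraticForm K (Fin 3 → K)} (hq : q.Anisotropic) {v : Fin 3 → Fin 3 → K}
    (hv : ∀ i, v i ≠ 0) (ho : ∀ i j, i ≠ j → q.polarBilin (v i) (v j) = 0) (x : Fin 3 → K) :
    ∃ c : Fin 3 → K, x = ∑ i, c i • v i := by
  have hli : LinearIndependent K v := by
    rw [Fintype.linearIndependent_iff]
    intro c hc i
    have h := congrArg (q.polarBilin (v i)) hc
    rw [map_sum, map_zero, Finset.sum_eq_single i] at h
    · rw [map_smul, polarBilin_self, smul_eq_mul] at h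
      have : q (v i) ≠ 0 := fun h => hv i (hq _ h)
      simp_all
    · intro j _ hj
      rw [map_smul, ho i j hj.symm, smul_zero]
    · simp
  have ht := hli.span_eq_top_of_card_eq_finrank (by simp)
  have hx : x ∈ Submodule.span K (Set.range v) := ht ▸ Submodule.mem_top
  obtain ⟨c, hc⟩ := (Submodule.mem_span_range_iff_exists_fun K).mp hx
  exact ⟨c, hc.symm⟩

theorem eq_smul_of_orthogonal (h2 : (2 : K) ≠ 0)
    {q : QuadraticForm K (Fin 3 → K)} (hq : q.Anisotropic) {v : Fin 3 → Fin 3 → K}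
    (hv : ∀ i, v i ≠ 0) (ho : ∀ i j, i ≠ j → q.polarBilin (v i) (v j) = 0) {x : Fin 3 → K}
    (h0 : q.polarBilin (v 0) x = 0) (h1 : q.polarBilin (v 1) x = 0) : ∃ c : K, x = c • v 2 := by
  obtain ⟨c, rfl⟩ := exists_eq_combination_of_orthogonal h2 hq hv ho x
  have hn : ∀ i, q (v i) ≠ 0 := fun i h => hv i (hq _ h)
  have hn0 := hn 0
  have hn1 := hn 1
  simp only [Fin.sum_univ_three, map_add, map_smul, smul_eq_mul, polarBilin_self,
    ho 0 1 (by decide), ho 0 2 (by decide), ho 1 0 (by decide), ho 1 2 (by decide)] at h0 h1 ⊢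
  refine ⟨c 2, ?_⟩
  have e0 : c 0 = 0 := by simp_all
  have e1 : c 1 = 0 := by simp_all
  simp [e0, e1]

theorem polarBilin_toMatrix (q : QuadraticForm K (Fin 3 → K)) (x y : Fin 3 → K) :
    q.polarBilin x y = x ⬝ᵥ ((LinearMap.toMatrix₂' K q.polarBilin).mulVec y) := by
  rw [← Matrix.toLinearMap₂'_apply', Matrix.toLinearMap₂'_toMatrix']

theorem det_toMatrix_polarBilin_ne_zero (h2 : (2 : K) ≠ 0) {q : QuadraticForm K (Fin 3 → K)}
    (hq : q.Anisotropic) : (LinearMap.toMatrix₂' K q.polarBilin).det ≠ 0 := by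
  intro h
  obtain ⟨v, hv, hv0⟩ := Matrix.exists_mulVec_eq_zero_iff.mpr h
  have := polarBilin_toMatrix q v v
  rw [hv0, dotProduct_zero, polarBilin_self] at this
  exact hv (hq _ (by simpa [h2] using this))

/-- Euler's axis theorem: if `M` preserves the Gram matrix `G`, then `Mᵀ G (M - 1) = (1 - M)ᵀ G`. In
odd dimension the determinants of the two sides differ by a sign, so `det (M - 1) = 0`. -/
theorem exists_fixed_vector (h2 : (2 : K) ≠ 0) {q : QuadraticForm K (Fin 3 → K)}
    (hq : q.Anisotropic) {g : (Fin 3 → K) ≃ₗ[K] (Fin 3 → K)}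
    (hg : g ∈ specialOrthogonalGroupQuad q) : ∃ v, v ≠ 0 ∧ g v = v := by
  set G := LinearMap.toMatrix₂' K q.polarBilin with hG
  set M := LinearMap.toMatrix' (g : (Fin 3 → K) →ₗ[K] (Fin 3 → K)) with hM
  have hMv : ∀ x, M.mulVec x = g x := fun x => by
    rw [hM, LinearMap.toMatrix'_mulVec]; rfl
  have hdet : M.det = 1 := by
    have := congrArg Units.val (MonoidHom.mem_ker.mp hg.2)
    rwa [LinearEquiv.coe_det, ← LinearMap.det_toMatrix'] at this
  have hMG : M.transpose * G * M = G := by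
    rw [← LinearMap.toMatrix₂'_compl₁₂]
    exact congrArg _ (LinearMap.ext₂ fun x y => polarBilin_map hg.1 x y)
  have h1 : M.transpose * G * (M - 1) = (1 - M).transpose * G := by
    rw [Matrix.mul_sub, hMG, Matrix.transpose_sub, Matrix.transpose_one, Matrix.sub_mul]
    simp
  have h3 := congrArg Matrix.det h1
  rw [Matrix.det_mul, Matrix.det_mul, Matrix.det_mul, Matrix.det_transpose, Matrix.det_transpose,
    hdet, show (1 - M : Matrix (Fin 3) (Fin 3) K) = -(M - 1) by abel, Matrix.det_neg] at h3
  have hGd : G.det ≠ 0 := det_toMatrix_polarBilin_ne_zero h2 hq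
  have h4 : (M - 1).det = 0 := by
    have : 2 * G.det * (M - 1).det = 0 := by
      simp at h3
      linear_combination h3
    simpa [h2, hGd] using this
  obtain ⟨v, hv, hv0⟩ := Matrix.exists_mulVec_eq_zero_iff.mpr h4
  refine ⟨v, hv, ?_⟩
  rw [Matrix.sub_mulVec, Matrix.one_mulVec, hMv] at hv0
  exact sub_eq_zero.mp hv0

/-- The axis `w` is orthogonal to `v`, since `b(v, w) = b(-v, w)`. The orthogonal complement of both
is an invariant line, on which an isometry is a scalar of square one; so `g` is diagonal with
entries of square one. -/
theorem mul_self_eq_one_of_neg_vector (h2 : (2 : K) ≠ 0) {q : QuadraticForm K (Fin 3 → K)}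
    (hq : q.Anisotropic) {g : (Fin 3 → K) ≃ₗ[K] (Fin 3 → K)}
    (hg : g ∈ specialOrthogonalGroupQuad q) {v : Fin 3 → K} (hv : v ≠ 0) (hgv : g v = -v) :
    g * g = 1 := by
  obtain ⟨w, hw, hgw⟩ := exists_fixed_vector h2 hq hg
  have hgb := polarBilin_map (q := q) (g := g) hg.1
  have hvw : q.polarBilin v w = 0 := by
    have := hgb v w
    rw [hgv, hgw, map_neg, LinearMap.neg_apply] at this
    have h : 2 * q.polarBilin v w = 0 := by linear_combination -this
    simpa [h2] using h
  obtain ⟨y, hy, hvy, hwy⟩ := exists_ne_zero_orthogonal q v w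
  have hb : ∀ i, ![v, w, y] i ≠ 0 := by intro i; fin_cases i <;> simpa
  have ho : ∀ i j, i ≠ j → q.polarBilin (![v, w, y] i) (![v, w, y] j) = 0 := by
    intro i j hij
    have h1 := polarBilin_symm q w v
    have h2 := polarBilin_symm q y v
    have h3 := polarBilin_symm q y w
    fin_cases i <;> fin_cases j <;> first | exact absurd rfl hij | skip
    all_goals simp only [Fin.zero_eta, Fin.mk_one, Fin.reduceFinMk, Matrix.cons_val]
    · exact hvw
    · exact hvy
    · rw [h1, hvw]
    · exact hwy
    · rw [h2, hvy]
    · rw [h3, hwy]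
  obtain ⟨c, hc⟩ := eq_smul_of_orthogonal h2 hq hb ho (x := g y)
    (by
      have := hgb v y
      rw [hgv, map_neg, LinearMap.neg_apply, hvy] at this
      simpa using this)
    (by
      have := hgb w y
      rw [hgw, hwy] at this
      simpa using this)
  simp only [Matrix.cons_val] at hc
  have hcc : c * c = 1 := by
    have := hg.1 y
    rw [hc, QuadraticMap.map_smul, smul_eq_mul] at this
    have hqy : q y ≠ 0 := fun h => hy (hq _ h)
    exact mul_right_cancel₀ hqy (by rw [this, one_mul])
  ext1 x
  obtain ⟨d, rfl⟩ := exists_eq_combination_of_orthogonal h2 hq hb ho x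
  simp only [LinearEquiv.mul_apply, Fin.sum_univ_three, Matrix.cons_val, map_add, map_smul,
    hgv, hgw, hc, map_neg, neg_neg, LinearEquiv.coe_one, id_eq, smul_smul]
  rw [hcc, mul_one]

/-- The half-turn about a vector orthogonal to the axis of `g` negates the axis, so its product with
`g` negates a vector and squares to one. -/
theorem isProdOfInvolutions_of_two_ne_zero (h2 : (2 : K) ≠ 0) {q : QuadraticForm K (Fin 3 → K)}
    (hq : q.Anisotropic) (g : specialOrthogonalGroupQuad q) : IsProdOfInvolutions 2 g := by
  obtain ⟨v, hv, hgv⟩ := exists_fixed_vector h2 hq g.2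
  obtain ⟨u, hu, hvu, -⟩ := exists_ne_zero_orthogonal q v v
  have hqu : q u ≠ 0 := fun h => hu (hq _ h)
  have hsv : halfTurn q hqu v = -v := by
    rw [halfTurn_apply, polarBilin_symm, hvu]
    simp
  refine isProdOfInvolutions_two_of_mul_self (orderOf_halfTurn hqu (x := v) ?_) (Subtype.ext ?_)
  · rw [hsv]
    intro h
    have : (2 : K) • v = 0 := by
      rw [two_smul]; nth_rw 1 [← h]; simp
    exact hv ((smul_eq_zero.mp this).resolve_left h2)
  · refine mul_self_eq_one_of_neg_vector h2 hq (v := v)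
      ((specialOrthogonalGroupQuad q).mul_mem (halfTurn_mem q hqu) g.2) hv ?_
    change halfTurn q hqu (g.1 v) = -v
    rw [hgv, hsv]

/-- The step of the Cartan–Dieudonné argument: `q (g y) = q y` gives `b(g y - y, g y) = q(g y - y)`,
so the reflection along `g y - y` takes `g y` back to `y`. -/
theorem halfTurn_sub_apply (h2 : (2 : K) = 0) {q : QuadraticForm K (Fin 3 → K)}
    {g : (Fin 3 → K) ≃ₗ[K] (Fin 3 → K)} (hg : ∀ x, q (g x) = q x) (y : Fin 3 → K)
    (hu : q (g y - y) ≠ 0) : halfTurn q hu (g y) = y ∧ halfTurn q hu y ≠ y := by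
  have hb : q.polarBilin (g y - y) (g y) = q (g y - y) := by
    have := map_add_polarBilin q (g y - y) y
    rw [sub_add_cancel, hg] at this
    have h3 : q.polarBilin (g y - y) (g y) = q.polarBilin (g y - y) (g y - y) +
        q.polarBilin (g y - y) y := by rw [← map_add, sub_add_cancel]
    rw [polarBilin_self] at h3
    linear_combination h3 - this
  have h1 : halfTurn q hu (g y) = -y := by
    rw [halfTurn_apply, hb, inv_mul_cancel₀ hu]
    simp
  have hneg : -y = y := by
    rw [neg_eq_iff_add_eq_zero, ← two_smul K, h2, zero_smul]
  rw [hneg] at h1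
  refine ⟨h1, fun h => ?_⟩
  have := (halfTurn q hu).injective (h1.trans h.symm)
  rw [this] at hu
  simp at hu

theorem halfTurn_apply_of_orthogonal (h2 : (2 : K) = 0) {q : QuadraticForm K (Fin 3 → K)}
    {u x : Fin 3 → K} (hu : q u ≠ 0) (hx : q.polarBilin u x = 0) : halfTurn q hu x = x := by
  rw [halfTurn_apply, hx]
  rw [mul_zero, zero_smul, zero_sub, neg_eq_iff_add_eq_zero, ← two_smul K, h2, zero_smul]

/-- All isometries fix a generator `e` of the radical, so only two more independent vectors have to
be brought back, at the cost of one reflection each. -/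
theorem isProdOfInvolutions_of_two_eq_zero (h2 : (2 : K) = 0) {q : QuadraticForm K (Fin 3 → K)}
    (hq : q.Anisotropic) (hd : HasDefect q 1) (g : specialOrthogonalGroupQuad q) :
    IsProdOfInvolutions 2 g := by
  obtain ⟨-, hd1, -⟩ := hd
  obtain ⟨⟨e, he⟩, hne, hspan⟩ := finrank_eq_one_iff'.mp hd1
  have he0 : e ≠ 0 := fun h => hne (Subtype.ext h)
  have hqe : q e ≠ 0 := fun h => he0 (hq _ h)
  have hbe : ∀ x, q.polarBilin e x = 0 := fun x => by
    rw [quadPerp, LinearMap.mem_ker] at he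
    rw [he, LinearMap.zero_apply]
  have hge : ∀ f ∈ specialOrthogonalGroupQuad q, f e = e := by
    intro f hf
    have hfe : f e ∈ quadPerp q := by
      rw [quadPerp, LinearMap.mem_ker]
      refine LinearMap.ext fun x => ?_
      obtain ⟨x, rfl⟩ := f.surjective x
      rw [polarBilin_map hf.1, hbe]
      rfl
    obtain ⟨c, hc⟩ := hspan ⟨f e, hfe⟩
    have hc : c • e = f e := congrArg Subtype.val hc
    have h1 := hf.1 e
    rw [← hc, QuadraticMap.map_smul, smul_eq_mul] at h1
    -- From `c² = 1`, as `c² - 1 = (c - 1)²` in characteristic two.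
    have h3 : (c - 1) * (c - 1) = 0 := by
      apply mul_right_cancel₀ hqe
      linear_combination h1 - (c * q e - q e) * h2
    have : c = 1 := by simpa [sub_eq_zero] using h3
    rw [← hc, this, one_smul]
  by_cases hg1 : g = 1
  · exact ⟨[], by simp, by simp, by simp [hg1]⟩
  obtain ⟨y, hy⟩ : ∃ y, g.1 y ≠ y := by
    by_contra! h
    exact hg1 (Subtype.ext (LinearEquiv.ext h))
  have hu : q (g.1 y - y) ≠ 0 := fun h => hy (sub_eq_zero.mp (hq _ h))
  have hu1 := halfTurn_sub_apply h2 g.2.1 y hu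
  set s : specialOrthogonalGroupQuad q := ⟨halfTurn q hu, halfTurn_mem q hu⟩ with hs
  refine isProdOfInvolutions_two_of_mul_self (s := s) (orderOf_halfTurn hu hu1.2) ?_
  set b := s * g with hb
  have hby : b.1 y = y := hu1.1
  by_cases hb1 : b = 1
  · rw [hb1, mul_one]
  obtain ⟨z, hz⟩ : ∃ z, b.1 z ≠ z := by
    by_contra! h
    exact hb1 (Subtype.ext (LinearEquiv.ext h))
  have hw : q (b.1 z - z) ≠ 0 := fun h => hz (sub_eq_zero.mp (hq _ h))
  have hw1 := halfTurn_sub_apply h2 b.2.1 z hw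
  set s' : specialOrthogonalGroupQuad q := ⟨halfTurn q hw, halfTurn_mem q hw⟩ with hs'
  -- Then `b` is the inverse of the involution `s'`, so `b * b = 1`.
  suffices h : s' * b = 1 by
    rw [eq_inv_of_mul_eq_one_right h, ← mul_inv_rev, inv_eq_one]
    exact Subtype.ext (halfTurn_mul_self q hw)
  set F : Submodule K (Fin 3 → K) :=
    LinearMap.eqLocus ((s' * b).1 : (Fin 3 → K) →ₗ[K] (Fin 3 → K)) LinearMap.id with hF
  have hFz : z ∈ F := hw1.1
  -- The second reflection does not spoil `y`: as `b` fixes `y`, the vector `b z - z` is orthogonal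
  -- to `y`.
  have hFy : y ∈ F := by
    change s'.1 (b.1 y) = y
    rw [hby]
    refine halfTurn_apply_of_orthogonal h2 hw ?_
    have := polarBilin_map b.2.1 z y
    rw [hby] at this
    rw [LinearMap.map_sub₂, this, sub_self]
  have hFe : e ∈ F := hge _ (s' * b).2
  -- Independence comes from the maps: `g` fixes `e` but moves `y`, and `b` fixes `e` and `y` but
  -- moves `z`. The fixed space `F` is therefore three-dimensional.
  have h1 : Submodule.span K {e} < Submodule.span K {e, y} := by
    refine lt_of_le_of_ne (Submodule.span_mono (by simp)) fun h => hy ?_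
    have : y ∈ Submodule.span K {e} := h ▸ Submodule.subset_span (by simp)
    obtain ⟨c, rfl⟩ := Submodule.mem_span_singleton.mp this
    rw [map_smul, hge _ g.2]
  have h3 : Submodule.span K {e, y} < Submodule.span K {e, y, z} := by
    refine lt_of_le_of_ne (Submodule.span_mono (by intro x; simp; tauto)) fun h => hz ?_
    have : z ∈ Submodule.span K {e, y} := h ▸ Submodule.subset_span (by simp)
    obtain ⟨c, d, rfl⟩ := Submodule.mem_span_pair.mp this
    rw [map_add, map_smul, map_smul, hge _ b.2, hby]
  have h4 : Submodule.span K {e, y, z} ≤ F := by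
    rw [Submodule.span_le]
    rintro x (rfl | rfl | rfl)
    exacts [hFe, hFy, hFz]
  have d1 := finrank_span_singleton (K := K) he0
  have d2 := Submodule.finrank_lt_finrank_of_lt h1
  have d3 := Submodule.finrank_lt_finrank_of_lt h3
  have d4 := Submodule.finrank_mono h4
  have d5 : Module.finrank K F ≤ 3 := by simpa using Submodule.finrank_le F
  have hFt : F = ⊤ := Submodule.eq_top_of_finrank_eq (by simp; omega)
  refine Subtype.ext (LinearEquiv.ext fun x => ?_)
  have : x ∈ F := hFt ▸ Submodule.mem_top
  exact this

theorem isNondegenerateQuad_of_anisotropic (h2 : (2 : K) ≠ 0) {q : QuadraticForm K (Fin 3 → K)}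
    (hq : q.Anisotropic) : IsNondegenerateQuad q := by
  rw [IsNondegenerateQuad, Submodule.eq_bot_iff]
  intro x hx
  rw [quadPerp, LinearMap.mem_ker] at hx
  have := polarBilin_self q x
  rw [hx, LinearMap.zero_apply] at this
  exact hq _ (by simpa [h2] using this.symm)

end Ternary
end

noncomputable section

/-! ### The half-discriminant and similitudes -/

section HalfDiscriminant

variable {K : Type*} [Field K]

theorem map_eq_coordinates (q : QuadraticForm K (Fin 3 → K)) (e : Fin 3 → Fin 3 → K)
    (x : Fin 3 → K) :
    q (∑ i, x i • e i) = q (e 0) * x 0 ^ 2 + q (e 1) * x 1 ^ 2 + q (e 2) * x 2 ^ 2 +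
      q.polarBilin (e 1) (e 2) * (x 1 * x 2) + q.polarBilin (e 0) (e 2) * (x 0 * x 2) +
      q.polarBilin (e 0) (e 1) * (x 0 * x 1) := by
  simp only [Fin.sum_univ_three, map_add_polarBilin, QuadraticMap.map_smul, map_add, map_smul,
    LinearMap.add_apply, LinearMap.smul_apply, smul_eq_mul]
  ring

theorem polarBilin_eq_coordinates (q : QuadraticForm K (Fin 3 → K)) (e : Fin 3 → Fin 3 → K)
    (x y : Fin 3 → K) :
    q.polarBilin (∑ i, x i • e i) (∑ i, y i • e i) =
      2 * (q (e 0) * (x 0 * y 0) + q (e 1) * (x 1 * y 1) + q (e 2) * (x 2 * y 2)) +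
      q.polarBilin (e 1) (e 2) * (x 1 * y 2 + x 2 * y 1) +
      q.polarBilin (e 0) (e 2) * (x 0 * y 2 + x 2 * y 0) +
      q.polarBilin (e 0) (e 1) * (x 0 * y 1 + x 1 * y 0) := by
  simp only [Fin.sum_univ_three, map_add, map_smul,
    LinearMap.add_apply, LinearMap.smul_apply, smul_eq_mul, polarBilin_self,
    polarBilin_symm q (e 1) (e 0), polarBilin_symm q (e 2) (e 0), polarBilin_symm q (e 2) (e 1)]
  ring

/-- The half-discriminant of a ternary quadratic form in the frame `e`. -/
def halfDisc (q : QuadraticForm K (Fin 3 → K)) (e : Fin 3 → Fin 3 → K) : K :=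
  4 * q (e 0) * q (e 1) * q (e 2) +
    q.polarBilin (e 1) (e 2) * q.polarBilin (e 0) (e 2) * q.polarBilin (e 0) (e 1) -
    q (e 0) * q.polarBilin (e 1) (e 2) ^ 2 - q (e 1) * q.polarBilin (e 0) (e 2) ^ 2 -
    q (e 2) * q.polarBilin (e 0) (e 1) ^ 2

/-- The Gram determinant is twice `halfDisc` and so vanishes in characteristic two; `halfDisc` obeys
the same transformation law there and can remain nonzero. -/
theorem halfDisc_combination (q : QuadraticForm K (Fin 3 → K)) (e : Fin 3 → Fin 3 → K)
    (M : Matrix (Fin 3) (Fin 3) K) :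
    halfDisc q (fun j => ∑ i, M i j • e i) = M.det ^ 2 * halfDisc q e := by
  simp only [halfDisc, map_eq_coordinates q e (fun i => M i _),
    polarBilin_eq_coordinates q e (fun i => M i _) (fun i => M i _), Matrix.det_fin_three]
  ring

theorem halfDisc_ne_zero_of_anisotropic {q : QuadraticForm K (Fin 3 → K)} (hq : q.Anisotropic)
    (hn : q.polarBilin ≠ 0) : halfDisc q (fun i => Pi.single i 1) ≠ 0 := by
  have hb : ∀ x : Fin 3 → K, x = ∑ i, x i • (Pi.single i 1 : Fin 3 → K) := fun x => by
    ext j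
    simp [Finset.sum_apply, Pi.single_apply]
  by_cases h2 : (2 : K) = 0
  · intro h
    -- In characteristic two the polar form is alternating and this vector, made of its three
    -- entries, lies in its radical; the half-discriminant is just `q v`.
    set v : Fin 3 → K := ![q.polarBilin (Pi.single 1 1) (Pi.single 2 1),
      q.polarBilin (Pi.single 0 1) (Pi.single 2 1), q.polarBilin (Pi.single 0 1) (Pi.single 1 1)]
      with hv
    have h1 : q v = 0 := by
      rw [hb v, map_eq_coordinates]
      simp only [halfDisc] at h
      simp only [hv, Matrix.cons_val]
      linear_combination - h + (2 * q (Pi.single 0 1) * q (Pi.single 1 1) * q (Pi.single 2 1) +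
        2 * q.polarBilin (Pi.single 1 1) (Pi.single 2 1) *
        q.polarBilin (Pi.single 0 1) (Pi.single 2 1) *
        q.polarBilin (Pi.single 0 1) (Pi.single 1 1)) * h2
    have h0 := hq _ h1
    refine hn (LinearMap.ext₂ fun x y => ?_)
    rw [hb x, hb y, polarBilin_eq_coordinates]
    have e0 : q.polarBilin (Pi.single 1 1) (Pi.single 2 1) = 0 := congrFun h0 0
    have e1 : q.polarBilin (Pi.single 0 1) (Pi.single 2 1) = 0 := congrFun h0 1
    have e2 : q.polarBilin (Pi.single 0 1) (Pi.single 1 1) = 0 := congrFun h0 2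
    rw [e0, e1, e2, h2]
    simp
  · intro h
    apply det_toMatrix_polarBilin_ne_zero h2 hq
    rw [Matrix.det_fin_three]
    simp only [LinearMap.toMatrix₂'_apply, polarBilin_self,
      polarBilin_symm q (Pi.single 1 1) (Pi.single 0 1),
      polarBilin_symm q (Pi.single 2 1) (Pi.single 0 1),
      polarBilin_symm q (Pi.single 2 1) (Pi.single 1 1)]
    simp only [halfDisc] at h
    linear_combination 2 * h

/-- The multiplier `c` of a similitude `f` of a ternary form satisfies `(det f)² = c³`. -/
theorem det_sq_of_similitude {q : QuadraticForm K (Fin 3 → K)} (hq : q.Anisotropic)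
    (hn : q.polarBilin ≠ 0) {f : (Fin 3 → K) →ₗ[K] (Fin 3 → K)} {c : K}
    (h : ∀ v, q (f v) = c * q v) : LinearMap.det f ^ 2 = c ^ 3 := by
  have hb : ∀ x y, q.polarBilin (f x) (f y) = c * q.polarBilin x y := fun x y => by
    simp only [QuadraticMap.polarBilin_apply_apply, QuadraticMap.polar, ← map_add, h]
    ring
  apply mul_right_cancel₀ (halfDisc_ne_zero_of_anisotropic hq hn)
  rw [← LinearMap.det_toMatrix', ← halfDisc_combination]
  have : ∀ j, ∑ i, LinearMap.toMatrix' f i j • (Pi.single i 1 : Fin 3 → K) =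
      f (Pi.single j 1) := fun j => by
    ext l
    simp [Finset.sum_apply, Pi.single_apply, LinearMap.toMatrix'_apply]
  simp only [this]
  simp only [halfDisc, h, hb]
  ring

/-- The scalar is `c / det f`. By `(det f)² = c³` it turns both the multiplier `c` and the
determinant into `1`. -/
theorem exists_smul_mem_specialOrthogonalGroupQuad {q : QuadraticForm K (Fin 3 → K)}
    (hq : q.Anisotropic) (hn : q.polarBilin ≠ 0) {f : (Fin 3 → K) →ₗ[K] (Fin 3 → K)} {c : K}
    (hc : c ≠ 0) (h : ∀ v, q (f v) = c * q v) :
    ∃ g ∈ specialOrthogonalGroupQuad q, ∃ d : K, d ≠ 0 ∧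
      (g : (Fin 3 → K) →ₗ[K] (Fin 3 → K)) = d • f := by
  have hd := det_sq_of_similitude hq hn h
  have hd0 : LinearMap.det f ≠ 0 := fun h0 => by
    rw [h0] at hd
    exact pow_ne_zero 3 hc (by rw [← hd]; simp)
  have hdet : LinearMap.det ((c / LinearMap.det f) • f) = 1 := by
    rw [LinearMap.det_smul]
    simp only [Module.finrank_fintype_fun_eq_card, Fintype.card_fin]
    field_simp
    exact hd.symm
  refine ⟨LinearEquiv.ofIsUnitDet (f := (c / LinearMap.det f) • f) (v := Pi.basisFun K (Fin 3))
    (v' := Pi.basisFun K (Fin 3)) ?_, ⟨fun x => ?_, ?_⟩, c / LinearMap.det f,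
    div_ne_zero hc hd0, rfl⟩
  · rw [LinearMap.det_toMatrix, hdet]
    exact isUnit_one
  · change q ((c / LinearMap.det f) • f x) = q x
    rw [QuadraticMap.map_smul, h, smul_eq_mul]
    field_simp
    linear_combination - q x * hd
  · refine MonoidHom.mem_ker.mpr (Units.ext ?_)
    rw [LinearEquiv.coe_det]
    exact hdet

/-- A nonzero alternating form in dimension three has rank two: with `b(y, z) ≠ 0` and `e`
orthogonal to both, `e, y, z` is a basis and the radical is the line of `e`. -/
theorem hasDefect_one_of_anisotropic (h2 : (2 : K) = 0) {q : QuadraticForm K (Fin 3 → K)}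
    (hq : q.Anisotropic) (hn : q.polarBilin ≠ 0) : HasDefect q 1 := by
  refine ⟨le_rfl, ?_, fun x _ hx => hq _ hx⟩
  obtain ⟨y, z, hyz⟩ : ∃ y z, q.polarBilin y z ≠ 0 := by
    by_contra! h
    exact hn (LinearMap.ext₂ h)
  have hself : ∀ x, q.polarBilin x x = 0 := fun x => by rw [polarBilin_self, h2, zero_mul]
  obtain ⟨e, he, hye, hze⟩ := exists_ne_zero_orthogonal q y z
  have hli : LinearIndependent K ![e, y, z] := by
    rw [Fintype.linearIndependent_iff]
    intro c hc
    simp only [Fin.sum_univ_three, Matrix.cons_val] at hc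
    have hy := congrArg (q.polarBilin y) hc
    have hz := congrArg (q.polarBilin z) hc
    simp only [map_add, map_smul, hye, hze, hself, map_zero, smul_eq_mul, mul_zero, zero_add,
      add_zero, polarBilin_symm q z y, mul_eq_zero, hyz, or_false] at hy hz
    simp only [hy, hz, zero_smul, add_zero, smul_eq_zero, he, or_false] at hc
    intro i
    fin_cases i
    exacts [hc, hz, hy]
  have hx : ∀ x, ∃ a b c : K, x = a • e + b • y + c • z := fun x => by
    have hx : x ∈ Submodule.span K (Set.range ![e, y, z]) :=
      (hli.span_eq_top_of_card_eq_finrank (by simp)) ▸ Submodule.mem_top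
    obtain ⟨c, hc⟩ := (Submodule.mem_span_range_iff_exists_fun K).mp hx
    exact ⟨c 0, c 1, c 2, by rw [← hc, Fin.sum_univ_three]; rfl⟩
  have hmem : e ∈ quadPerp q := by
    rw [quadPerp, LinearMap.mem_ker]
    refine LinearMap.ext fun x => ?_
    obtain ⟨a, b, c, rfl⟩ := hx x
    simp [-QuadraticMap.polarBilin_apply_apply, hself, polarBilin_symm q e y, polarBilin_symm q e z,
      hye, hze]
  refine finrank_eq_one_iff'.mpr ⟨⟨e, hmem⟩, fun h => he (congrArg Subtype.val h), ?_⟩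
  rintro ⟨x, hxm⟩
  obtain ⟨a, b, c, rfl⟩ := hx x
  rw [quadPerp, LinearMap.mem_ker] at hxm
  have hy := LinearMap.congr_fun hxm y
  have hz := LinearMap.congr_fun hxm z
  simp only [map_add, map_smul, LinearMap.add_apply, LinearMap.smul_apply, hself,
    polarBilin_symm q e y, polarBilin_symm q e z, hye, hze, polarBilin_symm q z y,
    LinearMap.zero_apply, smul_eq_mul, mul_zero, zero_add, add_zero, mul_eq_zero, hyz,
    or_false] at hy hz
  exact ⟨a, Subtype.ext (by simp [hy, hz])⟩

end HalfDiscriminant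
end

noncomputable section

/-! ### The four base points and normal coordinates over the algebraic closure -/

section Base

variable {k : Type*} [Field k]

/-- The properties of the set of base points of a pencil that are used below. -/
structure GeneralBase (P : ConicPencil k) (T : Finset (GeomPoint k)) : Prop where
  card : T.card = 4
  noThreeCollinear : NoThreeCollinear (T : Set (GeomPoint k))
  vanish₁ : ∀ x ∈ T, aeval x.rep P.q₁ = 0
  vanish₂ : ∀ x ∈ T, aeval x.rep P.q₂ = 0
  even_sum : ∀ m : GeomPoint k → ℕ, (∀ g x, m (galoisPoint g x) = m x) → Even (∑ x ∈ T, m x)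

theorem galoisPoint_mul (g h : Gal(AlgebraicClosure k/k)) (x : GeomPoint k) :
    galoisPoint (g * h) x = galoisPoint g (galoisPoint h x) := by
  induction x using Projectivization.ind with
  | h v hv => rfl

theorem eq_of_mem_of_isDPoint {d : ℕ} {p : Set (GeomPoint k)} (hp : IsDPoint d p)
    {m : GeomPoint k → ℕ} (hm : ∀ g x, m (galoisPoint g x) = m x) :
    ∃ c, ∀ x ∈ p, m x = c := by
  obtain ⟨⟨x, rfl⟩, -⟩ := hp
  refine ⟨m x, ?_⟩
  rintro _ ⟨g, rfl⟩
  exact hm g x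

theorem IsDPoint.finite {d : ℕ} (hd : d ≠ 0) {p : Set (GeomPoint k)} (hp : IsDPoint d p) :
    p.Finite :=
  Set.finite_of_ncard_ne_zero (hp.2 ▸ hd)

namespace ConicPencil

theorem IsThrough.vanish {P : ConicPencil k} {S : Set (GeomPoint k)} (h : P.IsThrough S) :
    (∀ x ∈ S, aeval x.rep P.q₁ = 0) ∧ ∀ x ∈ S, aeval x.rep P.q₂ = 0 :=
  ⟨(h _ P.homogeneous₁).mpr (Submodule.subset_span (by simp)),
    (h _ P.homogeneous₂).mpr (Submodule.subset_span (by simp))⟩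

/-- An invariant function is constant on the single orbit, of size four, so its sum is even. For two
orbits of size two the same holds orbit by orbit. -/
theorem IsType4.exists_generalBase {P : ConicPencil k} {F : Type*} [Field F] [Algebra k F]
    (h : P.IsType4 F) : ∃ T, GeneralBase P T := by
  obtain ⟨p, hp, hc, -, ht⟩ := h
  have hf := hp.finite four_ne_zero
  lift p to Finset (GeomPoint k) using hf
  have hcard : p.card = 4 := by rw [← Set.ncard_coe_finset, hp.2]
  refine ⟨p, hcard, hc, ht.vanish.1, ht.vanish.2, fun m hm => ?_⟩
  obtain ⟨c, hc⟩ := eq_of_mem_of_isDPoint hp hm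
  rw [Finset.sum_congr rfl hc, Finset.sum_const, hcard]
  exact ⟨2 * c, by simp; ring⟩

theorem IsType22.exists_generalBase {P : ConicPencil k} {L L' : Type*} [Field L] [Algebra k L]
    [Field L'] [Algebra k L'] (h : P.IsType22 L L') : ∃ T, GeneralBase P T := by
  classical
  obtain ⟨p, p', hp, hp', hd, hc, -, -, ht⟩ := h
  have hf := hp.finite two_ne_zero
  have hf' := hp'.finite two_ne_zero
  lift p to Finset (GeomPoint k) using hf
  lift p' to Finset (GeomPoint k) using hf'
  have hcard : p.card = 2 := by rw [← Set.ncard_coe_finset, hp.2]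
  have hcard' : p'.card = 2 := by rw [← Set.ncard_coe_finset, hp'.2]
  rw [Finset.disjoint_coe] at hd
  rw [← Finset.coe_union] at hc ht
  refine ⟨p ∪ p', by rw [Finset.card_union_of_disjoint hd, hcard, hcard'], hc, ht.vanish.1,
    ht.vanish.2, fun m hm => ?_⟩
  obtain ⟨c, hc⟩ := eq_of_mem_of_isDPoint hp hm
  obtain ⟨c', hc'⟩ := eq_of_mem_of_isDPoint hp' hm
  rw [Finset.sum_union hd, Finset.sum_congr rfl hc, Finset.sum_congr rfl hc', Finset.sum_const,
    Finset.sum_const, hcard, hcard']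
  exact ⟨c + c', by simp; ring⟩

/-- The form `q₁` over the algebraic closure. -/
def geomForm₁ (P : ConicPencil k) :
    QuadraticForm (AlgebraicClosure k) (Fin 3 → AlgebraicClosure k) :=
  quadraticFormOfPoly _ (P.homogeneous₁.map (algebraMap k (AlgebraicClosure k)))

/-- The form `q₂` over the algebraic closure. -/
def geomForm₂ (P : ConicPencil k) :
    QuadraticForm (AlgebraicClosure k) (Fin 3 → AlgebraicClosure k) :=
  quadraticFormOfPoly _ (P.homogeneous₂.map (algebraMap k (AlgebraicClosure k)))

theorem geomForm₁_apply (P : ConicPencil k) (v) : P.geomForm₁ v = aeval v P.q₁ := by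
  rw [aeval_def, eval₂_eq_eval_map]; rfl

theorem geomForm₂_apply (P : ConicPencil k) (v) : P.geomForm₂ v = aeval v P.q₂ := by
  rw [aeval_def, eval₂_eq_eval_map]; rfl

end ConicPencil

theorem Projectivization.exists_rep_eq_smul {K V : Type*} [DivisionRing K] [AddCommGroup V]
    [Module K V] {v : V} (hv : v ≠ 0) :
    ∃ c : K, c ≠ 0 ∧ v = c • (Projectivization.mk K v hv).rep := by
  obtain ⟨a, ha⟩ := Projectivization.exists_smul_eq_mk_rep K v hv
  refine ⟨(a⁻¹ : Kˣ), a⁻¹.ne_zero, ?_⟩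
  rw [← ha, Units.smul_def, smul_smul, Units.inv_mul, one_smul]

theorem GeneralBase.geomForm_eq_zero {P : ConicPencil k} {T : Finset (GeomPoint k)}
    (h : GeneralBase P T) {v : Fin 3 → AlgebraicClosure k} (hv : v ≠ 0)
    (hT : Projectivization.mk _ v hv ∈ T) : P.geomForm₁ v = 0 ∧ P.geomForm₂ v = 0 := by
  obtain ⟨c, -, hc⟩ := Projectivization.exists_rep_eq_smul (K := AlgebraicClosure k) hv
  rw [hc, QuadraticMap.map_smul, QuadraticMap.map_smul, ConicPencil.geomForm₁_apply,
    ConicPencil.geomForm₂_apply, h.vanish₁ _ hT, h.vanish₂ _ hT]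
  simp

/-- Three of the points give a basis. The fourth has all coordinates nonzero in it, as otherwise it
would be collinear with two of them; rescaling the basis makes these coordinates `1`. -/
theorem exists_general_frame {K : Type*} [Field K] {T : Finset (ℙ K (Fin 3 → K))} (hT : T.card = 4)
    (hc : ∀ x ∈ T, ∀ y ∈ T, ∀ z ∈ T, x ≠ y → x ≠ z → y ≠ z →
      Projectivization.Independent ![x, y, z]) :
    ∃ v : Fin 3 → Fin 3 → K, LinearIndependent K v ∧
      (∀ i, ∃ h : v i ≠ 0, Projectivization.mk K (v i) h ∈ T) ∧
      ∃ h : v 0 + v 1 + v 2 ≠ 0, Projectivization.mk K (v 0 + v 1 + v 2) h ∈ T := by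
  let e := (T.equivFinOfCardEq hT).symm
  have hne : ∀ i j, i ≠ j → (e i : ℙ K (Fin 3 → K)) ≠ e j := fun i j hij h =>
    hij (e.injective (Subtype.ext h))
  set w : Fin 4 → Fin 3 → K := fun i => (e i : ℙ K (Fin 3 → K)).rep with hw
  have hli : ∀ i j l, i ≠ j → i ≠ l → j ≠ l → LinearIndependent K ![w i, w j, w l] := by
    intro i j l hij hil hjl
    have := hc _ (e i).2 _ (e j).2 _ (e l).2 (hne _ _ hij) (hne _ _ hil) (hne _ _ hjl)
    rw [Projectivization.independent_iff] at this
    have he : Projectivization.rep ∘ ![(e i : ℙ K (Fin 3 → K)), e j, e l] = ![w i, w j, w l] := by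
      ext a : 1
      fin_cases a <;> rfl
    rw [he] at this
    exact this
  have h012 := hli 0 1 2 (by decide) (by decide) (by decide)
  have hx : w 3 ∈ Submodule.span K (Set.range ![w 0, w 1, w 2]) :=
    (h012.span_eq_top_of_card_eq_finrank (by simp)) ▸ Submodule.mem_top
  obtain ⟨c, hc⟩ := (Submodule.mem_span_range_iff_exists_fun K).mp hx
  simp only [Fin.sum_univ_three, Matrix.cons_val] at hc
  have hc0 : ∀ i, c i ≠ 0 := by
    have key : ∀ i j (a b : K), i ≠ j → i ≠ 3 → j ≠ 3 → a • w i + b • w j ≠ w 3 := by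
      intro i j a b hij hi hj h
      have := Fintype.linearIndependent_iff.mp (hli i j 3 hij hi hj) ![a, b, -1]
        (by simp [Fin.sum_univ_three, h]) 2
      simp at this
    intro i hi
    fin_cases i
    · exact key 1 2 (c 1) (c 2) (by decide) (by decide) (by decide) (by simp_all)
    · exact key 0 2 (c 0) (c 2) (by decide) (by decide) (by decide) (by simp_all)
    · exact key 0 1 (c 0) (c 1) (by decide) (by decide) (by decide) (by simp_all)
  have hwn : ∀ i, w i ≠ 0 := fun i => Projectivization.rep_nonzero _
  have hmk : ∀ i, ∀ a : K, a ≠ 0 → ∃ h : a • w i ≠ 0, Projectivization.mk K (a • w i) h ∈ T := by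
    intro i a ha
    refine ⟨smul_ne_zero ha (hwn i), ?_⟩
    have : Projectivization.mk K (a • w i) (smul_ne_zero ha (hwn i)) = (e i : ℙ K _) := by
      conv_rhs => rw [← Projectivization.mk_rep (e i : ℙ K (Fin 3 → K))]
      rw [Projectivization.mk_eq_mk_iff']
      exact ⟨a, rfl⟩
    rw [this]
    exact (e i).2
  refine ⟨![c 0 • w 0, c 1 • w 1, c 2 • w 2], ?_, ?_, ?_⟩
  · have := h012.units_smul fun i => Units.mk0 (c i) (hc0 i)
    convert this using 1
    ext a : 1
    fin_cases a <;> rfl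
  · intro i
    fin_cases i
    exacts [hmk 0 _ (hc0 0), hmk 1 _ (hc0 1), hmk 2 _ (hc0 2)]
  · have := hmk 3 1 one_ne_zero
    simp only [Matrix.cons_val, hc]
    simpa using this

/-- Linear independence survives extension of scalars: apply `k`-linear functionals of the closure
to the coefficients of the relation. -/
theorem ConicPencil.eq_zero_of_combination_eq_zero (P : ConicPencil k) {a b : AlgebraicClosure k}
    (h : ∀ v, a * P.geomForm₁ v + b * P.geomForm₂ v = 0) : a = 0 ∧ b = 0 := by
  have hp : C a * map (algebraMap k _) P.q₁ + C b * map (algebraMap k _) P.q₂ = 0 := by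
    apply MvPolynomial.funext
    intro v
    rw [map_add, map_mul, map_mul, eval_C, eval_C, map_zero]
    exact h v
  have hl : ∀ l : Module.Dual k (AlgebraicClosure k), l a = 0 ∧ l b = 0 := by
    intro l
    have := LinearIndependent.pair_iff.mp P.linearIndependent (l a) (l b) ?_
    · exact this
    ext m
    have hm := congrArg l (congrArg (coeff m) hp)
    rw [coeff_add, coeff_C_mul, coeff_C_mul, coeff_map, coeff_map, mul_comm, ← Algebra.smul_def,
      mul_comm b, ← Algebra.smul_def, map_add, map_smul, map_smul, coeff_zero, map_zero] at hm
    rw [coeff_add, coeff_smul, coeff_smul, coeff_zero, ← hm, smul_eq_mul, smul_eq_mul, smul_eq_mul,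
      smul_eq_mul]
    ring
  exact ⟨(Module.forall_dual_apply_eq_zero_iff k a).mp fun l => (hl l).1,
    (Module.forall_dual_apply_eq_zero_iff k b).mp fun l => (hl l).2⟩

/-- In suitable coordinates over the algebraic closure, the base points are the coordinate points
and `[1 : 1 : 1]`. -/
theorem GeneralBase.exists_frame {P : ConicPencil k} {T : Finset (GeomPoint k)}
    (h : GeneralBase P T) :
    ∃ v : Fin 3 → Fin 3 → AlgebraicClosure k, LinearIndependent (AlgebraicClosure k) v ∧
      (∀ i, ∃ h : v i ≠ 0, Projectivization.mk _ (v i) h ∈ T) ∧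
      (∃ h : v 0 + v 1 + v 2 ≠ 0, Projectivization.mk _ (v 0 + v 1 + v 2) h ∈ T) ∧
      ∃ a₁ b₁ a₂ b₂ : AlgebraicClosure k, a₁ * b₂ - a₂ * b₁ ≠ 0 ∧ ∀ y : Fin 3 → AlgebraicClosure k,
        P.geomForm₁ (∑ i, y i • v i) =
          a₁ * (y 0 * y 1 - y 0 * y 2) + b₁ * (y 1 * y 2 - y 0 * y 2) ∧
        P.geomForm₂ (∑ i, y i • v i) =
          a₂ * (y 0 * y 1 - y 0 * y 2) + b₂ * (y 1 * y 2 - y 0 * y 2) := by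
  obtain ⟨v, hli, hv, hv3, hv3T⟩ := exists_general_frame h.card h.noThreeCollinear
  refine ⟨v, hli, hv, ⟨hv3, hv3T⟩, P.geomForm₁.polarBilin (v 0) (v 1),
    P.geomForm₁.polarBilin (v 1) (v 2), P.geomForm₂.polarBilin (v 0) (v 1),
    P.geomForm₂.polarBilin (v 1) (v 2), ?_⟩
  -- Vanishing at the coordinate points removes the squares; vanishing at `[1 : 1 : 1]` makes the
  -- three mixed coefficients sum to zero, which leaves two parameters per form.
  have h1 : ∀ i, P.geomForm₁ (v i) = 0 := fun i => (h.geomForm_eq_zero (hv i).1 (hv i).2).1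
  have h2 : ∀ i, P.geomForm₂ (v i) = 0 := fun i => (h.geomForm_eq_zero (hv i).1 (hv i).2).2
  obtain ⟨h31, h32⟩ := h.geomForm_eq_zero hv3 hv3T
  have hf : ∀ y : Fin 3 → AlgebraicClosure k, P.geomForm₁ (∑ i, y i • v i) =
      P.geomForm₁.polarBilin (v 0) (v 1) * (y 0 * y 1 - y 0 * y 2) +
      P.geomForm₁.polarBilin (v 1) (v 2) * (y 1 * y 2 - y 0 * y 2) ∧
      P.geomForm₂ (∑ i, y i • v i) =
      P.geomForm₂.polarBilin (v 0) (v 1) * (y 0 * y 1 - y 0 * y 2) +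
      P.geomForm₂.polarBilin (v 1) (v 2) * (y 1 * y 2 - y 0 * y 2) := by
    intro y
    simp only [map_add_polarBilin, map_add, LinearMap.add_apply, h1, h2] at h31 h32
    rw [map_eq_coordinates, map_eq_coordinates]
    simp only [h1, h2]
    exact ⟨by linear_combination y 0 * y 2 * h31, by linear_combination y 0 * y 2 * h32⟩
  refine ⟨fun hδ => ?_, hf⟩
  have hspan : ∀ x, ∃ y : Fin 3 → AlgebraicClosure k, x = ∑ i, y i • v i := fun x => by
    have hx : x ∈ Submodule.span _ (Set.range v) :=
      (hli.span_eq_top_of_card_eq_finrank (by simp)) ▸ Submodule.mem_top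
    obtain ⟨c, hc⟩ := (Submodule.mem_span_range_iff_exists_fun _).mp hx
    exact ⟨c, hc.symm⟩
  generalize P.geomForm₁.polarBilin (v 0) (v 1) = a₁ at *
  generalize P.geomForm₁.polarBilin (v 1) (v 2) = b₁ at *
  generalize P.geomForm₂.polarBilin (v 0) (v 1) = a₂ at *
  generalize P.geomForm₂.polarBilin (v 1) (v 2) = b₂ at *
  have key : ∀ l m, l * a₁ + m * a₂ = 0 → l * b₁ + m * b₂ = 0 → l = 0 ∧ m = 0 := by
    intro l m ha hb
    apply P.eq_zero_of_combination_eq_zero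
    intro x
    obtain ⟨y, rfl⟩ := hspan x
    rw [(hf y).1, (hf y).2]
    linear_combination (y 0 * y 1 - y 0 * y 2) * ha + (y 1 * y 2 - y 0 * y 2) * hb
  obtain ⟨hb2, hb1⟩ := key b₂ (-b₁) (by linear_combination hδ) (by ring)
  obtain ⟨ha2, ha1⟩ := key a₂ (-a₁) (by ring) (by linear_combination -hδ)
  rw [neg_eq_zero] at hb1 ha1
  exact one_ne_zero (key 1 0 (by simp [ha1]) (by simp [hb1])).1

/-- There are no further base points: as `a₁ b₂ - a₂ b₁ ≠ 0`, both forms vanish only if `y₀(y₁ - y₂)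
= 0` and `y₂(y₁ - y₀) = 0`, which has exactly the four solutions of the frame. -/
theorem GeneralBase.mk_mem {P : ConicPencil k} {T : Finset (GeomPoint k)}
    (h : GeneralBase P T) {w : Fin 3 → AlgebraicClosure k} (hw : w ≠ 0)
    (h1 : P.geomForm₁ w = 0) (h2 : P.geomForm₂ w = 0) : Projectivization.mk _ w hw ∈ T := by
  obtain ⟨v, hli, hv, ⟨hv3, hv3T⟩, a₁, b₁, a₂, b₂, hδ, hf⟩ := h.exists_frame
  have hx : w ∈ Submodule.span _ (Set.range v) :=
    (hli.span_eq_top_of_card_eq_finrank (by simp)) ▸ Submodule.mem_top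
  obtain ⟨y, rfl⟩ := (Submodule.mem_span_range_iff_exists_fun _).mp hx
  rw [(hf y).1] at h1
  rw [(hf y).2] at h2
  have e1 : y 0 * (y 1 - y 2) = 0 := by
    apply (mul_eq_zero.mp (?_ : (a₁ * b₂ - a₂ * b₁) * (y 0 * (y 1 - y 2)) = 0)).resolve_left hδ
    linear_combination b₂ * h1 - b₁ * h2
  have e2 : y 2 * (y 1 - y 0) = 0 := by
    apply (mul_eq_zero.mp (?_ : (a₁ * b₂ - a₂ * b₁) * (y 2 * (y 1 - y 0)) = 0)).resolve_left hδ
    linear_combination a₁ * h2 - a₂ * h1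
  have hmk : ∀ (u : Fin 3 → AlgebraicClosure k) (hu : u ≠ 0) (c : AlgebraicClosure k),
      Projectivization.mk _ u hu ∈ T → ∑ i, y i • v i = c • u →
      Projectivization.mk _ _ hw ∈ T := by
    intro u hu c huT hc
    rwa [show Projectivization.mk _ _ hw = Projectivization.mk _ u hu from
      (Projectivization.mk_eq_mk_iff' _ _ _ _ _).mpr ⟨c, hc.symm⟩]
  rcases mul_eq_zero.mp e1 with y0 | y12
  · rw [y0, sub_zero] at e2
    rcases mul_eq_zero.mp e2 with y2 | y1
    · exact hmk _ (hv 1).1 (y 1) (hv 1).2 (by simp [Fin.sum_univ_three, y0, y2])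
    · exact hmk _ (hv 2).1 (y 2) (hv 2).2 (by simp [Fin.sum_univ_three, y0, y1])
  · rcases mul_eq_zero.mp e2 with y2 | y10
    · rw [y2, sub_zero] at y12
      exact hmk _ (hv 0).1 (y 0) (hv 0).2 (by simp [Fin.sum_univ_three, y12, y2])
    · refine hmk _ hv3 (y 1) hv3T ?_
      simp [Fin.sum_univ_three, ← sub_eq_zero.mp y12, ← sub_eq_zero.mp y10]

end Base
end

noncomputable section

/-! ### Leading coefficients and primitive polynomial vectors -/

section LeadingCoefficients

variable {k : Type*} [Field k]

theorem natDegree_aeval_le_and_coeff_aeval {σ : Type*} [Fintype σ] {n d : ℕ}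
    {Q : MvPolynomial σ k} (hQ : Q.IsHomogeneous n) {p : σ → Polynomial k}
    (hp : ∀ i, (p i).natDegree ≤ d) :
    (aeval p Q).natDegree ≤ n * d ∧
      (aeval p Q).coeff (n * d) = eval (fun i => (p i).coeff d) Q := by
  have key : ∀ m ∈ Q.support, (∏ i, p i ^ m i).natDegree ≤ n * d ∧
      (∏ i, p i ^ m i).coeff (n * d) = ∏ i, (p i).coeff d ^ m i := by
    intro m hm
    have hdeg : ∑ i, m i = n := by
      have h := hQ (mem_support_iff.mp hm)
      rw [← h, Finsupp.weight_apply, Finsupp.sum_fintype _ _ (by simp)]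
      simp
    have h1 : ∀ i, (p i ^ m i).natDegree ≤ m i * d := fun i =>
      Polynomial.natDegree_pow_le_of_le _ (hp i)
    have h2 : ∀ s : Finset σ, (∏ i ∈ s, p i ^ m i).natDegree ≤ (∑ i ∈ s, m i) * d ∧
        (∏ i ∈ s, p i ^ m i).coeff ((∑ i ∈ s, m i) * d) = ∏ i ∈ s, (p i).coeff d ^ m i := by
      classical
      intro s
      induction s using Finset.induction_on with
      | empty => simp
      | insert a s ha ih =>
        rw [Finset.prod_insert ha, Finset.sum_insert ha, Finset.prod_insert ha, add_mul]
        refine ⟨Polynomial.natDegree_mul_le_of_le (h1 a) ih.1, ?_⟩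
        rw [Polynomial.coeff_mul_add_eq_of_natDegree_le (h1 a) ih.1, ih.2,
          Polynomial.coeff_pow_of_natDegree_le (hp a)]
    rw [← hdeg]
    exact h2 _
  rw [aeval_def, eval₂_eq', eval_eq']
  constructor
  · refine Polynomial.natDegree_sum_le_of_forall_le _ _ fun m hm => ?_
    rw [Polynomial.algebraMap_eq]
    exact (Polynomial.natDegree_C_mul_le _ _).trans (key m hm).1
  · rw [Polynomial.finsetSum_coeff]
    refine Finset.sum_congr rfl fun m hm => ?_
    rw [Polynomial.algebraMap_eq, Polynomial.coeff_C_mul, (key m hm).2]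

/-- A nonzero vector over `k(t)` is proportional to a unimodular vector over `k[t]`. -/
theorem exists_unimodular_of_ne_zero {ι : Type*} [Fintype ι] {v : ι → RatFunc k} (hv : v ≠ 0) :
    ∃ (c : RatFunc k) (p a : ι → Polynomial k), c ≠ 0 ∧ ∑ i, a i * p i = 1 ∧
      ∀ i, c * v i = algebraMap _ _ (p i) := by
  obtain ⟨b, hb⟩ := IsLocalization.exist_integer_multiples_of_finite
    (nonZeroDivisors (Polynomial k)) v
  choose p hp using hb
  obtain ⟨g, hg⟩ := (IsPrincipalIdealRing.principal (Ideal.span (Set.range p))).principal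
  have hb0 : algebraMap _ (RatFunc k) (b : Polynomial k) ≠ 0 :=
    RatFunc.algebraMap_ne_zero (nonZeroDivisors.coe_ne_zero b)
  have hdvd : ∀ i, g ∣ p i := fun i => by
    rw [← Ideal.mem_span_singleton]
    change p i ∈ Submodule.span _ {g}
    rw [← hg]
    exact Ideal.subset_span ⟨i, rfl⟩
  choose p' hp' using hdvd
  have hg0 : g ≠ 0 := by
    rintro rfl
    apply hv
    ext i
    have := hp i
    rw [hp', zero_mul, map_zero, Algebra.smul_def] at this
    simpa [hb0] using this.symm
  have hgm : g ∈ Ideal.span (Set.range p) := by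
    rw [hg]
    exact Submodule.mem_span_singleton_self g
  obtain ⟨a, ha⟩ := (Submodule.mem_span_range_iff_exists_fun _).mp hgm
  have hg0' := RatFunc.algebraMap_ne_zero hg0
  refine ⟨algebraMap _ _ (b : Polynomial k) / algebraMap _ _ g, p', a, div_ne_zero hb0 hg0',
    ?_, fun i => ?_⟩
  · apply mul_left_cancel₀ hg0
    rw [mul_one, Finset.mul_sum]
    refine Eq.trans (Finset.sum_congr rfl fun i _ => ?_) ha
    rw [smul_eq_mul, hp' i]
    ring
  · have := hp i
    rw [Algebra.smul_def, hp', map_mul] at this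
    field_simp
    rw [← this]

end LeadingCoefficients

/-! ### Anisotropy by a parity count -/

section Anisotropic

variable {k : Type*} [Field k]

theorem galoisPoint_mk (g : Gal(AlgebraicClosure k/k)) {v : Fin 3 → AlgebraicClosure k}
    (hv : v ≠ 0) (hv' : (fun i => g (v i)) ≠ 0) :
    galoisPoint g (Projectivization.mk _ v hv) = Projectivization.mk _ _ hv' := rfl

theorem galoisPoint_injective (g : Gal(AlgebraicClosure k/k)) :
    Function.Injective (galoisPoint g) := by
  intro x y h
  have := congrArg (galoisPoint g⁻¹) h
  have h1 : ∀ x : GeomPoint k, galoisPoint (1 : Gal(AlgebraicClosure k/k)) x = x := by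
    intro x
    induction x using Projectivization.ind with
    | h v hv => rfl
  rwa [← galoisPoint_mul, ← galoisPoint_mul, inv_mul_cancel, h1, h1] at this

theorem ConicPencil.quadForm_apply (P : ConicPencil k) (v : Fin 3 → RatFunc k) :
    P.quadForm v = aeval v P.q₁ + RatFunc.X * aeval v P.q₂ := by
  change eval v _ = _
  rw [map_add, map_mul, eval_C, ← eval₂_eq_eval_map, ← eval₂_eq_eval_map]
  rfl

/-- A rational base point is fixed by Galois, so its indicator function is invariant and has sum
`1`, which is odd. -/
theorem GeneralBase.not_rational {P : ConicPencil k} {T : Finset (GeomPoint k)}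
    (h : GeneralBase P T) {w : Fin 3 → k} (hw : w ≠ 0) (h1 : eval w P.q₁ = 0)
    (h2 : eval w P.q₂ = 0) : False := by
  classical
  set v : Fin 3 → AlgebraicClosure k := fun i => algebraMap k _ (w i) with hv
  have hv0 : v ≠ 0 := fun h0 => hw (funext fun i => by
    have := congrFun h0 i
    simpa [hv] using this)
  have hev : ∀ Q : MvPolynomial (Fin 3) k, aeval v Q = algebraMap k _ (eval w Q) := by
    intro Q
    rw [hv, ← coe_aeval_eq_eval]
    exact aeval_algebraMap_apply _ w Q
  have hmem := h.mk_mem hv0 (by rw [P.geomForm₁_apply, hev, h1, map_zero])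
    (by rw [P.geomForm₂_apply, hev, h2, map_zero])
  have hfix : ∀ g, galoisPoint g (Projectivization.mk _ v hv0) = Projectivization.mk _ v hv0 := by
    intro g
    have : (fun i => g (v i)) = v := funext fun i => by simp [hv]
    rw [galoisPoint_mk g hv0 (by rwa [this])]
    simp only [this]
  have := h.even_sum (fun x => if x = Projectivization.mk _ v hv0 then 1 else 0) (by
    intro g x
    congr 1
    nth_rw 1 [← hfix g]
    rw [(galoisPoint_injective g).eq_iff])
  rw [Finset.sum_ite_eq_of_mem' _ _ _ hmem] at this
  exact Nat.not_even_one this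

/-- The degree of the pull-back of the base locus along a section is even. -/
theorem GeneralBase.even_natDegree {P : ConicPencil k} {T : Finset (GeomPoint k)}
    (h : GeneralBase P T) {p a : Fin 3 → Polynomial k} (hpa : ∑ i, a i * p i = 1)
    {f : Polynomial k} (h1 : ∀ x : AlgebraicClosure k, Polynomial.aeval x f = 0 →
      aeval (fun i => Polynomial.aeval x (p i)) P.q₁ = 0 ∧
      aeval (fun i => Polynomial.aeval x (p i)) P.q₂ = 0) :
    Even f.natDegree := by
  classical
  set pv : AlgebraicClosure k → Fin 3 → AlgebraicClosure k :=
    fun x i => Polynomial.aeval x (p i) with hpv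
  have hp0 : ∀ x, pv x ≠ 0 := fun x h0 => by
    have := congrArg (Polynomial.aeval x) hpa
    rw [map_sum, map_one] at this
    refine zero_ne_one (Eq.trans (Finset.sum_eq_zero fun i _ => ?_).symm this)
    rw [map_mul]
    exact mul_eq_zero_of_right _ (congrFun h0 i)
  let pt : AlgebraicClosure k → GeomPoint k := fun x => Projectivization.mk _ (pv x) (hp0 x)
  have hgv : ∀ (g : Gal(AlgebraicClosure k/k)) x, pv (g x) = fun i => g (pv x i) := fun g x => by
    ext i
    exact Polynomial.aeval_algHom_apply g.toAlgHom x (p i)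
  have hpt : ∀ (g : Gal(AlgebraicClosure k/k)) x, pt (g x) = galoisPoint g (pt x) := fun g x => by
    have h' : (fun i => g (pv x i)) ≠ 0 := by rw [← hgv]; exact hp0 _
    rw [galoisPoint_mk g (hp0 x) h']
    exact (Projectivization.mk_eq_mk_iff' _ _ _ _ _).mpr ⟨1, by rw [one_smul, hgv]⟩
  set F := f.map (algebraMap k (AlgebraicClosure k)) with hF
  have hsplit : F.roots.card = F.natDegree :=
    IsAlgClosed.card_roots_eq_natDegree
  have hroots : ∀ g : Gal(AlgebraicClosure k/k), F.roots.map g = F.roots := by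
    intro g
    have := Polynomial.roots_map_of_injective_of_card_eq_natDegree
      (f := (g : AlgebraicClosure k →+* AlgebraicClosure k)) g.injective hsplit
    have hFg : F.map (g : AlgebraicClosure k →+* AlgebraicClosure k) = F := by
      rw [hF, Polynomial.map_map]
      congr 1
      ext x
      simp
    rw [hFg] at this
    exact this
  -- Each base point is counted with the number of roots of `f`, with multiplicity, which the curve
  -- sends there. The curve has a value at every root because `p` is unimodular.
  have hsum : ∑ x ∈ T, (F.roots.map pt).count x = f.natDegree := by
    rw [Multiset.sum_count_eq_card, Multiset.card_map, hsplit, hF, Polynomial.natDegree_map]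
    intro x hx
    obtain ⟨y, hy, rfl⟩ := Multiset.mem_map.mp hx
    have hy0 : Polynomial.aeval y f = 0 := by
      have := (Polynomial.mem_roots'.mp hy).2
      rwa [Polynomial.IsRoot.def, hF, Polynomial.eval_map_algebraMap] at this
    obtain ⟨e1, e2⟩ := h1 y hy0
    exact h.mk_mem (hp0 y) (by rw [P.geomForm₁_apply]; exact e1)
      (by rw [P.geomForm₂_apply]; exact e2)
  rw [← hsum]
  refine h.even_sum _ fun g x => ?_
  -- The curve and `f` are defined over `k`, so Galois permutes the roots with their multiplicities,
  -- compatibly with the images.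
  have : F.roots.map pt = (F.roots.map pt).map (galoisPoint g) := by
    conv_lhs => rw [← hroots g]
    rw [Multiset.map_map, Multiset.map_map]
    exact Multiset.map_congr rfl fun x _ => hpt g x
  conv_lhs => rw [this]
  exact Multiset.count_map_eq_count' _ _ (galoisPoint_injective g) _

/-- An isotropic vector would be a section of the conic fibration. Normalized to a primitive
polynomial vector `p` of degree `d`, it gives `q₁(p) = -t f` with `f = q₂(p)` of degree `2d - 1`,
against the even count of zeros of `f`. -/
theorem GeneralBase.anisotropic {P : ConicPencil k} {T : Finset (GeomPoint k)}
    (h : GeneralBase P T) : P.quadForm.Anisotropic := by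
  intro v hv0
  by_contra hv
  obtain ⟨c, p, a, hc, hpa, hp⟩ := exists_unimodular_of_ne_zero hv
  have hcv : c • v = fun i => algebraMap _ _ (p i) := funext hp
  have hq : P.quadForm (c • v) = 0 := by rw [QuadraticMap.map_smul, hv0, smul_zero]
  have hev : ∀ Q : MvPolynomial (Fin 3) k,
      aeval (c • v) Q = algebraMap (Polynomial k) (RatFunc k) (aeval p Q) := by
    intro Q
    rw [hcv]
    exact aeval_algebraMap_apply _ p Q
  rw [P.quadForm_apply, hev, hev, ← RatFunc.algebraMap_X, ← map_mul, ← map_add,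
    map_eq_zero_iff _ (RatFunc.algebraMap_injective k)] at hq
  set f := aeval p P.q₂ with hf
  obtain ⟨i₀, -, hi₀⟩ := Finset.exists_max_image Finset.univ (fun i => (p i).natDegree)
    Finset.univ_nonempty
  set d := (p i₀).natDegree with hd
  have hpd : ∀ i, (p i).natDegree ≤ d := fun i => hi₀ i (Finset.mem_univ i)
  have hw : (fun i => (p i).coeff d) ≠ 0 := by
    intro h0
    have hpi : p i₀ = 0 := Polynomial.leadingCoeff_eq_zero.mp (congrFun h0 i₀)
    have hd0 : d = 0 := by rw [hd, hpi, Polynomial.natDegree_zero]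
    have hall : ∀ i, p i = 0 := fun i => by
      have h1 := hpd i
      have h2 : (p i).coeff d = 0 := congrFun h0 i
      rw [hd0] at h1 h2
      rw [Polynomial.eq_C_of_natDegree_le_zero h1, h2, Polynomial.C_0]
    simp [hall] at hpa
  obtain ⟨d1, c1⟩ := natDegree_aeval_le_and_coeff_aeval P.homogeneous₁ hpd
  obtain ⟨d2, c2⟩ := natDegree_aeval_le_and_coeff_aeval P.homogeneous₂ hpd
  have hq1 : aeval p P.q₁ = -(Polynomial.X * f) := by linear_combination hq
  rw [hq1, Polynomial.natDegree_neg] at d1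
  rw [hq1, Polynomial.coeff_neg] at c1
  have hfd : f.coeff (2 * d) = 0 := by
    rw [← Polynomial.coeff_X_mul]
    exact Polynomial.coeff_eq_zero_of_natDegree_lt (by omega)
  rw [← hf, hfd] at c2
  -- The vector of coefficients of degree `d` is a rational point on which `q₂` vanishes, since `t
  -- f` has degree at most `2d`. It is not a base point, so `q₁` does not vanish on it and `t f` has
  -- degree exactly `2d`.
  have hne : (Polynomial.X * f).coeff (2 * d) ≠ 0 := fun h0 =>
    h.not_rational hw (by rw [← c1, h0, neg_zero]) c2.symm
  obtain ⟨e, he⟩ : ∃ e, 2 * d = e + 1 := by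
    rcases Nat.eq_zero_or_pos (2 * d) with h0 | h0
    · rw [h0] at hne
      simp at hne
    · exact ⟨2 * d - 1, by omega⟩
  rw [he, Polynomial.coeff_X_mul] at hne
  have hfe : f.natDegree = e := by
    refine le_antisymm ?_ (Polynomial.le_natDegree_of_ne_zero hne)
    have hf0 : f ≠ 0 := fun h0 => by simp [h0] at hne
    rw [Polynomial.natDegree_X_mul hf0] at d1
    omega
  have hev : ∀ (x : AlgebraicClosure k) (Q : MvPolynomial (Fin 3) k),
      aeval (fun i => Polynomial.aeval x (p i)) Q = Polynomial.aeval x (aeval p Q) := by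
    intro x Q
    rw [← AlgHom.comp_apply]
    congr 1
    ext i
    simp
  -- At a zero of `f` both `q₂(p) = f` and `q₁(p) = -t f` vanish.
  have := h.even_natDegree hpa (f := f) fun x hx => by
    rw [hev, hev, hq1, map_neg, map_mul, ← hf, hx]
    simp
  rw [hfe] at this
  obtain ⟨r, hr⟩ := this
  omega

end Anisotropic
end

noncomputable section

/-! ### Coprimality of the two quadratic forms -/

section CoprimeForms

/-- Coprime ternary quadratic forms. -/
structure CoprimeForms {k : Type*} [Field k] (q₁ q₂ : MvPolynomial (Fin 3) k) : Prop where
  homogeneous₁ : q₁.IsHomogeneous 2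
  homogeneous₂ : q₂.IsHomogeneous 2
  ne_zero₁ : q₁ ≠ 0
  ne_zero₂ : q₂ ≠ 0
  isRelPrime : IsRelPrime q₁ q₂

variable {k : Type*} [Field k]

theorem homogeneousComponent_two_mul {σ : Type*} {d e : MvPolynomial σ k}
    (hd : d.totalDegree ≤ 1) (he : e.totalDegree ≤ 1) :
    homogeneousComponent 2 (d * e) = homogeneousComponent 1 d * homogeneousComponent 1 e := by
  have h : ∀ f : MvPolynomial σ k, f.totalDegree ≤ 1 →
      f = homogeneousComponent 0 f + homogeneousComponent 1 f := by
    intro f hf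
    conv_lhs => rw [← sum_homogeneousComponent f]
    rw [Finset.sum_subset (Finset.range_mono (by omega : f.totalDegree + 1 ≤ 2))]
    · rw [Finset.sum_range_succ, Finset.sum_range_one]
    · intro i _ hi
      exact homogeneousComponent_eq_zero _ _ (by simpa using hi)
  have hh : ∀ (f : MvPolynomial σ k) n, (homogeneousComponent n f).IsHomogeneous n :=
    fun f n => homogeneousComponent_isHomogeneous n f
  conv_lhs => rw [h d hd, h e he]
  rw [add_mul, mul_add, mul_add, map_add, map_add, map_add,
    homogeneousComponent_of_mem ((hh d 0).mul (hh e 0)),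
    homogeneousComponent_of_mem ((hh d 0).mul (hh e 1)),
    homogeneousComponent_of_mem ((hh d 1).mul (hh e 0)),
    homogeneousComponent_of_mem ((hh d 1).mul (hh e 1))]
  simp

/-- A common divisor of degree two would make the forms proportional. One of degree one may fail to
be homogeneous, but its linear component divides both forms, because the components of top degree
multiply. -/
theorem isRelPrime_of_no_common_line {σ : Type*} {q₁ q₂ : MvPolynomial σ k}
    (h₁ : q₁.IsHomogeneous 2) (h₂ : q₂.IsHomogeneous 2) (hli : LinearIndependent k ![q₁, q₂])
    (hl : ∀ l : MvPolynomial σ k, l.IsHomogeneous 1 → l ∣ q₁ → ¬ l ∣ q₂) : IsRelPrime q₁ q₂ := by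
  have n₁ : q₁ ≠ 0 := hli.ne_zero 0
  have n₂ : q₂ ≠ 0 := hli.ne_zero 1
  rintro d ⟨e₁, he₁⟩ ⟨e₂, he₂⟩
  have hd0 : d ≠ 0 := by rintro rfl; simp_all
  have he₁0 : e₁ ≠ 0 := by rintro rfl; simp_all
  have he₂0 : e₂ ≠ 0 := by rintro rfl; simp_all
  have t₁ := totalDegree_mul_of_isDomain hd0 he₁0
  have t₂ := totalDegree_mul_of_isDomain hd0 he₂0
  rw [← he₁, h₁.totalDegree n₁] at t₁
  rw [← he₂, h₂.totalDegree n₂] at t₂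
  rcases (by omega : d.totalDegree = 0 ∨ d.totalDegree = 1 ∨ d.totalDegree = 2) with h | h | h
  · rw [totalDegree_eq_zero_iff_eq_C.mp h] at hd0 ⊢
    refine IsUnit.map C (isUnit_iff_ne_zero.mpr fun h0 => hd0 ?_)
    rw [h0, map_zero]
  · refine absurd ?_ (hl _ (homogeneousComponent_isHomogeneous 1 d) ⟨homogeneousComponent 1 e₁, ?_⟩)
    · refine ⟨homogeneousComponent 1 e₂, ?_⟩
      rw [← homogeneousComponent_two_mul (by omega) (by omega), ← he₂]
      exact (homogeneousComponent_eq_self h₂).symm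
    · rw [← homogeneousComponent_two_mul (by omega) (by omega), ← he₁]
      exact (homogeneousComponent_eq_self h₁).symm
  · have c₁ := totalDegree_eq_zero_iff_eq_C.mp (by omega : e₁.totalDegree = 0)
    have c₂ := totalDegree_eq_zero_iff_eq_C.mp (by omega : e₂.totalDegree = 0)
    have := (LinearIndependent.pair_iff.mp hli (coeff 0 e₂) (-coeff 0 e₁) (by
      rw [smul_eq_C_mul, smul_eq_C_mul, C_neg, ← c₁, ← c₂, he₁, he₂]
      ring)).1
    rw [this, C_0] at c₂
    exact absurd c₂ he₂0

end CoprimeForms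

/-! ### The pencil has no common component and a nonzero polar form -/

section PencilCoprime

variable {k : Type*} [Field k]

theorem eval_eq_sum_of_isHomogeneous_one {n : ℕ} {l : MvPolynomial (Fin n) k}
    (hl : l.IsHomogeneous 1) : ∃ c : Fin n → k, l = ∑ i, c i • X i := by
  have : l ∈ homogeneousSubmodule (Fin n) k 1 := hl
  rw [homogeneousSubmodule_one_eq_span_X] at this
  obtain ⟨c, hc⟩ := (Submodule.mem_span_range_iff_exists_fun _).mp this
  exact ⟨c, hc.symm⟩

/-- A common line would lie in the base locus, so each of its points would satisfy the two equations
of that locus; a few explicit points on it contradict this. -/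
theorem GeneralBase.no_common_line {P : ConicPencil k} {T : Finset (GeomPoint k)}
    (h : GeneralBase P T) {l : MvPolynomial (Fin 3) (AlgebraicClosure k)} (hl : l.IsHomogeneous 1)
    (h₁ : l ∣ map (algebraMap k _) P.q₁) (h₂ : l ∣ map (algebraMap k _) P.q₂) : False := by
  obtain ⟨v, hli, -, -, a₁, b₁, a₂, b₂, hδ, hf⟩ := h.exists_frame
  obtain ⟨c, rfl⟩ := eval_eq_sum_of_isHomogeneous_one hl
  set L : (Fin 3 → AlgebraicClosure k) →ₗ[AlgebraicClosure k] AlgebraicClosure k :=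
    Fintype.linearCombination _ c with hL
  have hLe : ∀ w, eval w (∑ i, c i • X i) = L w := by
    intro w
    simp [hL, Fintype.linearCombination_apply, mul_comm]
  have key : ∀ y : Fin 3 → AlgebraicClosure k, ∑ i, y i * L (v i) = 0 →
      y 0 * (y 1 - y 2) = 0 ∧ y 2 * (y 1 - y 0) = 0 := by
    intro y hy
    have hy' : L (∑ i, y i • v i) = 0 := by simpa using hy
    obtain ⟨e₁, he₁⟩ := h₁
    obtain ⟨e₂, he₂⟩ := h₂
    have z₁ : P.geomForm₁ (∑ i, y i • v i) = 0 := by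
      change eval _ _ = _
      rw [he₁, map_mul, hLe, hy', zero_mul]
    have z₂ : P.geomForm₂ (∑ i, y i • v i) = 0 := by
      change eval _ _ = _
      rw [he₂, map_mul, hLe, hy', zero_mul]
    rw [(hf y).1] at z₁
    rw [(hf y).2] at z₂
    constructor
    · apply (mul_eq_zero.mp (?_ : (a₁ * b₂ - a₂ * b₁) * (y 0 * (y 1 - y 2)) = 0)).resolve_left hδ
      linear_combination b₂ * z₁ - b₁ * z₂
    · apply (mul_eq_zero.mp (?_ : (a₁ * b₂ - a₂ * b₁) * (y 2 * (y 1 - y 0)) = 0)).resolve_left hδ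
      linear_combination a₁ * z₂ - a₂ * z₁
  generalize hc : (fun i => L (v i)) = w at key
  have hcw : ∀ i, L (v i) = w i := fun i => congrFun hc i
  simp only [hcw, Fin.sum_univ_three] at key
  -- The intersections of the line with the sides of the coordinate triangle. They force all
  -- products `wᵢ wⱼ` with `i ≠ j` to vanish; the points with two coordinates `1` rule out the
  -- remaining lines.
  have k1 := (key ![w 1, -w 0, 0] (by simp; ring)).1
  have k2 := (key ![0, w 2, -w 1] (by simp; ring)).2
  have k3 := (key ![w 2, 0, -w 0] (by simp; ring)).1
  simp at k1 k2 k3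
  by_cases w0 : w 0 = 0
  · have := (key ![0, 1, 1])
    have k4 := (key ![1, 0, 1])
    have k5 := (key ![1, 1, 0])
    simp [w0] at this k4 k5
    by_cases w1 : w 1 = 0
    · simp_all
    · simp_all
  · have := (key ![0, 1, 1])
    simp at this
    simp_all

theorem GeneralBase.coprimeForms_map {P : ConicPencil k} {T : Finset (GeomPoint k)}
    (h : GeneralBase P T) : CoprimeForms (map (algebraMap k (AlgebraicClosure k)) P.q₁)
      (map (algebraMap k (AlgebraicClosure k)) P.q₂) := by
  have hli : LinearIndependent (AlgebraicClosure k)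
      ![map (algebraMap k (AlgebraicClosure k)) P.q₁,
        map (algebraMap k (AlgebraicClosure k)) P.q₂] := by
    rw [LinearIndependent.pair_iff]
    intro a b hab
    refine P.eq_zero_of_combination_eq_zero fun v => ?_
    have := congrArg (eval v) hab
    rwa [map_add, smul_eval, smul_eval, map_zero] at this
  exact ⟨P.homogeneous₁.map _, P.homogeneous₂.map _, hli.ne_zero 0, hli.ne_zero 1,
    isRelPrime_of_no_common_line (P.homogeneous₁.map _) (P.homogeneous₂.map _) hli
      fun l hl h₁ h₂ => h.no_common_line hl h₁ h₂⟩

theorem GeneralBase.coprimeForms {P : ConicPencil k} {T : Finset (GeomPoint k)}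
    (h : GeneralBase P T) : CoprimeForms P.q₁ P.q₂ :=
  ⟨P.homogeneous₁, P.homogeneous₂, P.linearIndependent.ne_zero 0, P.linearIndependent.ne_zero 1,
    isRelPrime_of_no_common_line P.homogeneous₁ P.homogeneous₂ P.linearIndependent
      fun _ hl h₁ h₂ => h.no_common_line (hl.map (algebraMap k _))
        (map_dvd (MvPolynomial.map (algebraMap k (AlgebraicClosure k))) h₁)
        (map_dvd (MvPolynomial.map (algebraMap k (AlgebraicClosure k))) h₂)⟩

/-- If the polar form vanished, `q₁` would be additive, first over `k` by comparing constant terms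
in `t`, then over the closure since the standard basis is rational. In the frame this gives `a₁ = b₁
= 0`. -/
theorem GeneralBase.polarBilin_ne_zero {P : ConicPencil k} {T : Finset (GeomPoint k)}
    (h : GeneralBase P T) : P.quadForm.polarBilin ≠ 0 := by
  intro h0
  have hk : ∀ x y : Fin 3 → k, eval (x + y) P.q₁ = eval x P.q₁ + eval y P.q₁ := by
    intro x y
    have hev : ∀ z : Fin 3 → k, P.quadForm (fun i => algebraMap k _ (z i)) =
        algebraMap (Polynomial k) (RatFunc k)
          (Polynomial.C (eval z P.q₁) + Polynomial.X * Polynomial.C (eval z P.q₂)) := by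
      intro z
      rw [P.quadForm_apply, map_add, map_mul, RatFunc.algebraMap_X, RatFunc.algebraMap_C,
        RatFunc.algebraMap_C, ← coe_aeval_eq_eval, ← RatFunc.algebraMap_eq_C]
      congr 1
      · exact aeval_algebraMap_apply _ z _
      · exact congrArg _ (aeval_algebraMap_apply _ z _)
    have h1 := map_add_polarBilin P.quadForm (fun i => algebraMap k _ (x i))
      (fun i => algebraMap k _ (y i))
    rw [h0, LinearMap.zero_apply, LinearMap.zero_apply, add_zero, hev, hev,
      show (fun i => algebraMap k (RatFunc k) (x i)) + (fun i => algebraMap k _ (y i)) =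
        fun i => algebraMap k _ ((x + y) i) from funext fun i => (map_add _ _ _).symm, hev,
      ← map_add, (RatFunc.algebraMap_injective k).eq_iff] at h1
    simpa using congrArg (Polynomial.coeff · 0) h1
  have hg : P.geomForm₁.polarBilin = 0 := by
    refine (Pi.basisFun _ (Fin 3)).ext fun i => (Pi.basisFun _ (Fin 3)).ext fun j => ?_
    have hs : ∀ i : Fin 3, (Pi.basisFun (AlgebraicClosure k) (Fin 3)) i =
        fun l => algebraMap k _ ((Pi.single i 1 : Fin 3 → k) l) := by
      intro i
      ext l
      simp [Pi.single_apply, apply_ite (algebraMap k (AlgebraicClosure k))]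
    have hev : ∀ z : Fin 3 → k, P.geomForm₁ (fun i => algebraMap k _ (z i)) =
        algebraMap k _ (eval z P.q₁) := fun z => by
      rw [P.geomForm₁_apply, ← coe_aeval_eq_eval]
      exact aeval_algebraMap_apply _ z _
    have h1 := map_add_polarBilin P.geomForm₁ (fun l => algebraMap k _ ((Pi.single i 1 :
      Fin 3 → k) l)) (fun l => algebraMap k _ ((Pi.single j 1 : Fin 3 → k) l))
    rw [hs, hs]
    rw [show (fun l => algebraMap k (AlgebraicClosure k) ((Pi.single i 1 : Fin 3 → k) l)) +
      (fun l => algebraMap k _ ((Pi.single j 1 : Fin 3 → k) l)) = fun l => algebraMap k _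
        ((Pi.single i 1 + Pi.single j 1 : Fin 3 → k) l) from
          funext fun l => ((algebraMap k (AlgebraicClosure k)).map_add _ _).symm,
      hev, hev, hev, hk, map_add] at h1
    simpa [-QuadraticMap.polarBilin_apply_apply] using h1
  obtain ⟨v, -, -, -, a₁, b₁, a₂, b₂, hδ, hf⟩ := h.exists_frame
  have hadd : ∀ x y, P.geomForm₁ (x + y) = P.geomForm₁ x + P.geomForm₁ y := fun x y => by
    rw [map_add_polarBilin, hg, LinearMap.zero_apply, LinearMap.zero_apply, add_zero]
  have f0 := (hf ![1, 0, 0]).1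
  have f1 := (hf ![0, 1, 0]).1
  have f2 := (hf ![0, 0, 1]).1
  have f01 := (hf ![1, 1, 0]).1
  have f12 := (hf ![0, 1, 1]).1
  simp [Fin.sum_univ_three] at f0 f1 f2 f01 f12
  rw [hadd, f0, f1] at f01
  rw [hadd, f1, f2] at f12
  apply hδ
  rw [← f01, ← f12]
  ring

end PencilCoprime
end

noncomputable section

/-! ### The generic point and the ideal of the conic over `k(t)` -/

section GenericPoint

variable {k : Type*} [Field k]

/-- The homogeneous coordinates of the generic point of the plane. -/
abbrev genericCoord (k : Type*) [Field k] (i : Fin 3) : FractionRing (MvPolynomial (Fin 3) k) :=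
  algebraMap (MvPolynomial (Fin 3) k) _ (X i)

/-- An algebraic element would be integral over the polynomial ring, hence a polynomial; then `q₂`
divides `q₁`, so by coprimality it is a unit, against its degree. -/
theorem CoprimeForms.transcendental {q₁ q₂ : MvPolynomial (Fin 3) k} (h : CoprimeForms q₁ q₂) :
    Transcendental k (-(algebraMap _ (FractionRing (MvPolynomial (Fin 3) k)) q₁) /
      algebraMap _ _ q₂) := by
  intro halg
  have hint : IsIntegral (MvPolynomial (Fin 3) k)
      (-(algebraMap _ (FractionRing (MvPolynomial (Fin 3) k)) q₁) / algebraMap _ _ q₂) :=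
    (isAlgebraic_iff_isIntegral.mp halg).tower_top
  obtain ⟨r, hr⟩ := IsIntegrallyClosed.isIntegral_iff.mp hint
  have hq₂ : algebraMap _ (FractionRing (MvPolynomial (Fin 3) k)) q₂ ≠ 0 :=
    (map_ne_zero_iff _ (IsFractionRing.injective _ _)).mpr h.ne_zero₂
  rw [eq_div_iff hq₂, ← map_mul, ← map_neg, (IsFractionRing.injective _ _).eq_iff] at hr
  have hu : IsUnit q₂ := h.isRelPrime ⟨-r, by linear_combination hr⟩ dvd_rfl
  have := (MvPolynomial.isUnit_iff_totalDegree_of_isReduced.mp hu).2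
  rw [h.homogeneous₂.totalDegree h.ne_zero₂] at this
  omega

/-- The embedding of `k(t)` into the function field with `t ↦ -q₁/q₂`. -/
def CoprimeForms.embedding {q₁ q₂ : MvPolynomial (Fin 3) k} (h : CoprimeForms q₁ q₂) :
    RatFunc k →ₐ[k] FractionRing (MvPolynomial (Fin 3) k) :=
  (IntermediateField.val _).comp (RatFunc.algEquivOfTranscendental _ h.transcendental).toAlgHom

theorem CoprimeForms.embedding_X {q₁ q₂ : MvPolynomial (Fin 3) k} (h : CoprimeForms q₁ q₂) :
    h.embedding RatFunc.X = -(algebraMap _ (FractionRing (MvPolynomial (Fin 3) k)) q₁) /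
      algebraMap _ _ q₂ := by
  exact RatFunc.algEquivOfTranscendental_X _ h.transcendental

theorem CoprimeForms.algebraMap_ne_zero₂ {q₁ q₂ : MvPolynomial (Fin 3) k}
    (h : CoprimeForms q₁ q₂) :
    algebraMap _ (FractionRing (MvPolynomial (Fin 3) k)) q₂ ≠ 0 :=
  (map_ne_zero_iff _ (IsFractionRing.injective _ _)).mpr h.ne_zero₂

theorem CoprimeForms.embedding_X_mul {q₁ q₂ : MvPolynomial (Fin 3) k} (h : CoprimeForms q₁ q₂) :
    h.embedding RatFunc.X * algebraMap _ _ q₂ = -algebraMap _ _ q₁ := by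
  rw [h.embedding_X, div_mul_cancel₀ _ h.algebraMap_ne_zero₂]

/-- The form `q₁ + t q₂` over `k(t)`. -/
def pencilPoly (q₁ q₂ : MvPolynomial (Fin 3) k) : MvPolynomial (Fin 3) (RatFunc k) :=
  map (algebraMap k (RatFunc k)) q₁ + C (RatFunc.X : RatFunc k) * map (algebraMap k (RatFunc k)) q₂

theorem exists_C_mul_eq_map (P : MvPolynomial (Fin 3) (RatFunc k)) :
    ∃ d : Polynomial k, d ≠ 0 ∧ ∃ P' : MvPolynomial (Fin 3) (Polynomial k),
      C (algebraMap _ _ d) * P = map (algebraMap (Polynomial k) (RatFunc k)) P' := by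
  induction P using MvPolynomial.induction_on with
  | C a =>
    refine ⟨a.denom, a.denom_ne_zero, C a.num, ?_⟩
    rw [map_C, ← C_mul]
    congr 1
    conv_lhs => rw [← RatFunc.num_div_denom a]
    rw [RatFunc.num_div_denom a]
    have := RatFunc.algebraMap_ne_zero a.denom_ne_zero
    nth_rw 2 [← RatFunc.num_div_denom a]
    field_simp
  | add p q hp hq =>
    obtain ⟨d, hd, p', hp'⟩ := hp
    obtain ⟨e, he, q', hq'⟩ := hq
    refine ⟨d * e, mul_ne_zero hd he, C e * p' + C d * q', ?_⟩
    rw [map_mul, C_mul, map_add (map (algebraMap (Polynomial k) (RatFunc k))),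
      map_mul (map (algebraMap (Polynomial k) (RatFunc k))),
      map_mul (map (algebraMap (Polynomial k) (RatFunc k))), ← hp', ← hq', map_C, map_C]
    ring
  | mul_X p i hp =>
    obtain ⟨d, hd, p', hp'⟩ := hp
    exact ⟨d, hd, p' * X i, by rw [map_mul, ← hp', map_X, mul_assoc]⟩

theorem isPrimitive_C_add_X_mul_C {R : Type*} [CommRing R] {a b : R} (h : IsRelPrime a b) :
    (Polynomial.C a + Polynomial.X * Polynomial.C b).IsPrimitive := by
  intro r hr
  rw [Polynomial.C_dvd_iff_dvd_coeff] at hr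
  refine h (by simpa using hr 0) ?_
  simpa [Polynomial.coeff_C] using hr 1

/-- The forms over `k(t)` vanishing at the generic point are the multiples of `q₁ + t q₂`. -/
theorem CoprimeForms.dvd_of_eval₂_eq_zero {q₁ q₂ : MvPolynomial (Fin 3) k}
    (h : CoprimeForms q₁ q₂) {P : MvPolynomial (Fin 3) (RatFunc k)}
    (hP : eval₂ (h.embedding : RatFunc k →+* _) (genericCoord k) P = 0) :
    pencilPoly q₁ q₂ ∣ P := by
  obtain ⟨d, hd, P', hP'⟩ := exists_C_mul_eq_map P
  -- interchange of the variables `t` and `x`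
  let θ : MvPolynomial (Fin 3) (Polynomial k) →+* Polynomial (MvPolynomial (Fin 3) k) :=
    eval₂Hom (Polynomial.mapRingHom C) fun i => Polynomial.C (X i)
  let θ' : Polynomial (MvPolynomial (Fin 3) k) →+* MvPolynomial (Fin 3) (RatFunc k) :=
    Polynomial.eval₂RingHom (map (algebraMap k (RatFunc k))) (C RatFunc.X)
  let ε : Polynomial (MvPolynomial (Fin 3) k) →+* FractionRing (MvPolynomial (Fin 3) k) :=
    Polynomial.eval₂RingHom (algebraMap _ _) (h.embedding RatFunc.X)
  have hθ' : ∀ G, θ' (θ G) = map (algebraMap (Polynomial k) (RatFunc k)) G := by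
    intro G
    rw [← RingHom.comp_apply]
    congr 1
    apply MvPolynomial.ringHom_ext'
    · apply Polynomial.ringHom_ext'
      · ext a
        simp [θ, θ', ← RatFunc.algebraMap_eq_C]
      · simp [θ, θ']
    · intro i
      simp [θ, θ']
  have hε : ∀ G, ε (θ G) = eval₂ (h.embedding : RatFunc k →+* _) (genericCoord k)
      (map (algebraMap (Polynomial k) (RatFunc k)) G) := by
    intro G
    rw [eval₂_map, ← coe_eval₂Hom, ← RingHom.comp_apply]
    congr 1
    apply MvPolynomial.ringHom_ext'
    · apply Polynomial.ringHom_ext'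
      · ext a
        simp only [θ, ε, RingHom.comp_apply, coe_eval₂Hom, eval₂_C, Polynomial.coe_mapRingHom,
          Polynomial.map_C, Polynomial.coe_eval₂RingHom, Polynomial.eval₂_C, RatFunc.algebraMap_C]
        rw [← RatFunc.algebraMap_eq_C]
        exact (h.embedding.commutes a).symm
      · simp [θ, ε]
    · intro i
      simp [θ, ε]
  have hroot : ε (θ P') = 0 := by
    rw [hε, ← hP', eval₂_mul, hP, mul_zero]
  -- As a polynomial in `t` over the function field, `θ P'` has the root `-q₁/q₂`, so `q₁ + t q₂`
  -- divides it there. Gauss's lemma brings the divisibility back to polynomials, since coprimality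
  -- makes `q₁ + t q₂` primitive.
  have hdvd : Polynomial.C q₁ + Polynomial.X * Polynomial.C q₂ ∣ θ P' := by
    apply (isPrimitive_C_add_X_mul_C h.isRelPrime).dvd_of_fraction_map_dvd_fraction_map
      (K := FractionRing (MvPolynomial (Fin 3) k))
    have hr : (Polynomial.X - Polynomial.C (h.embedding RatFunc.X)) ∣
        (θ P').map (algebraMap _ (FractionRing (MvPolynomial (Fin 3) k))) := by
      rw [Polynomial.dvd_iff_isRoot, Polynomial.IsRoot.def, Polynomial.eval_map]
      exact hroot
    have he : (Polynomial.C q₁ + Polynomial.X * Polynomial.C q₂).map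
        (algebraMap _ (FractionRing (MvPolynomial (Fin 3) k))) =
        Polynomial.C (algebraMap _ _ q₂) *
          (Polynomial.X - Polynomial.C (h.embedding RatFunc.X)) := by
      rw [mul_sub, ← Polynomial.C_mul, mul_comm (algebraMap _ _ q₂), h.embedding_X_mul]
      simp only [Polynomial.map_add, Polynomial.map_mul, Polynomial.map_C, Polynomial.map_X,
        Polynomial.C_neg]
      ring
    rw [he]
    exact (IsUnit.mul_left_dvd (Polynomial.isUnit_C.mpr
      (isUnit_iff_ne_zero.mpr h.algebraMap_ne_zero₂))).mpr hr
  have h1 := map_dvd θ' hdvd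
  rw [hθ', ← hP'] at h1
  have h2 : θ' (Polynomial.C q₁ + Polynomial.X * Polynomial.C q₂) = pencilPoly q₁ q₂ := by
    simp [θ', pencilPoly]
    ring
  rw [h2] at h1
  refine (IsUnit.dvd_mul_left ?_).mp h1
  exact IsUnit.map C (isUnit_iff_ne_zero.mpr (RatFunc.algebraMap_ne_zero hd))

end GenericPoint
end

noncomputable section

/-! ### Linear substitutions given by matrices -/

section LinearSubstitution

variable {K : Type*} [Field K]

/-- The linear forms given by the rows of a matrix. -/
def linPoly (M : Matrix (Fin 3) (Fin 3) K) (i : Fin 3) : MvPolynomial (Fin 3) K :=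
  ∑ j, C (M i j) * X j

theorem linPoly_isHomogeneous (M : Matrix (Fin 3) (Fin 3) K) (i : Fin 3) :
    (linPoly M i).IsHomogeneous 1 :=
  IsHomogeneous.sum _ _ _ fun j _ => isHomogeneous_C_mul_X (M i j) j

theorem linPoly_one : linPoly (1 : Matrix (Fin 3) (Fin 3) K) = X := by
  ext1 i
  simp [linPoly, Matrix.one_apply, apply_ite C]

theorem bind₁_linPoly_linPoly (M N : Matrix (Fin 3) (Fin 3) K) (i : Fin 3) :
    bind₁ (linPoly M) (linPoly N i) = linPoly (N * M) i := by
  simp only [linPoly, map_sum, map_mul, bind₁_C_right, bind₁_X_right, Matrix.mul_apply,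
    Finset.mul_sum, Finset.sum_mul]
  rw [Finset.sum_comm]
  simp only [mul_assoc]

theorem bind₁_linPoly_bind₁_linPoly (M N : Matrix (Fin 3) (Fin 3) K)
    (G : MvPolynomial (Fin 3) K) :
    bind₁ (linPoly M) (bind₁ (linPoly N) G) = bind₁ (linPoly (N * M)) G := by
  rw [bind₁_bind₁]
  simp only [bind₁_linPoly_linPoly]

theorem eval_bind₁_linPoly (M : Matrix (Fin 3) (Fin 3) K) (G : MvPolynomial (Fin 3) K)
    (v : Fin 3 → K) : eval v (bind₁ (linPoly M) G) = eval (M.mulVec v) G := by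
  rw [← coe_aeval_eq_eval, ← coe_aeval_eq_eval]
  change aeval v (bind₁ (linPoly M) G) = aeval (M.mulVec v) G
  rw [aeval_bind₁]
  congr 2
  ext i
  simp [linPoly, Matrix.mulVec, dotProduct]

end LinearSubstitution

/-! ### Matrices over `k(t)` acting on the generic point -/

section GenericPoint

variable {k : Type*} [Field k] {q₁ q₂ : MvPolynomial (Fin 3) k}

theorem pencilPoly_isHomogeneous (h : CoprimeForms q₁ q₂) :
    (pencilPoly q₁ q₂).IsHomogeneous 2 := by
  refine (h.homogeneous₁.map _).add ?_
  simpa using (isHomogeneous_C (Fin 3) (RatFunc.X : RatFunc k)).mul (h.homogeneous₂.map _)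

theorem CoprimeForms.eval₂_map (h : CoprimeForms q₁ q₂)
    (y : Fin 3 → FractionRing (MvPolynomial (Fin 3) k)) (G : MvPolynomial (Fin 3) k) :
    eval₂ (h.embedding : RatFunc k →+* _) y (map (algebraMap k (RatFunc k)) G) = aeval y G := by
  rw [MvPolynomial.eval₂_map, aeval_def]
  congr 1
  exact h.embedding.comp_algebraMap

theorem aeval_genericCoord (G : MvPolynomial (Fin 3) k) :
    aeval (genericCoord k) G = algebraMap _ (FractionRing (MvPolynomial (Fin 3) k)) G := by
  have := aeval_algebraMap_apply (FractionRing (MvPolynomial (Fin 3) k))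
    (X : Fin 3 → MvPolynomial (Fin 3) k) G
  rw [aeval_X_left_apply] at this
  exact this

theorem CoprimeForms.eval₂_pencilPoly (h : CoprimeForms q₁ q₂)
    (y : Fin 3 → FractionRing (MvPolynomial (Fin 3) k)) :
    eval₂ (h.embedding : RatFunc k →+* _) y (pencilPoly q₁ q₂) =
      aeval y q₁ + h.embedding RatFunc.X * aeval y q₂ := by
  rw [pencilPoly, eval₂_add, eval₂_mul, h.eval₂_map, h.eval₂_map, eval₂_C]
  rfl

theorem CoprimeForms.eval₂_genericCoord_pencilPoly (h : CoprimeForms q₁ q₂) :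
    eval₂ (h.embedding : RatFunc k →+* _) (genericCoord k) (pencilPoly q₁ q₂) = 0 := by
  rw [h.eval₂_pencilPoly, aeval_genericCoord, aeval_genericCoord, h.embedding_X_mul, add_neg_cancel]

theorem pencilPoly_ne_zero (h : CoprimeForms q₁ q₂) : pencilPoly q₁ q₂ ≠ 0 := by
  intro h0
  obtain ⟨m, hm⟩ := MvPolynomial.ne_zero_iff.mp h.ne_zero₂
  have := congrArg (coeff m) h0
  rw [pencilPoly, coeff_add, coeff_C_mul, coeff_map, coeff_map, coeff_zero,
    RatFunc.algebraMap_eq_C, ← RatFunc.algebraMap_C, ← RatFunc.algebraMap_C, ← RatFunc.algebraMap_X,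
    ← map_mul, ← map_add, map_eq_zero_iff _ (RatFunc.algebraMap_injective k)] at this
  exact hm (by simpa [Polynomial.coeff_C] using congrArg (Polynomial.coeff · 1) this)

theorem CoprimeForms.eq_C_mul_of_eval₂_eq_zero (h : CoprimeForms q₁ q₂)
    {Q : MvPolynomial (Fin 3) (RatFunc k)} (hQ : Q.IsHomogeneous 2)
    (h0 : eval₂ (h.embedding : RatFunc k →+* _) (genericCoord k) Q = 0) :
    ∃ c, Q = C c * pencilPoly q₁ q₂ := by
  obtain ⟨e, rfl⟩ := h.dvd_of_eval₂_eq_zero h0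
  by_cases he : e = 0
  · exact ⟨0, by simp [he]⟩
  have hp := pencilPoly_ne_zero h
  have := totalDegree_mul_of_isDomain hp he
  rw [hQ.totalDegree (mul_ne_zero hp he), (pencilPoly_isHomogeneous h).totalDegree hp] at this
  refine ⟨coeff 0 e, ?_⟩
  rw [mul_comm, ← totalDegree_eq_zero_iff_eq_C.mp (by omega : e.totalDegree = 0)]

/-- The coordinates of the generic point are linearly independent over `k(t)`. -/
theorem CoprimeForms.eq_zero_of_sum_eq_zero (h : CoprimeForms q₁ q₂) {c : Fin 3 → RatFunc k}
    (hc : ∑ j, h.embedding (c j) * genericCoord k j = 0) : c = 0 := by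
  by_contra hc0
  set l : MvPolynomial (Fin 3) (RatFunc k) := ∑ j, C (c j) * X j with hl
  have hlh : l.IsHomogeneous 1 := IsHomogeneous.sum _ _ _ fun j _ => isHomogeneous_C_mul_X (c j) j
  have hle : eval₂ (h.embedding : RatFunc k →+* _) (genericCoord k) l = 0 := by
    rw [← hc, hl, eval₂_sum]
    simp
  have hl0 : l ≠ 0 := by
    intro h0
    apply hc0
    ext i
    have := congrArg (eval (Pi.single i 1)) h0
    simpa [hl, Pi.single_apply] using this
  obtain ⟨e, he⟩ := h.dvd_of_eval₂_eq_zero hle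
  have he0 : e ≠ 0 := fun h0 => hl0 (by rw [he, h0, mul_zero])
  have hp := pencilPoly_ne_zero h
  have := totalDegree_mul_of_isDomain hp he0
  rw [← he, hlh.totalDegree hl0, (pencilPoly_isHomogeneous h).totalDegree hp] at this
  omega

/-- The image of the generic point under a matrix over `k(t)`. -/
def CoprimeForms.act (h : CoprimeForms q₁ q₂) (M : Matrix (Fin 3) (Fin 3) (RatFunc k))
    (i : Fin 3) : FractionRing (MvPolynomial (Fin 3) k) :=
  ∑ j, h.embedding (M i j) * genericCoord k j

theorem CoprimeForms.act_ne_zero (h : CoprimeForms q₁ q₂)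
    {M : Matrix (Fin 3) (Fin 3) (RatFunc k)} (hM : M ≠ 0) : ∃ i, h.act M i ≠ 0 := by
  by_contra! h0
  exact hM (funext fun i => h.eq_zero_of_sum_eq_zero (h0 i))

theorem CoprimeForms.eval₂_bind₁_linPoly (h : CoprimeForms q₁ q₂)
    (M : Matrix (Fin 3) (Fin 3) (RatFunc k)) (G : MvPolynomial (Fin 3) (RatFunc k)) :
    eval₂ (h.embedding : RatFunc k →+* _) (genericCoord k) (bind₁ (linPoly M) G) =
      eval₂ (h.embedding : RatFunc k →+* _) (h.act M) G := by
  rw [← coe_eval₂Hom, eval₂Hom_bind₁, ← coe_eval₂Hom]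
  congr 2
  ext i
  simp [linPoly, CoprimeForms.act]

theorem CoprimeForms.eval₂_act_pencilPoly (h : CoprimeForms q₁ q₂)
    {M : Matrix (Fin 3) (Fin 3) (RatFunc k)} {c : RatFunc k}
    (hM : bind₁ (linPoly M) (pencilPoly q₁ q₂) = C c * pencilPoly q₁ q₂) :
    eval₂ (h.embedding : RatFunc k →+* _) (h.act M) (pencilPoly q₁ q₂) = 0 := by
  rw [← h.eval₂_bind₁_linPoly, hM, eval₂_mul, h.eval₂_genericCoord_pencilPoly, mul_zero]

/-- The image of the generic point under a similitude is again generic. -/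
theorem CoprimeForms.eq_zero_of_aeval_act_eq_zero (h : CoprimeForms q₁ q₂)
    {M N : Matrix (Fin 3) (Fin 3) (RatFunc k)} (hMN : M * N = 1) {c : RatFunc k}
    (hN : bind₁ (linPoly N) (pencilPoly q₁ q₂) = C c * pencilPoly q₁ q₂)
    {H : MvPolynomial (Fin 3) k} (hH : aeval (h.act M) H = 0) : H = 0 := by
  rw [← h.eval₂_map, ← h.eval₂_bind₁_linPoly] at hH
  have h1 := map_dvd (bind₁ (linPoly N)) (h.dvd_of_eval₂_eq_zero hH)
  rw [bind₁_linPoly_bind₁_linPoly, hMN, linPoly_one, hN] at h1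
  have h2 : pencilPoly q₁ q₂ ∣ map (algebraMap k (RatFunc k)) H := by
    refine (Dvd.intro_left _ rfl).trans (h1.trans ?_)
    rw [show (bind₁ X : MvPolynomial (Fin 3) (RatFunc k) →ₐ[RatFunc k] _) = AlgHom.id _ _ from
      aeval_X_left]
    rfl
  obtain ⟨e, he⟩ := h2
  have h3 := h.eval₂_map (genericCoord k) H
  rw [he, eval₂_mul, h.eval₂_genericCoord_pencilPoly, zero_mul, aeval_genericCoord] at h3
  exact (map_eq_zero_iff _ (IsFractionRing.injective _ _)).mp h3.symm

end GenericPoint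

/-! ### Field endomorphisms induced by dominant maps -/

section Substitution

variable {k : Type*} [Field k] {q₁ q₂ : MvPolynomial (Fin 3) k}

theorem ratFunc_algHom_ext {L : Type*} [Field L] [Algebra k L] {f g : RatFunc k →ₐ[k] L}
    (h : f RatFunc.X = g RatFunc.X) : f = g := by
  have hp : ∀ p : Polynomial k, f (algebraMap _ _ p) = g (algebraMap _ _ p) := by
    intro p
    have : (f.comp (Algebra.algHom k (Polynomial k) (RatFunc k))) =
        (g.comp (Algebra.algHom k (Polynomial k) (RatFunc k))) := by
      apply Polynomial.algHom_ext
      change f (algebraMap _ _ Polynomial.X) = g (algebraMap _ _ Polynomial.X)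
      rw [RatFunc.algebraMap_X, h]
    exact DFunLike.congr_fun this p
  ext a
  rw [← RatFunc.num_div_denom a, map_div₀, map_div₀, hp, hp]

/-- Pull-back along `F`. Preserving the ratio `q₁/q₂` means fixing the image of `t`, so the
endomorphism is linear over `k(t)`. -/
theorem CoprimeForms.exists_endomorphism (h : CoprimeForms q₁ q₂)
    {F : Fin 3 → MvPolynomial (Fin 3) k} (hF : Function.Injective (bind₁ F))
    (hq : bind₁ F q₁ * q₂ = bind₁ F q₂ * q₁) :
    ∃ σ : FractionRing (MvPolynomial (Fin 3) k) →ₐ[k] FractionRing (MvPolynomial (Fin 3) k),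
      (∀ G, σ (algebraMap _ _ G) = algebraMap _ _ (bind₁ F G)) ∧
      ∀ a, σ (h.embedding a) = h.embedding a := by
  set g : MvPolynomial (Fin 3) k →ₐ[k] FractionRing (MvPolynomial (Fin 3) k) :=
    (Algebra.algHom k (MvPolynomial (Fin 3) k) (FractionRing (MvPolynomial (Fin 3) k))).comp
      (bind₁ F)
  have hg : Function.Injective g := (IsFractionRing.injective (MvPolynomial (Fin 3) k) _).comp hF
  set σ : FractionRing (MvPolynomial (Fin 3) k) →ₐ[k] FractionRing (MvPolynomial (Fin 3) k) :=
    IsFractionRing.liftAlgHom hg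
  have hσ : ∀ G, σ (algebraMap _ _ G) = algebraMap _ _ (bind₁ F G) := fun G => by
    rw [IsFractionRing.liftAlgHom_apply]
    exact IsFractionRing.lift_algebraMap hg G
  refine ⟨σ, hσ, fun a => ?_⟩
  suffices σ.comp h.embedding = h.embedding from DFunLike.congr_fun this a
  apply ratFunc_algHom_ext
  have h2 : algebraMap _ (FractionRing (MvPolynomial (Fin 3) k)) (bind₁ F q₂) ≠ 0 :=
    (map_ne_zero_iff _ (IsFractionRing.injective _ _)).mpr
      ((map_ne_zero_iff _ hF).mpr h.ne_zero₂)
  rw [AlgHom.comp_apply, h.embedding_X, map_div₀, map_neg, hσ, hσ,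
    div_eq_div_iff h2 h.algebraMap_ne_zero₂, neg_mul, neg_mul, ← map_mul, ← map_mul, hq, mul_comm]

/-- A dominant substitution by forms is injective. -/
theorem bind₁_injective_of_dominant {F : Fin 3 → MvPolynomial (Fin 3) k} {e : ℕ}
    (hF : ∀ i, (F i).IsHomogeneous e)
    (hd : ∀ (d : ℕ) (H : MvPolynomial (Fin 3) k), H.IsHomogeneous d → H ≠ 0 → bind₁ F H ≠ 0) :
    Function.Injective (bind₁ F) := by
  -- Constant coordinates satisfy a linear relation, so they are not dominant. With `e ≠ 0`,
  -- components of different degrees `d` are sent to different degrees `e * d` and cannot cancel.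
  have he : e ≠ 0 := by
    rintro rfl
    have hc : ∀ i, F i = C (coeff 0 (F i)) := fun i =>
      totalDegree_eq_zero_iff_eq_C.mp (Nat.le_zero.mp (hF i).totalDegree_le)
    set H : MvPolynomial (Fin 3) k := C (coeff 0 (F 1)) * X 0 - C (coeff 0 (F 0)) * X 1 with hH
    have h1 : bind₁ F H = 0 := by
      rw [hH, map_sub, map_mul, map_mul, bind₁_C_right, bind₁_C_right, bind₁_X_right,
        bind₁_X_right, ← hc, ← hc]
      ring
    by_cases h0 : F 0 = 0
    · exact hd 1 (X 0) (isHomogeneous_X _ _) (X_ne_zero _) (by rw [bind₁_X_right, h0])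
    · refine hd 1 H ((isHomogeneous_C_mul_X _ _).sub (isHomogeneous_C_mul_X _ _)) ?_ h1
      intro hH0
      have := congrArg (eval (Pi.single 1 1)) hH0
      rw [hc] at h0
      simp [hH] at this
      simp [this] at h0
  rw [injective_iff_map_eq_zero]
  intro H h0
  rw [← sum_homogeneousComponent H]
  refine Finset.sum_eq_zero fun d hdm => ?_
  by_contra hne
  refine hd d _ (homogeneousComponent_isHomogeneous d H) hne ?_
  have h1 : homogeneousComponent (e * d) (bind₁ F H) = bind₁ F (homogeneousComponent d H) := by
    conv_lhs => rw [← sum_homogeneousComponent H]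
    have hb : ∀ d', (bind₁ F (homogeneousComponent d' H)).IsHomogeneous (e * d') := fun d' =>
      (homogeneousComponent_isHomogeneous d' H).aeval F hF
    rw [map_sum, map_sum, Finset.sum_eq_single d]
    · rw [homogeneousComponent_of_mem
        (hb d), if_pos rfl]
    · intro d' _ hdd
      rw [homogeneousComponent_of_mem
        (hb d'), if_neg]
      intro h2
      exact hdd (Nat.eq_of_mul_eq_mul_left (Nat.pos_of_ne_zero he) h2).symm
    · intro h2
      exact absurd hdm h2
  rw [← h1, h0, map_zero]

end Substitution
end

noncomputable section

/-! ### Automorphisms of a parametrized conic are linear -/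

section Moebius

/-- The degree of `K(X)` over `K(r)` is the larger of the degrees of numerator and denominator of
`r`; here it is `1`. -/
theorem exists_moebius_of_mem_adjoin {K : Type*} [Field K] {r : RatFunc K}
    (hr : RatFunc.X ∈ IntermediateField.adjoin K {r}) :
    ∃ α β γ δ : K, RatFunc.C γ + RatFunc.C δ * RatFunc.X ≠ 0 ∧
      r * (RatFunc.C γ + RatFunc.C δ * RatFunc.X) = RatFunc.C α + RatFunc.C β * RatFunc.X := by
  have htop : IntermediateField.adjoin K {r} = ⊤ := by
    rw [eq_top_iff, ← RatFunc.adjoin_X, IntermediateField.adjoin_simple_le_iff]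
    exact hr
  have hdeg := RatFunc.finrank_eq_max_natDegree r
  rw [htop, IntermediateField.finrank_top] at hdeg
  have hp : ∀ p : Polynomial K, p.natDegree ≤ 1 → algebraMap _ (RatFunc K) p =
      RatFunc.C (p.coeff 0) + RatFunc.C (p.coeff 1) * RatFunc.X := by
    intro p hp
    conv_lhs => rw [Polynomial.eq_X_add_C_of_natDegree_le_one hp]
    simp
    ring
  refine ⟨r.num.coeff 0, r.num.coeff 1, r.denom.coeff 0, r.denom.coeff 1, ?_, ?_⟩
  · rw [← hp _ (hdeg ▸ le_max_right _ _)]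
    exact RatFunc.algebraMap_ne_zero r.denom_ne_zero
  · rw [← hp _ (hdeg ▸ le_max_right _ _), ← hp _ (hdeg ▸ le_max_left _ _)]
    nth_rw 1 [← RatFunc.num_div_denom r]
    exact div_mul_cancel₀ _ (RatFunc.algebraMap_ne_zero r.denom_ne_zero)

/-- An endomorphism of `L` over `K` under which `K(u)` has an inverse image of `u` acts on `u` by a
Möbius transformation. -/
theorem exists_moebius {K L : Type*} [Field K] [Field L] [Algebra K L] {u : L}
    (hu : Transcendental K u) (σ : L →ₐ[K] L) (h1 : σ u ∈ IntermediateField.adjoin K {u})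
    {w : L} (hw : w ∈ IntermediateField.adjoin K {u}) (h2 : σ w = u) :
    ∃ α β γ δ : K, algebraMap K L γ + algebraMap K L δ * u ≠ 0 ∧
      σ u * (algebraMap K L γ + algebraMap K L δ * u) =
        algebraMap K L α + algebraMap K L β * u := by
  let φ : RatFunc K →ₐ[K] L :=
    (IntermediateField.val _).comp (RatFunc.algEquivOfTranscendental u hu).toAlgHom
  have hφX : φ RatFunc.X = u := RatFunc.algEquivOfTranscendental_X u hu
  have hφC : ∀ c, φ (RatFunc.C c) = algebraMap K L c := fun c => by
    rw [← RatFunc.algebraMap_eq_C]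
    exact φ.commutes c
  set r : RatFunc K := (RatFunc.algEquivOfTranscendental u hu).symm ⟨σ u, h1⟩ with hr
  have hφr : φ r = σ u := by
    simp [φ, hr]
  have hmem : u ∈ IntermediateField.adjoin K {σ u} := by
    have : σ w ∈ (IntermediateField.adjoin K {u}).map σ := ⟨w, hw, rfl⟩
    rwa [h2, IntermediateField.adjoin_map, Set.image_singleton] at this
  have hX : RatFunc.X ∈ IntermediateField.adjoin K {r} := by
    rw [← hφr, ← Set.image_singleton (f := φ), ← IntermediateField.adjoin_map] at hmem
    obtain ⟨x, hx, hxu⟩ := hmem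
    have : x = RatFunc.X := φ.injective (hxu.trans hφX.symm)
    rwa [← this]
  obtain ⟨α, β, γ, δ, hne, h⟩ := exists_moebius_of_mem_adjoin hX
  refine ⟨α, β, γ, δ, ?_, ?_⟩
  · have := (map_ne_zero φ).mpr hne
    rwa [map_add, map_mul, hφC, hφC, hφX] at this
  · have := congrArg φ h
    rwa [map_mul, map_add, map_mul, map_add, map_mul, hφC, hφC, hφC, hφC, hφX, hφr] at this

/-- A conic of the shape `a y₀ y₁ + b y₁ y₂ + c y₀ y₂ = 0` over `K`, at a point `y` with
transcendental `u = y₂ / y₁`: a `K`-endomorphism acting invertibly on `K(u)` acts linearly. -/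
theorem exists_linear_of_conic {K L : Type*} [Field K] [Field L] [Algebra K L] {a b c : K}
    (ha : a ≠ 0) (hb : b ≠ 0) (hc : c ≠ 0) {y : Fin 3 → L} (hy1 : y 1 ≠ 0)
    (hy : algebraMap K L a * (y 0 * y 1) + algebraMap K L b * (y 1 * y 2) +
      algebraMap K L c * (y 0 * y 2) = 0)
    (hu : Transcendental K (y 2 / y 1)) (σ : L →ₐ[K] L)
    (h1 : σ (y 2 / y 1) ∈ IntermediateField.adjoin K {y 2 / y 1})
    {w : L} (hw : w ∈ IntermediateField.adjoin K {y 2 / y 1}) (h2 : σ w = y 2 / y 1) :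
    ∃ (A : Matrix (Fin 3) (Fin 3) K) (μ : L), μ ≠ 0 ∧
      ∀ i, σ (y i) = μ * ∑ j, algebraMap K L (A i j) * y j := by
  obtain ⟨α, β, γ, δ, hD, hm⟩ := exists_moebius hu σ h1 hw h2
  set u := y 2 / y 1 with hu_def
  have ha' := (map_ne_zero (algebraMap K L)).mpr ha
  have hb' := (map_ne_zero (algebraMap K L)).mpr hb
  have hc' := (map_ne_zero (algebraMap K L)).mpr hc
  have hne : algebraMap K L a + algebraMap K L c * u ≠ 0 := by
    intro h0
    have : u = algebraMap K L (-a / c) := by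
      rw [map_div₀, map_neg]
      field_simp
      linear_combination h0
    exact hu (this ▸ isAlgebraic_algebraMap _)
  have hy2 : y 2 = u * y 1 := by rw [hu_def, div_mul_cancel₀ _ hy1]
  -- Parametrization of the conic: `y = W · (-b u, a + c u, u (a + c u))`.
  set W := y 1 / (algebraMap K L a + algebraMap K L c * u) with hW
  have hW0 : W ≠ 0 := div_ne_zero hy1 hne
  have hWy1 : y 1 = (algebraMap K L a + algebraMap K L c * u) * W := by
    rw [hW]; field_simp
  have hWy2 : y 2 = u * (algebraMap K L a + algebraMap K L c * u) * W := by
    rw [hy2, hWy1]; ring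
  have hWy0 : y 0 = - algebraMap K L b * u * W := by
    apply mul_right_cancel₀ (mul_ne_zero hy1 hne)
    rw [hy2] at hy
    rw [hWy1] at hy ⊢
    linear_combination hy
  -- every quadratic polynomial in `u` is, up to the factor `W`, a linear form in `y`
  have hquad : ∀ e₀ e₁ e₂ : K, ∑ j, algebraMap K L
      (![e₀ * c / (a * b) - e₁ / b + e₂ * a / (b * c), e₀ / a, e₂ / c] j) * y j =
      W * (algebraMap K L e₀ + algebraMap K L e₁ * u + algebraMap K L e₂ * u ^ 2) := by
    intro e₀ e₁ e₂
    rw [Fin.sum_univ_three, hWy0, hWy1, hWy2]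
    simp only [Matrix.cons_val, map_add, map_sub, map_mul, map_div₀]
    field_simp
    ring
  have hσy1 : σ (y 1) ≠ 0 := (map_ne_zero σ).mpr hy1
  have hσy2 : σ (y 2) = σ u * σ (y 1) := by rw [hy2, map_mul]
  have hσne : algebraMap K L a + algebraMap K L c * σ u ≠ 0 := by
    have := (map_ne_zero σ).mpr hne
    rwa [map_add, map_mul, σ.commutes, σ.commutes] at this
  have hσy : σ (y 0) * (algebraMap K L a + algebraMap K L c * σ u) =
      - algebraMap K L b * σ u * σ (y 1) := by
    have := congrArg σ hy
    simp only [map_add, map_mul, σ.commutes, map_zero, hσy2] at this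
    apply mul_right_cancel₀ hσy1
    linear_combination this
  set D := algebraMap K L γ + algebraMap K L δ * u with hD_def
  set N := algebraMap K L α + algebraMap K L β * u with hN_def
  have hE : algebraMap K L a * D + algebraMap K L c * N ≠ 0 := by
    rw [← hm]
    have := mul_ne_zero hσne hD
    rwa [add_mul, mul_assoc] at this
  have hσu : σ u = N / D := by rw [← hm, mul_div_cancel_right₀ _ hD]
  set ν := σ (y 1) / (D * (algebraMap K L a * D + algebraMap K L c * N)) with hν
  -- With `σ u = N / D`, the image of `y` is proportional to `(-b N D, D (a D + c N), N (a D + c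
  -- N))`. The rows are the coefficients given by `hquad` for these three quadratic polynomials in
  -- `u`.
  refine ⟨![
    ![(-b * (α * γ)) * c / (a * b) - (-b * (α * δ + β * γ)) / b + (-b * (β * δ)) * a / (b * c),
      (-b * (α * γ)) / a, (-b * (β * δ)) / c],
    ![(a * γ ^ 2 + c * (α * γ)) * c / (a * b) -
        (2 * a * γ * δ + c * (α * δ + β * γ)) / b + (a * δ ^ 2 + c * (β * δ)) * a / (b * c),
      (a * γ ^ 2 + c * (α * γ)) / a, (a * δ ^ 2 + c * (β * δ)) / c],
    ![(a * (α * γ) + c * α ^ 2) * c / (a * b) -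
        (a * (α * δ + β * γ) + 2 * c * α * β) / b + (a * (β * δ) + c * β ^ 2) * a / (b * c),
      (a * (α * γ) + c * α ^ 2) / a, (a * (β * δ) + c * β ^ 2) / c]], ν / W,
    div_ne_zero (div_ne_zero hσy1 (mul_ne_zero hD hE)) hW0, ?_⟩
  have hy1' : σ (y 1) = ν * (D * (algebraMap K L a * D + algebraMap K L c * N)) := by
    rw [hν, div_mul_cancel₀ _ (mul_ne_zero hD hE)]
  have hred : ∀ z : L, ν / W * (W * z) = ν * z := fun z => by
    field_simp
  intro i
  fin_cases i
  · refine Eq.trans ?_ (congrArg (ν / W * ·) (hquad _ _ _).symm)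
    rw [hred]
    apply mul_right_cancel₀ hσne
    change σ (y 0) * _ = _
    rw [hσy, hy1', hσu]
    simp only [map_add, map_mul, map_neg]
    field_simp
    rw [hD_def, hN_def]
    ring
  · refine Eq.trans ?_ (congrArg (ν / W * ·) (hquad _ _ _).symm)
    change σ (y 1) = ν / W * (W * _)
    rw [hred, hy1', hD_def, hN_def]
    simp only [map_add, map_mul, map_pow, map_ofNat]
    ring
  · refine Eq.trans ?_ (congrArg (ν / W * ·) (hquad _ _ _).symm)
    change σ (y 2) = ν / W * (W * _)
    rw [hred, hσy2, hy1', hσu]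
    simp only [map_add, map_mul, map_pow, map_ofNat]
    field_simp
    rw [hD_def, hN_def]
    ring

end Moebius
end

noncomputable section

/-! ### Linearity of fibre-preserving maps in a rational frame -/

section FrameLinear

variable {k : Type*} [Field k] {q₁ q₂ : MvPolynomial (Fin 3) k}

theorem sum_homogenized_eq {K L : Type*} [Field K] [CommRing L] (f : K →+* L) (P : Polynomial K)
    (u v : L) :
    ∑ n ∈ Finset.range (P.natDegree + 1), f (P.coeff n) * ((u * v) ^ n * v ^ (P.natDegree - n)) =
      v ^ P.natDegree * P.eval₂ f u := by
  rw [Polynomial.eval₂_eq_sum_range, Finset.mul_sum]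
  refine Finset.sum_congr rfl fun n hn => ?_
  have : v ^ P.natDegree = v ^ n * v ^ (P.natDegree - n) := by
    rw [← pow_add]
    congr 1
    have := Finset.mem_range.mp hn
    omega
  rw [this]
  ring

instance infinite_ratFunc (K : Type*) [Field K] : Infinite (RatFunc K) :=
  Infinite.of_injective _ (RatFunc.algebraMap_injective K)

/-- A frame in which the pencil consists of the conics through the coordinate points and
`[1 : 1 : 1]`. -/
structure PencilFrame (q₁ q₂ : MvPolynomial (Fin 3) k) where
  V : Matrix (Fin 3) (Fin 3) k
  W : Matrix (Fin 3) (Fin 3) k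
  V_mul_W : V * W = 1
  a₁ : k
  b₁ : k
  a₂ : k
  b₂ : k
  disc_ne_zero : a₁ * b₂ - a₂ * b₁ ≠ 0
  eq₁ : bind₁ (linPoly V) q₁ = C a₁ * (X 0 * X 1 - X 0 * X 2) + C b₁ * (X 1 * X 2 - X 0 * X 2)
  eq₂ : bind₁ (linPoly V) q₂ = C a₂ * (X 0 * X 1 - X 0 * X 2) + C b₂ * (X 1 * X 2 - X 0 * X 2)

namespace PencilFrame

variable (𝓕 : PencilFrame q₁ q₂)

theorem W_mul_V : 𝓕.W * 𝓕.V = 1 := mul_eq_one_comm.mp 𝓕.V_mul_W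

def a : RatFunc k := RatFunc.C 𝓕.a₁ + RatFunc.X * RatFunc.C 𝓕.a₂

def b : RatFunc k := RatFunc.C 𝓕.b₁ + RatFunc.X * RatFunc.C 𝓕.b₂

theorem ratFunc_pencil_ne_zero {x y : k} (h : x ≠ 0 ∨ y ≠ 0) :
    RatFunc.C x + RatFunc.X * RatFunc.C y ≠ 0 := by
  intro h0
  rw [← RatFunc.algebraMap_C, ← RatFunc.algebraMap_C, ← RatFunc.algebraMap_X, ← map_mul, ← map_add,
    map_eq_zero_iff _ (RatFunc.algebraMap_injective k)] at h0
  have hx := congrArg (Polynomial.coeff · 0) h0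
  have hy := congrArg (Polynomial.coeff · 1) h0
  simp [Polynomial.coeff_C] at hx hy
  simp_all

theorem a_ne_zero : 𝓕.a ≠ 0 := by
  apply ratFunc_pencil_ne_zero
  by_contra! h
  exact 𝓕.disc_ne_zero (by rw [h.1, h.2]; ring)

theorem b_ne_zero : 𝓕.b ≠ 0 := by
  apply ratFunc_pencil_ne_zero
  by_contra! h
  exact 𝓕.disc_ne_zero (by rw [h.1, h.2]; ring)

theorem a_add_b_ne_zero : 𝓕.a + 𝓕.b ≠ 0 := by
  have : 𝓕.a + 𝓕.b = RatFunc.C (𝓕.a₁ + 𝓕.b₁) + RatFunc.X * RatFunc.C (𝓕.a₂ + 𝓕.b₂) := by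
    simp only [a, b, map_add]
    ring
  rw [this]
  apply ratFunc_pencil_ne_zero
  by_contra! h
  refine 𝓕.disc_ne_zero ?_
  linear_combination 𝓕.a₁ * h.2 - 𝓕.a₂ * h.1

/-- The coordinates in the frame, as linear forms. -/
def coordPoly (i : Fin 3) : MvPolynomial (Fin 3) k := linPoly 𝓕.W i

/-- The coordinates of the generic point in the frame. -/
def coord (i : Fin 3) : FractionRing (MvPolynomial (Fin 3) k) := algebraMap _ _ (𝓕.coordPoly i)

theorem coordPoly_ne_zero (i : Fin 3) : 𝓕.coordPoly i ≠ 0 := by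
  intro h
  have h1 := bind₁_linPoly_linPoly 𝓕.V 𝓕.W i
  rw [𝓕.W_mul_V, linPoly_one] at h1
  rw [coordPoly] at h
  rw [h, map_zero] at h1
  exact X_ne_zero i h1.symm

theorem coord_ne_zero (i : Fin 3) : 𝓕.coord i ≠ 0 :=
  (map_ne_zero_iff _ (IsFractionRing.injective _ _)).mpr (𝓕.coordPoly_ne_zero i)

theorem X_eq (i : Fin 3) : X i = ∑ j, C (𝓕.V i j) * 𝓕.coordPoly j := by
  have h := bind₁_linPoly_linPoly 𝓕.W 𝓕.V i
  rw [𝓕.V_mul_W, linPoly_one] at h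
  rw [← h]
  simp [linPoly, coordPoly]

theorem algebraMap_C (c : k) :
    algebraMap (MvPolynomial (Fin 3) k) (FractionRing (MvPolynomial (Fin 3) k)) (C c) =
      algebraMap k _ c := by
  rw [← MvPolynomial.algebraMap_eq, ← IsScalarTower.algebraMap_apply]

theorem genericCoord_eq (i : Fin 3) :
    genericCoord k i = ∑ j, algebraMap k _ (𝓕.V i j) * 𝓕.coord j := by
  rw [genericCoord, 𝓕.X_eq i, map_sum]
  simp only [map_mul, algebraMap_C, coord]

theorem aeval_coord_bind₁ (G : MvPolynomial (Fin 3) k) :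
    aeval 𝓕.coord (bind₁ (linPoly 𝓕.V) G) = algebraMap _ _ G := by
  rw [aeval_bind₁, ← aeval_genericCoord]
  congr 2
  ext i
  rw [𝓕.genericCoord_eq i]
  simp [linPoly]

theorem conic_coord (h : CoprimeForms q₁ q₂) :
    h.embedding 𝓕.a * (𝓕.coord 0 * 𝓕.coord 1) + h.embedding 𝓕.b * (𝓕.coord 1 * 𝓕.coord 2) +
      h.embedding (-(𝓕.a + 𝓕.b)) * (𝓕.coord 0 * 𝓕.coord 2) = 0 := by
  have h1 := 𝓕.aeval_coord_bind₁ q₁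
  have h2 := 𝓕.aeval_coord_bind₁ q₂
  have h3 := h.embedding_X_mul
  rw [𝓕.eq₁] at h1
  rw [𝓕.eq₂] at h2
  have hC : ∀ c, h.embedding (RatFunc.C c) = algebraMap k _ c := fun c => by
    rw [← RatFunc.algebraMap_eq_C]
    exact h.embedding.commutes c
  rw [← h1, ← h2] at h3
  simp only [map_add, map_mul, map_sub, aeval_C, aeval_X] at h3
  simp only [a, b, map_add, map_mul, map_neg, hC]
  linear_combination h3

theorem eval_pencilPoly (v : Fin 3 → RatFunc k) :
    eval ((𝓕.V.map (algebraMap k (RatFunc k))).mulVec v) (pencilPoly q₁ q₂) =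
      𝓕.a * (v 0 * v 1 - v 0 * v 2) + 𝓕.b * (v 1 * v 2 - v 0 * v 2) := by
  have hG : ∀ G : MvPolynomial (Fin 3) k,
      eval ((𝓕.V.map (algebraMap k (RatFunc k))).mulVec v) (map (algebraMap k (RatFunc k)) G) =
      aeval v (bind₁ (linPoly 𝓕.V) G) := by
    intro G
    rw [aeval_bind₁, aeval_def, eval₂_eq_eval_map]
    congr 2
    ext i
    simp [linPoly, Matrix.mulVec, dotProduct]
  rw [pencilPoly, map_add, map_mul, eval_C, hG, hG, 𝓕.eq₁, 𝓕.eq₂]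
  simp only [map_add, map_mul, map_sub, aeval_C, aeval_X, a, b, RatFunc.algebraMap_eq_C]
  ring

/-- A relation `P(u) = 0`, homogenized, vanishes at the generic point and is therefore a multiple of
the conic. Its values at the `k(t)`-rational points of the conic then give `P` too many zeros. -/
theorem transcendental_coord (h : CoprimeForms q₁ q₂) :
    letI : Algebra (RatFunc k) (FractionRing (MvPolynomial (Fin 3) k)) :=
      h.embedding.toRingHom.toAlgebra
    Transcendental (RatFunc k) (𝓕.coord 2 / 𝓕.coord 1) := by
  let : Algebra (RatFunc k) (FractionRing (MvPolynomial (Fin 3) k)) :=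
      h.embedding.toRingHom.toAlgebra
  rw [transcendental_iff]
  intro P hP
  set Y : Fin 3 → MvPolynomial (Fin 3) (RatFunc k) :=
    fun i => map (algebraMap k (RatFunc k)) (𝓕.coordPoly i) with hY
  set H : MvPolynomial (Fin 3) (RatFunc k) := ∑ n ∈ Finset.range (P.natDegree + 1),
    C (P.coeff n) * (Y 2 ^ n * Y 1 ^ (P.natDegree - n)) with hH
  have hYe : ∀ i, eval₂ (h.embedding : RatFunc k →+* _) (genericCoord k) (Y i) = 𝓕.coord i := by
    intro i
    rw [hY, h.eval₂_map, aeval_genericCoord, coord]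
  have hH0 : eval₂ (h.embedding : RatFunc k →+* _) (genericCoord k) H = 0 := by
    rw [hH, eval₂_sum]
    simp only [eval₂_mul, eval₂_C, eval₂_pow, hYe]
    have := sum_homogenized_eq (h.embedding : RatFunc k →+* _) P (𝓕.coord 2 / 𝓕.coord 1)
      (𝓕.coord 1)
    rw [div_mul_cancel₀ _ (𝓕.coord_ne_zero 1)] at this
    rw [this]
    exact mul_eq_zero_of_right _ hP
  obtain ⟨e, he⟩ := h.dvd_of_eval₂_eq_zero hH0
  have hWV : (𝓕.W.map (algebraMap k (RatFunc k))) * (𝓕.V.map (algebraMap k (RatFunc k))) = 1 := by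
    rw [← Matrix.map_mul, 𝓕.W_mul_V, Matrix.map_one _ (map_zero _) (map_one _)]
  have hYv : ∀ (v : Fin 3 → RatFunc k) i,
      eval ((𝓕.V.map (algebraMap k (RatFunc k))).mulVec v) (Y i) = v i := by
    intro v i
    have h1 : eval ((𝓕.V.map (algebraMap k (RatFunc k))).mulVec v) (Y i) =
        (𝓕.W.map (algebraMap k (RatFunc k))).mulVec
          ((𝓕.V.map (algebraMap k (RatFunc k))).mulVec v) i := by
      simp [hY, coordPoly, linPoly, Matrix.mulVec, dotProduct]
    rw [h1, Matrix.mulVec_mulVec, hWV, Matrix.one_mulVec]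
  -- Evaluate at `(-b l, m, l m)`, the point of the conic with parameter `u = l`.
  have key : ∀ l : RatFunc k, 𝓕.a - (𝓕.a + 𝓕.b) * l ≠ 0 → P.eval l = 0 := by
    intro l hl
    set m := 𝓕.a - (𝓕.a + 𝓕.b) * l with hm
    have h1 := congrArg (eval ((𝓕.V.map (algebraMap k (RatFunc k))).mulVec
      ![-𝓕.b * l, m, l * m])) he
    rw [map_mul, 𝓕.eval_pencilPoly, hH, map_sum] at h1
    simp only [map_mul, eval_C, map_pow, hYv] at h1
    simp only [Matrix.cons_val] at h1
    have h2 := sum_homogenized_eq (RingHom.id (RatFunc k)) P l m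
    simp only [RingHom.id_apply] at h2
    rw [h2] at h1
    have h3 : m ^ P.natDegree * Polynomial.eval₂ (RingHom.id _) l P = 0 := by
      rw [h1]
      apply mul_eq_zero_of_left
      rw [hm]
      ring
    simpa [hl, Polynomial.eval₂_id] using h3
  -- The extra factor takes care of the excluded parameter, so the product vanishes at every element
  -- of an infinite field.
  have hprod : P * (Polynomial.C 𝓕.a - Polynomial.C (𝓕.a + 𝓕.b) * Polynomial.X) = 0 := by
    apply Polynomial.funext
    intro l
    rw [Polynomial.eval_mul, Polynomial.eval_zero]
    by_cases hl : 𝓕.a - (𝓕.a + 𝓕.b) * l = 0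
    · apply mul_eq_zero_of_right
      simpa using hl
    · rw [key l hl, zero_mul]
  refine (mul_eq_zero.mp hprod).resolve_right fun h0 => 𝓕.a_ne_zero ?_
  simpa using congrArg (Polynomial.coeff · 0) h0

/-- Fractions of degree zero lie in `k(t)(u)`, where `u` is the affine coordinate of the conic. -/
theorem div_pow_mem (h : CoprimeForms q₁ q₂) {H : MvPolynomial (Fin 3) k} {d : ℕ}
    (hH : H.IsHomogeneous d) :
    letI : Algebra (RatFunc k) (FractionRing (MvPolynomial (Fin 3) k)) :=
      h.embedding.toRingHom.toAlgebra
    algebraMap _ _ H / 𝓕.coord 1 ^ d ∈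
      IntermediateField.adjoin (RatFunc k) {𝓕.coord 2 / 𝓕.coord 1} := by
  let : Algebra (RatFunc k) (FractionRing (MvPolynomial (Fin 3) k)) :=
      h.embedding.toRingHom.toAlgebra
  set E := IntermediateField.adjoin (RatFunc k) {𝓕.coord 2 / 𝓕.coord 1} with hE
  have hal : ∀ a, h.embedding a ∈ E := fun a => E.algebraMap_mem a
  have hkE : ∀ c : k, algebraMap k _ c ∈ E := fun c => by
    rw [← h.embedding.commutes c]
    exact hal _
  have hu : 𝓕.coord 2 / 𝓕.coord 1 ∈ E := IntermediateField.mem_adjoin_simple_self _ _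
  have h1 := 𝓕.coord_ne_zero 1
  -- The equation of the conic is linear in `y₀`, so it expresses `y₀ / y₁` through `u`.
  have h0 : 𝓕.coord 0 / 𝓕.coord 1 ∈ E := by
    set u := 𝓕.coord 2 / 𝓕.coord 1 with hu_def
    have hne : h.embedding 𝓕.a + h.embedding (-(𝓕.a + 𝓕.b)) * u ≠ 0 := by
      intro h0
      have hc : h.embedding (-(𝓕.a + 𝓕.b)) ≠ 0 :=
        (map_ne_zero _).mpr (neg_ne_zero.mpr 𝓕.a_add_b_ne_zero)
      have : u = algebraMap (RatFunc k) _ (-𝓕.a / (-(𝓕.a + 𝓕.b))) := by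
        change u = h.embedding _
        rw [map_div₀, map_neg, eq_div_iff hc]
        linear_combination h0
      refine 𝓕.transcendental_coord h ?_
      rw [← hu_def, this]
      exact isAlgebraic_algebraMap _
    have : 𝓕.coord 0 / 𝓕.coord 1 = -(h.embedding 𝓕.b * u) /
        (h.embedding 𝓕.a + h.embedding (-(𝓕.a + 𝓕.b)) * u) := by
      rw [div_eq_div_iff h1 hne]
      have hc := 𝓕.conic_coord h
      have h2 : 𝓕.coord 2 = u * 𝓕.coord 1 := by rw [hu_def, div_mul_cancel₀ _ h1]
      apply mul_right_cancel₀ h1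
      rw [h2] at hc
      linear_combination hc
    rw [this]
    exact E.div_mem (E.neg_mem (E.mul_mem (hal _) hu))
      (E.add_mem (hal _) (E.mul_mem (hal _) hu))
  have hx : ∀ i, (𝓕.coord 1)⁻¹ * genericCoord k i ∈ E := by
    intro i
    rw [𝓕.genericCoord_eq, Fin.sum_univ_three, mul_add, mul_add]
    have hcd : ∀ j, 𝓕.coord j / 𝓕.coord 1 ∈ E := by
      intro j
      fin_cases j
      · exact h0
      · change 𝓕.coord 1 / 𝓕.coord 1 ∈ E
        rw [div_self h1]
        exact E.one_mem
      · exact hu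
    have hcj : ∀ j, (𝓕.coord 1)⁻¹ * (algebraMap k _ (𝓕.V i j) * 𝓕.coord j) ∈ E := by
      intro j
      rw [show (𝓕.coord 1)⁻¹ * (algebraMap k _ (𝓕.V i j) * 𝓕.coord j) =
        algebraMap k _ (𝓕.V i j) * (𝓕.coord j / 𝓕.coord 1) by ring]
      exact E.mul_mem (hkE _) (hcd j)
    exact E.add_mem (E.add_mem (hcj 0) (hcj 1)) (hcj 2)
  have hs := aeval_mul_of_isHomogeneous hH (𝓕.coord 1)⁻¹ (genericCoord k)
  rw [aeval_genericCoord, inv_pow, mul_comm, ← div_eq_mul_inv] at hs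
  rw [← hs, aeval_def, eval₂_eq']
  exact sum_mem fun m _ => E.mul_mem (hkE _) (prod_mem fun i _ => pow_mem (hx i) _)

theorem isHomogeneous_bind₁_coordPoly {F : Fin 3 → MvPolynomial (Fin 3) k} {d : ℕ}
    (hF : ∀ i, (F i).IsHomogeneous d) (i : Fin 3) :
    (bind₁ F (𝓕.coordPoly i)).IsHomogeneous d := by
  have := (linPoly_isHomogeneous 𝓕.W i).aeval F hF
  rwa [mul_one] at this

theorem div_mem (h : CoprimeForms q₁ q₂) {H H' : MvPolynomial (Fin 3) k} {d : ℕ}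
    (hH : H.IsHomogeneous d) (hH' : H'.IsHomogeneous d) :
    letI : Algebra (RatFunc k) (FractionRing (MvPolynomial (Fin 3) k)) :=
      h.embedding.toRingHom.toAlgebra
    algebraMap _ _ H / algebraMap _ _ H' ∈
      IntermediateField.adjoin (RatFunc k) {𝓕.coord 2 / 𝓕.coord 1} := by
  let : Algebra (RatFunc k) (FractionRing (MvPolynomial (Fin 3) k)) :=
      h.embedding.toRingHom.toAlgebra
  have h1 := IntermediateField.div_mem _ (𝓕.div_pow_mem h hH) (𝓕.div_pow_mem h hH')
  rwa [div_div_div_cancel_right₀ (pow_ne_zero d (𝓕.coord_ne_zero 1))] at h1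

/-- A birational self-map of the plane preserving each member of the pencil acts linearly over the
field `k(t)`. -/
theorem exists_matrix (𝓕 : PencilFrame q₁ q₂) (h : CoprimeForms q₁ q₂)
    {F G : Fin 3 → MvPolynomial (Fin 3) k} {d e : ℕ} (hF : ∀ i, (F i).IsHomogeneous d) (hG : ∀ i, (G i).IsHomogeneous e)
    (hinj : Function.Injective (bind₁ F)) (hq : bind₁ F q₁ * q₂ = bind₁ F q₂ * q₁)
    (hG0 : ∃ i, G i ≠ 0)
    (hGF : ∀ i j, bind₁ F (G i) * X j = bind₁ F (G j) * X i) :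
    ∃ (M : Matrix (Fin 3) (Fin 3) (RatFunc k)) (μ : FractionRing (MvPolynomial (Fin 3) k)),
      μ ≠ 0 ∧ ∀ i, algebraMap _ _ (F i) = μ * h.act M i := by
  let : Algebra (RatFunc k) (FractionRing (MvPolynomial (Fin 3) k)) :=
      h.embedding.toRingHom.toAlgebra
  obtain ⟨σ, hσ, hσι⟩ := h.exists_endomorphism hinj hq
  let σ' : FractionRing (MvPolynomial (Fin 3) k) →ₐ[RatFunc k]
    FractionRing (MvPolynomial (Fin 3) k) := { σ with commutes' := hσι }
  have hσ' : ∀ x, σ' x = σ x := fun _ => rfl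
  have hσy : ∀ i, σ (𝓕.coord i) = algebraMap _ _ (bind₁ F (𝓕.coordPoly i)) := fun i => hσ _
  have hσu : σ' (𝓕.coord 2 / 𝓕.coord 1) ∈
      IntermediateField.adjoin (RatFunc k) {𝓕.coord 2 / 𝓕.coord 1} := by
    rw [map_div₀, hσ', hσ', hσy, hσy]
    exact 𝓕.div_mem h (𝓕.isHomogeneous_bind₁_coordPoly hF 2) (𝓕.isHomogeneous_bind₁_coordPoly hF 1)
  -- the preimage of `u`
  obtain ⟨i₀, hi₀⟩ := hG0
  -- The composite of the two maps is `[x : y : z]` only up to this common factor, which cancels in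
  -- the ratio `u`.
  set l := algebraMap _ (FractionRing (MvPolynomial (Fin 3) k)) (bind₁ F (G i₀)) /
    genericCoord k i₀ with hl
  have hX : ∀ i, genericCoord k i ≠ 0 := fun i =>
    (map_ne_zero_iff _ (IsFractionRing.injective _ _)).mpr (X_ne_zero i)
  have hl0 : l ≠ 0 := div_ne_zero ((map_ne_zero_iff _ (IsFractionRing.injective _ _)).mpr
    ((map_ne_zero_iff _ hinj).mpr hi₀)) (hX i₀)
  have hGl : ∀ i, σ (algebraMap _ _ (G i)) = l * genericCoord k i := by
    intro i
    have := congrArg (algebraMap _ (FractionRing (MvPolynomial (Fin 3) k))) (hGF i i₀)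
    rw [map_mul, map_mul] at this
    rw [hσ, hl, div_mul_eq_mul_div, eq_div_iff (hX i₀)]
    exact this
  have hGy : ∀ i, σ (algebraMap _ _ (bind₁ G (𝓕.coordPoly i))) = l * 𝓕.coord i := by
    intro i
    simp only [coord, coordPoly, linPoly, map_sum, map_mul, bind₁_C_right, bind₁_X_right, hGl,
      algebraMap_C, σ.commutes, Finset.mul_sum]
    exact Finset.sum_congr rfl fun j _ => by ring
  have hw := 𝓕.div_mem h (𝓕.isHomogeneous_bind₁_coordPoly hG 2)
    (𝓕.isHomogeneous_bind₁_coordPoly hG 1)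
  have h2 : σ' (algebraMap _ _ (bind₁ G (𝓕.coordPoly 2)) /
      algebraMap _ _ (bind₁ G (𝓕.coordPoly 1))) = 𝓕.coord 2 / 𝓕.coord 1 := by
    rw [map_div₀, hσ', hσ', hGy, hGy, mul_div_mul_left _ _ hl0]
  obtain ⟨A, μ, hμ, hA⟩ := exists_linear_of_conic 𝓕.a_ne_zero 𝓕.b_ne_zero
    (neg_ne_zero.mpr 𝓕.a_add_b_ne_zero) (𝓕.coord_ne_zero 1) (𝓕.conic_coord h)
    (𝓕.transcendental_coord h) σ' hσu hw h2
  refine ⟨𝓕.V.map (algebraMap k (RatFunc k)) * A * 𝓕.W.map (algebraMap k (RatFunc k)), μ, hμ, ?_⟩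
  intro i
  have hFi : algebraMap _ _ (F i) = σ (genericCoord k i) := by
    rw [genericCoord, hσ, bind₁_X_right]
  have hcoord : ∀ j, 𝓕.coord j = ∑ m, h.embedding (algebraMap k _ (𝓕.W j m)) *
      genericCoord k m := by
    intro j
    simp only [coord, coordPoly, linPoly, map_sum, map_mul, algebraMap_C, h.embedding.commutes]
  rw [hFi, 𝓕.genericCoord_eq, map_sum]
  have hA' : ∀ i, σ (𝓕.coord i) = μ * ∑ j, h.embedding (A i j) * 𝓕.coord j := hA
  simp only [map_mul, σ.commutes, hA']
  simp only [hcoord, CoprimeForms.act, Matrix.mul_apply, Matrix.map_apply, map_add, map_mul,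
    h.embedding.commutes, Fin.sum_univ_three]
  ring

end PencilFrame

end FrameLinear
end

noncomputable section

/-! ### Descent of the matrix to the ground field -/

section Descent

variable {k : Type*} [Field k] {κ : Type*} [Field κ] [Algebra k κ]

/-- The descent principle: a relation with scalars in `κ` among polynomials over `k` stays true
after a `k`-linear functional is applied to the scalars. -/
theorem sum_C_dual_mul_eq {σ ι : Type*} {s : Finset ι} {c d : ι → κ} {r u : ι → MvPolynomial σ k}
    (h : ∑ i ∈ s, C (c i) * map (algebraMap k κ) (r i) =
      ∑ i ∈ s, C (d i) * map (algebraMap k κ) (u i)) (l : Module.Dual k κ) :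
    ∑ i ∈ s, C (l (c i)) * r i = ∑ i ∈ s, C (l (d i)) * u i := by
  have key : ∀ (c : ι → κ) (r : ι → MvPolynomial σ k) m,
      l (coeff m (∑ i ∈ s, C (c i) * map (algebraMap k κ) (r i))) =
      coeff m (∑ i ∈ s, C (l (c i)) * r i) := by
    intro c r m
    rw [coeff_sum, coeff_sum, map_sum]
    refine Finset.sum_congr rfl fun i _ => ?_
    rw [coeff_C_mul, coeff_C_mul, coeff_map, mul_comm, ← Algebra.smul_def, map_smul, smul_eq_mul,
      mul_comm]
  ext m
  rw [← key, ← key, h]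

theorem bind₁_map_injective {F : Fin 3 → MvPolynomial (Fin 3) k}
    (hF : Function.Injective (bind₁ F)) :
    Function.Injective (bind₁ fun i => map (algebraMap k κ) (F i)) := by
  rw [injective_iff_map_eq_zero] at hF ⊢
  intro H hH
  have hsum : bind₁ (fun i => map (algebraMap k κ) (F i)) H =
      ∑ m ∈ H.support, C (coeff m H) * map (algebraMap k κ) (∏ i, F i ^ m i) := by
    change aeval _ H = _
    rw [aeval_def, eval₂_eq']
    simp only [map_prod, map_pow]
    rfl
  ext m
  rw [coeff_zero]
  by_contra hm
  obtain ⟨l, hl⟩ : ∃ l : Module.Dual k κ, l (coeff m H) ≠ 0 := by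
    by_contra! h0
    exact hm ((Module.forall_dual_apply_eq_zero_iff k _).mp h0)
  have h1 := sum_C_dual_mul_eq (s := H.support) (c := fun m => coeff m H) (d := fun _ => 0)
    (r := fun m => ∏ i, F i ^ m i) (u := fun _ => 0) (by rw [← hsum, hH]; simp) l
  have h2 : bind₁ F (∑ m ∈ H.support, monomial m (l (coeff m H))) = 0 := by
    rw [map_sum]
    refine Eq.trans (Finset.sum_congr rfl fun m _ => ?_) (h1.trans (by simp))
    rw [bind₁_monomial]
    congr 1
    exact Finset.prod_subset (Finset.subset_univ _) fun i _ hi => by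
      rw [Finsupp.notMem_support_iff.mp hi, pow_zero]
  have h3 := congrArg (coeff m) (hF _ h2)
  rw [coeff_sum, Finset.sum_eq_single m, coeff_monomial, if_pos rfl, coeff_zero] at h3
  · exact hl h3
  · intro m' _ hne
    rw [coeff_monomial, if_neg hne]
  · intro h0
    exact absurd (mem_support_iff.mpr hm) h0

/-- The form of degree `2 N` obtained by homogenizing `p` and substituting `-q₁`, `q₂`. -/
def homPoly (q₁ q₂ : MvPolynomial (Fin 3) k) (N : ℕ) (p : Polynomial k) : MvPolynomial (Fin 3) k :=
  ∑ n ∈ Finset.range (N + 1), C (p.coeff n) * ((-q₁) ^ n * q₂ ^ (N - n))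

theorem CoprimeForms.homPoly_isHomogeneous {q₁ q₂ : MvPolynomial (Fin 3) k}
    (h : CoprimeForms q₁ q₂) (N : ℕ) (p : Polynomial k) :
    (homPoly q₁ q₂ N p).IsHomogeneous (2 * N) := by
  refine IsHomogeneous.sum _ _ _ fun n hn => IsHomogeneous.C_mul ?_ _
  have := (h.homogeneous₁.neg.pow n).mul (h.homogeneous₂.pow (N - n))
  rwa [← mul_add, Nat.add_sub_cancel' (Nat.lt_succ_iff.mp (Finset.mem_range.mp hn))] at this

theorem CoprimeForms.algebraMap_homPoly {q₁ q₂ : MvPolynomial (Fin 3) k} (h : CoprimeForms q₁ q₂)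
    {N : ℕ} {p : Polynomial k} (hp : p.natDegree ≤ N) :
    algebraMap _ (FractionRing (MvPolynomial (Fin 3) k)) (homPoly q₁ q₂ N p) =
      algebraMap _ _ q₂ ^ N * h.embedding (algebraMap _ _ p) := by
  conv_rhs => rw [p.as_sum_range' (N + 1) (Nat.lt_succ_of_le hp)]
  rw [homPoly, map_sum, map_sum, map_sum, Finset.mul_sum]
  refine Finset.sum_congr rfl fun n hn => ?_
  have hn : n ≤ N := Nat.lt_succ_iff.mp (Finset.mem_range.mp hn)
  rw [RatFunc.algebraMap_monomial, map_mul h.embedding, map_pow h.embedding,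
    ← RatFunc.algebraMap_eq_C, h.embedding.commutes, map_mul, map_mul, map_pow, map_pow, map_neg,
    ← h.embedding_X_mul, PencilFrame.algebraMap_C, mul_pow]
  rw [show algebraMap _ (FractionRing (MvPolynomial (Fin 3) k)) q₂ ^ N =
    algebraMap _ _ q₂ ^ n * algebraMap _ _ q₂ ^ (N - n) by
      rw [← pow_add, Nat.add_sub_cancel' hn]]
  ring

theorem map_homPoly_mul_eq (q₁ q₂ A B : MvPolynomial (Fin 3) k) (N : ℕ) (p : Polynomial κ) :
    map (algebraMap k κ) A * (homPoly (map (algebraMap k κ) q₁) (map (algebraMap k κ) q₂) N p *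
      map (algebraMap k κ) B) = ∑ n ∈ Finset.range (N + 1),
        C (p.coeff n) * map (algebraMap k κ) (A * ((-q₁) ^ n * q₂ ^ (N - n) * B)) := by
  rw [homPoly, Finset.sum_mul, Finset.mul_sum]
  refine Finset.sum_congr rfl fun n _ => ?_
  simp only [map_mul, map_pow, map_neg]
  ring

theorem homPoly_mul_eq (q₁ q₂ A B : MvPolynomial (Fin 3) k) (N : ℕ) (p : Polynomial k) :
    A * (homPoly q₁ q₂ N p * B) = ∑ n ∈ Finset.range (N + 1),
        C (p.coeff n) * (A * ((-q₁) ^ n * q₂ ^ (N - n) * B)) := by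
  rw [homPoly, Finset.sum_mul, Finset.mul_sum]
  refine Finset.sum_congr rfl fun n _ => ?_
  ring

theorem exists_common_denominator {ι : Type*} [Finite ι] (f : ι → RatFunc k) :
    ∃ (d : Polynomial k) (p : ι → Polynomial k) (N : ℕ), d ≠ 0 ∧ d.natDegree ≤ N ∧
      (∀ i, (p i).natDegree ≤ N) ∧ ∀ i, algebraMap _ _ (p i) = algebraMap _ _ d * f i := by
  cases nonempty_fintype ι
  obtain ⟨d, hd⟩ := IsLocalization.exist_integer_multiples_of_finite
    (nonZeroDivisors (Polynomial k)) f
  choose p hp using hd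
  refine ⟨d, p, (d : Polynomial k).natDegree + ∑ i, (p i).natDegree,
    nonZeroDivisors.coe_ne_zero d, Nat.le_add_right _ _, fun i => ?_, fun i => ?_⟩
  · exact (Finset.single_le_sum (f := fun i => (p i).natDegree) (fun _ _ => Nat.zero_le _)
      (Finset.mem_univ i)).trans (Nat.le_add_left _ _)
  · rw [hp i, Algebra.smul_def]

/-- If a map defined over `k` is linear over `κ(t)`, then it is linear over `k(t)`. -/
theorem CoprimeForms.exists_matrix_of_map {q₁ q₂ : MvPolynomial (Fin 3) k}
    (h : CoprimeForms q₁ q₂)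
    (h' : CoprimeForms (map (algebraMap k κ) q₁) (map (algebraMap k κ) q₂))
    {F : Fin 3 → MvPolynomial (Fin 3) k} {M' : Matrix (Fin 3) (Fin 3) (RatFunc κ)} (hM' : M' ≠ 0)
    (hF : ∀ i j, algebraMap _ (FractionRing (MvPolynomial (Fin 3) κ)) (map (algebraMap k κ) (F i)) *
      h'.act M' j = algebraMap _ _ (map (algebraMap k κ) (F j)) * h'.act M' i) :
    ∃ M : Matrix (Fin 3) (Fin 3) (RatFunc k), M ≠ 0 ∧
      ∀ i j, algebraMap _ _ (F i) * h.act M j = algebraMap _ _ (F j) * h.act M i := by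
  obtain ⟨d, p, N, hd, -, hpN, hp⟩ :=
    exists_common_denominator (fun x : Fin 3 × Fin 3 => M' x.1 x.2)
  have hp0 : ∃ i j n, n ≤ N ∧ (p (i, j)).coeff n ≠ 0 := by
    by_contra! h0
    apply hM'
    ext i j
    have hz : p (i, j) = 0 := by
      ext n
      by_cases hn : n ≤ N
      · rw [h0 i j n hn, Polynomial.coeff_zero]
      · rw [Polynomial.coeff_eq_zero_of_natDegree_lt ((hpN _).trans_lt (not_le.mp hn)),
          Polynomial.coeff_zero]
    have := hp (i, j)
    rw [hz, map_zero] at this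
    exact (mul_eq_zero.mp this.symm).resolve_left (RatFunc.algebraMap_ne_zero hd)
  obtain ⟨i₀, j₀, n₀, hn₀, hne⟩ := hp0
  -- After clearing denominators and homogenizing in `-q₁, q₂`, the proportionality of `F` and `M'
  -- x` is linear in the coefficients of `M'`. A functional that does not kill one of them yields a
  -- nonzero solution over `k`.
  obtain ⟨l, hl⟩ : ∃ l : Module.Dual k κ, l ((p (i₀, j₀)).coeff n₀) ≠ 0 := by
    by_contra! h0
    exact hne ((Module.forall_dual_apply_eq_zero_iff k _).mp h0)
  have hact : ∀ i, algebraMap _ (FractionRing (MvPolynomial (Fin 3) κ))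
      (∑ m, homPoly (map (algebraMap k κ) q₁) (map (algebraMap k κ) q₂) N (p (i, m)) * X m) =
      algebraMap _ _ (map (algebraMap k κ) q₂) ^ N * h'.embedding (algebraMap _ _ d) *
        h'.act M' i := by
    intro i
    rw [map_sum, CoprimeForms.act, Finset.mul_sum]
    refine Finset.sum_congr rfl fun m _ => ?_
    rw [map_mul, h'.algebraMap_homPoly (hpN _), hp, map_mul]
    ring
  have hpoly : ∀ i j, map (algebraMap k κ) (F i) * (∑ m, homPoly (map (algebraMap k κ) q₁)
        (map (algebraMap k κ) q₂) N (p (j, m)) * X m) =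
      map (algebraMap k κ) (F j) * (∑ m, homPoly (map (algebraMap k κ) q₁)
        (map (algebraMap k κ) q₂) N (p (i, m)) * X m) := by
    intro i j
    apply IsFractionRing.injective (MvPolynomial (Fin 3) κ)
      (FractionRing (MvPolynomial (Fin 3) κ))
    rw [map_mul, map_mul, hact, hact]
    linear_combination algebraMap _ _ (map (algebraMap k κ) q₂) ^ N *
      h'.embedding (algebraMap _ _ d) * hF i j
  let p' : Fin 3 × Fin 3 → Polynomial k := fun x =>
    ∑ n ∈ Finset.range (N + 1), Polynomial.monomial n (l ((p x).coeff n))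
  have hp'c : ∀ x n, n ≤ N → (p' x).coeff n = l ((p x).coeff n) := by
    intro x n hn
    simp only [p', Polynomial.finsetSum_coeff, Polynomial.coeff_monomial]
    rw [Finset.sum_ite_eq' (Finset.range (N + 1)) n, if_pos (Finset.mem_range.mpr (by omega))]
  have hp'N : ∀ x, (p' x).natDegree ≤ N := by
    intro x
    refine Polynomial.natDegree_sum_le_of_forall_le _ _ fun n hn => ?_
    exact (Polynomial.natDegree_monomial_le _).trans (Nat.lt_succ_iff.mp (Finset.mem_range.mp hn))
  have hX : ∀ m : Fin 3, (X m : MvPolynomial (Fin 3) κ) = map (algebraMap k κ) (X m) := fun m =>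
    (map_X _ m).symm
  have hpoly' : ∀ i j, F i * (∑ m, homPoly q₁ q₂ N (p' (j, m)) * X m) =
      F j * (∑ m, homPoly q₁ q₂ N (p' (i, m)) * X m) := by
    intro i j
    have h1 := hpoly i j
    simp only [hX, Finset.mul_sum, map_homPoly_mul_eq] at h1
    rw [← Finset.sum_product', ← Finset.sum_product'] at h1
    have h2 := sum_C_dual_mul_eq h1 l
    simp only [Finset.mul_sum, homPoly_mul_eq]
    rw [← Finset.sum_product', ← Finset.sum_product']
    refine Eq.trans (Finset.sum_congr rfl fun x hx => ?_) (h2.trans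
      (Finset.sum_congr rfl fun x hx => ?_))
    all_goals
      rw [hp'c]
      exact Nat.lt_succ_iff.mp (Finset.mem_range.mp (Finset.mem_product.mp hx).2)
  refine ⟨fun i j => algebraMap _ _ (p' (i, j)), fun h0 => hl ?_, fun i j => ?_⟩
  · rw [← hp'c _ _ hn₀]
    have h1 := congrFun (congrFun h0 i₀) j₀
    have h2 : p' (i₀, j₀) = 0 := RatFunc.algebraMap_injective k (h1.trans (map_zero _).symm)
    rw [h2, Polynomial.coeff_zero]
  · have hact' : ∀ i, algebraMap _ (FractionRing (MvPolynomial (Fin 3) k))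
        (∑ m, homPoly q₁ q₂ N (p' (i, m)) * X m) =
        algebraMap _ _ q₂ ^ N * h.act (fun i j => algebraMap _ _ (p' (i, j))) i := by
      intro i
      rw [map_sum]
      refine Eq.trans ?_ (Finset.mul_sum _ _ _).symm
      refine Finset.sum_congr rfl fun m _ => ?_
      rw [map_mul, h.algebraMap_homPoly (hp'N _)]
      ring
    have h1 := congrArg (algebraMap _ (FractionRing (MvPolynomial (Fin 3) k))) (hpoly' i j)
    rw [map_mul, map_mul, hact', hact'] at h1
    apply mul_left_cancel₀ (pow_ne_zero N h.algebraMap_ne_zero₂)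
    linear_combination h1

end Descent

/-! ### The frame defined by the base points -/

section Frame

variable {k : Type*} [Field k]

theorem GeneralBase.nonempty_pencilFrame {P : ConicPencil k} {T : Finset (GeomPoint k)}
    (h : GeneralBase P T) : Nonempty (PencilFrame (map (algebraMap k (AlgebraicClosure k)) P.q₁)
      (map (algebraMap k (AlgebraicClosure k)) P.q₂)) := by
  obtain ⟨v, hli, -, -, a₁, b₁, a₂, b₂, hδ, hf⟩ := h.exists_frame
  set V : Matrix (Fin 3) (Fin 3) (AlgebraicClosure k) := Matrix.of fun i j => v j i with hV
  have hu : IsUnit V := by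
    rw [← Matrix.linearIndependent_cols_iff_isUnit]
    exact hli
  have hVy : ∀ y, V.mulVec y = ∑ i, y i • v i := by
    intro y
    ext i
    simp [hV, Matrix.mulVec, dotProduct, Fin.sum_univ_three, mul_comm]
  refine ⟨⟨V, V⁻¹, Matrix.mul_nonsing_inv V ((Matrix.isUnit_iff_isUnit_det V).mp hu), a₁, b₁, a₂,
    b₂, hδ, ?_, ?_⟩⟩
  · apply MvPolynomial.funext
    intro y
    rw [eval_bind₁_linPoly, hVy]
    refine (hf y).1.trans ?_
    simp
  · apply MvPolynomial.funext
    intro y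
    rw [eval_bind₁_linPoly, hVy]
    refine (hf y).2.trans ?_
    simp

end Frame
end

noncomputable section

/-! ### Rational maps represented by matrices over `k(t)` -/

section LinearAction

variable {k : Type*} [Field k] {q₁ q₂ : MvPolynomial (Fin 3) k}

/-- On the generic fibre of the fibration `[q₁ : q₂]`, the rational map `[F₀ : F₁ : F₂]` is given by
the matrix `M`. -/
def CoprimeForms.Represents (h : CoprimeForms q₁ q₂) (F : RatRep k 2 2)
    (M : Matrix (Fin 3) (Fin 3) (RatFunc k)) : Prop :=
  ∀ i j, algebraMap _ _ (F.coord i) * h.act M j = algebraMap _ _ (F.coord j) * h.act M i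

theorem coord_algebraMap_ne_zero {G : MvPolynomial (Fin 3) k} (hG : G ≠ 0) :
    algebraMap _ (FractionRing (MvPolynomial (Fin 3) k)) G ≠ 0 :=
  (map_ne_zero_iff _ (IsFractionRing.injective _ _)).mpr hG

theorem CoprimeForms.Represents.of_equiv {h : CoprimeForms q₁ q₂} {F F' : RatRep k 2 2}
    {M : Matrix (Fin 3) (Fin 3) (RatFunc k)} (hF : h.Represents F M) (hE : F.Equiv F') :
    h.Represents F' M := by
  obtain ⟨l, hl⟩ := F.exists_ne_zero
  have hE' : ∀ i, algebraMap _ (FractionRing (MvPolynomial (Fin 3) k)) (F.coord l) *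
      algebraMap _ _ (F'.coord i) = algebraMap _ _ (F.coord i) * algebraMap _ _ (F'.coord l) := by
    intro i
    rw [← map_mul, ← map_mul, hE l i]
  intro i j
  apply mul_left_cancel₀ (coord_algebraMap_ne_zero hl)
  linear_combination h.act M j * hE' i - h.act M i * hE' j + algebraMap _ _ (F'.coord l) * hF i j

theorem CoprimeForms.Represents.equiv {h : CoprimeForms q₁ q₂} {F F' : RatRep k 2 2}
    {M : Matrix (Fin 3) (Fin 3) (RatFunc k)} (hM : M ≠ 0) (hF : h.Represents F M)
    (hF' : h.Represents F' M) : F.Equiv F' := by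
  obtain ⟨l, hl⟩ := h.act_ne_zero hM
  intro i j
  apply IsFractionRing.injective (MvPolynomial (Fin 3) k) (FractionRing (MvPolynomial (Fin 3) k))
  rw [map_mul, map_mul]
  apply mul_left_cancel₀ hl
  linear_combination algebraMap _ _ (F'.coord j) * hF i l - algebraMap _ _ (F'.coord i) * hF j l +
    algebraMap _ _ (F.coord l) * hF' j i

theorem CoprimeForms.act_smul (h : CoprimeForms q₁ q₂) (d : RatFunc k)
    (M : Matrix (Fin 3) (Fin 3) (RatFunc k)) (i : Fin 3) :
    h.act (d • M) i = h.embedding d * h.act M i := by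
  simp only [CoprimeForms.act, Matrix.smul_apply, smul_eq_mul, map_mul, Finset.mul_sum, mul_assoc]

theorem CoprimeForms.act_one (h : CoprimeForms q₁ q₂) (i : Fin 3) :
    h.act 1 i = genericCoord k i := by
  simp [CoprimeForms.act, Matrix.one_apply, apply_ite h.embedding]

theorem CoprimeForms.act_mul (h : CoprimeForms q₁ q₂) (M N : Matrix (Fin 3) (Fin 3) (RatFunc k))
    (i : Fin 3) : h.act (M * N) i = ∑ j, h.embedding (M i j) * h.act N j := by
  simp only [CoprimeForms.act, Matrix.mul_apply, map_sum, map_mul, Finset.mul_sum, Finset.sum_mul]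
  rw [Finset.sum_comm]
  simp only [mul_assoc]

theorem CoprimeForms.Represents.smul {h : CoprimeForms q₁ q₂} {F : RatRep k 2 2}
    {M : Matrix (Fin 3) (Fin 3) (RatFunc k)} (hF : h.Represents F M) (d : RatFunc k) :
    h.Represents F (d • M) := by
  intro i j
  rw [h.act_smul, h.act_smul]
  linear_combination h.embedding d * hF i j

theorem CoprimeForms.represents_id (h : CoprimeForms q₁ q₂) :
    h.Represents (DomRatRep.id k 2).toRatRep 1 := by
  intro i j
  rw [h.act_one, h.act_one]
  exact mul_comm _ _

/-- Pull back the relation for `F` along `G`. Since `G` preserves the fibration, the pull-back fixes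
the entries of `M` and replaces the generic point by a multiple of `N x`. -/
theorem CoprimeForms.Represents.comp {h : CoprimeForms q₁ q₂} {F : RatRep k 2 2}
    {G : DomRatRep k 2 2} {M N : Matrix (Fin 3) (Fin 3) (RatFunc k)} (hF : h.Represents F M)
    (hG : h.Represents G.toRatRep N) (hN : N ≠ 0)
    (hq : bind₁ G.coord q₁ * q₂ = bind₁ G.coord q₂ * q₁) :
    h.Represents (F.comp G) (M * N) := by
  obtain ⟨σ, hσ, hσι⟩ := h.exists_endomorphism
    (bind₁_injective_of_dominant G.homogeneous G.dominant) hq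
  obtain ⟨l, hl⟩ := h.act_ne_zero hN
  have hGl : algebraMap _ (FractionRing (MvPolynomial (Fin 3) k)) (G.coord l) ≠ 0 := by
    intro h0
    obtain ⟨m, hm⟩ := G.exists_ne_zero
    have := hG m l
    rw [h0, zero_mul] at this
    exact (mul_ne_zero (coord_algebraMap_ne_zero hm) hl) this
  have hact : ∀ i, σ (h.act M i) * h.act N l = algebraMap _ _ (G.coord l) * h.act (M * N) i := by
    intro i
    rw [h.act_mul, CoprimeForms.act, map_sum, Finset.sum_mul, Finset.mul_sum]
    refine Finset.sum_congr rfl fun j _ => ?_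
    rw [map_mul, hσι, hσ, bind₁_X_right]
    linear_combination h.embedding (M i j) * hG j l
  intro i j
  have h1 := congrArg σ (hF i j)
  rw [map_mul, map_mul, hσ, hσ] at h1
  change algebraMap _ _ (bind₁ G.coord (F.coord i)) * _ =
    algebraMap _ _ (bind₁ G.coord (F.coord j)) * _
  apply mul_left_cancel₀ hGl
  linear_combination h.act N l * h1 - algebraMap _ _ (bind₁ G.coord (F.coord i)) * hact j +
    algebraMap _ _ (bind₁ G.coord (F.coord j)) * hact i

theorem CoprimeForms.eval₂_pencilPoly_smul (h : CoprimeForms q₁ q₂)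
    (c : FractionRing (MvPolynomial (Fin 3) k))
    (y : Fin 3 → FractionRing (MvPolynomial (Fin 3) k)) :
    eval₂ (h.embedding : RatFunc k →+* _) (fun i => c * y i) (pencilPoly q₁ q₂) =
      c ^ 2 * eval₂ (h.embedding : RatFunc k →+* _) y (pencilPoly q₁ q₂) := by
  rw [h.eval₂_pencilPoly, h.eval₂_pencilPoly, aeval_mul_of_isHomogeneous h.homogeneous₁,
    aeval_mul_of_isHomogeneous h.homogeneous₂]
  ring

/-- A representable map preserves the fibration iff its matrix preserves the conic over `k(t)`. -/
theorem CoprimeForms.Represents.preserves_iff {h : CoprimeForms q₁ q₂} {F : RatRep k 2 2}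
    {M : Matrix (Fin 3) (Fin 3) (RatFunc k)} (hM : M ≠ 0) (hF : h.Represents F M) :
    bind₁ F.coord q₁ * q₂ = bind₁ F.coord q₂ * q₁ ↔
      eval₂ (h.embedding : RatFunc k →+* _) (h.act M) (pencilPoly q₁ q₂) = 0 := by
  obtain ⟨l, hl⟩ := h.act_ne_zero hM
  have hFl : algebraMap _ (FractionRing (MvPolynomial (Fin 3) k)) (F.coord l) ≠ 0 := by
    intro h0
    obtain ⟨m, hm⟩ := F.exists_ne_zero
    have := hF m l
    rw [h0, zero_mul] at this
    exact (mul_ne_zero (coord_algebraMap_ne_zero hm) hl) this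
  have h1 := h.eval₂_pencilPoly_smul (h.act M l) fun i => algebraMap _ _ (F.coord i)
  have h2 := h.eval₂_pencilPoly_smul (algebraMap _ _ (F.coord l)) (h.act M)
  have h3 : (fun i => h.act M l * algebraMap _ _ (F.coord i)) =
      fun i => algebraMap _ _ (F.coord l) * h.act M i := by
    ext i
    rw [mul_comm, hF]
  rw [h3] at h1
  have h4 : eval₂ (h.embedding : RatFunc k →+* _) (h.act M) (pencilPoly q₁ q₂) = 0 ↔
      eval₂ (h.embedding : RatFunc k →+* FractionRing (MvPolynomial (Fin 3) k))
        (fun i => algebraMap _ _ (F.coord i)) (pencilPoly q₁ q₂) = 0 := by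
    rw [← mul_eq_zero_iff_left (pow_ne_zero 2 hFl), ← h2, h1,
      mul_eq_zero_iff_left (pow_ne_zero 2 hl)]
  have h5 : ∀ G : MvPolynomial (Fin 3) k, aeval (fun i => algebraMap _
      (FractionRing (MvPolynomial (Fin 3) k)) (F.coord i)) G =
      algebraMap _ _ (bind₁ F.coord G) := fun G =>
    aeval_algebraMap_apply (FractionRing (MvPolynomial (Fin 3) k)) F.coord G
  rw [h4, h.eval₂_pencilPoly, h5, h5, ← mul_eq_zero_iff_right h.algebraMap_ne_zero₂, add_mul,
    mul_right_comm, h.embedding_X_mul, ← (IsFractionRing.injective (MvPolynomial (Fin 3) k)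
      (FractionRing (MvPolynomial (Fin 3) k))).eq_iff, map_mul, map_mul, neg_mul,
    ← sub_eq_add_neg, sub_eq_zero, mul_comm (algebraMap _ _ q₁)]

/-- Every similitude of the conic over `k(t)` comes from a dominant rational map. -/
theorem CoprimeForms.exists_domRatRep (h : CoprimeForms q₁ q₂)
    {M N : Matrix (Fin 3) (Fin 3) (RatFunc k)} (hMN : M * N = 1) {c : RatFunc k}
    (hN : bind₁ (linPoly N) (pencilPoly q₁ q₂) = C c * pencilPoly q₁ q₂) :
    ∃ F : DomRatRep k 2 2, h.Represents F.toRatRep M := by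
  have hM : M ≠ 0 := by
    rintro rfl
    simp at hMN
  obtain ⟨d, p, n, hd, hdn, hpn, hp⟩ :=
    exists_common_denominator (fun x : Fin 3 × Fin 3 => M x.1 x.2)
  -- Clear the denominators of `M` in `t`, then substitute `t = -q₁/q₂` and multiply by `q₂ ^ n`:
  -- forms of degree `2 * n + 1` proportional to `M x`.
  set F : Fin 3 → MvPolynomial (Fin 3) k := fun i => ∑ l, homPoly q₁ q₂ n (p (i, l)) * X l with hF
  set μ : FractionRing (MvPolynomial (Fin 3) k) :=
    algebraMap _ _ q₂ ^ n * h.embedding (algebraMap _ _ d) with hμ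
  have hμ0 : μ ≠ 0 := mul_ne_zero (pow_ne_zero _ h.algebraMap_ne_zero₂)
    ((map_ne_zero_iff _ h.embedding.injective).mpr (RatFunc.algebraMap_ne_zero hd))
  have hFM : ∀ i, algebraMap _ _ (F i) = μ * h.act M i := by
    intro i
    rw [hF, map_sum, CoprimeForms.act, Finset.mul_sum]
    refine Finset.sum_congr rfl fun l _ => ?_
    rw [map_mul, h.algebraMap_homPoly (hpn _), hp, map_mul, hμ]
    ring
  have hhom : ∀ i, (F i).IsHomogeneous (2 * n + 1) := fun i =>
    IsHomogeneous.sum _ _ _ fun l _ => (h.homPoly_isHomogeneous n _).mul (isHomogeneous_X k l)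
  refine ⟨⟨⟨F, 2 * n + 1, hhom, ?_⟩, fun e H hH hH0 h0 => hH0 ?_⟩, fun i j => ?_⟩
  · obtain ⟨l, hl⟩ := h.act_ne_zero hM
    refine ⟨l, fun h0 => mul_ne_zero hμ0 hl ?_⟩
    rw [← hFM, h0, map_zero]
  · refine h.eq_zero_of_aeval_act_eq_zero hMN hN ?_
    have h1 := aeval_mul_of_isHomogeneous hH μ (h.act M)
    have h2 := aeval_algebraMap_apply (FractionRing (MvPolynomial (Fin 3) k)) F H
    change _ = algebraMap _ _ (bind₁ F H) at h2
    rw [h0, map_zero] at h2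
    rw [← funext hFM] at h1
    exact (mul_eq_zero.mp (h1.symm.trans h2)).resolve_left (pow_ne_zero _ hμ0)
  · change algebraMap _ _ (F i) * _ = algebraMap _ _ (F j) * _
    rw [hFM, hFM]
    ring

/-- Two matrices representing the same map are pointwise proportional. -/
theorem CoprimeForms.Represents.exists_minors {h : CoprimeForms q₁ q₂} {F : RatRep k 2 2}
    {M N : Matrix (Fin 3) (Fin 3) (RatFunc k)} (hM : h.Represents F M) (hN : h.Represents F N)
    (i j : Fin 3) : ∃ c : RatFunc k, ∀ v : Fin 3 → RatFunc k,
      M.mulVec v i * N.mulVec v j - M.mulVec v j * N.mulVec v i =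
        c * eval v (pencilPoly q₁ q₂) := by
  obtain ⟨l, hl⟩ := F.exists_ne_zero
  have hl := coord_algebraMap_ne_zero hl
  have hlin : ∀ (M : Matrix (Fin 3) (Fin 3) (RatFunc k)) i,
      eval₂ (h.embedding : RatFunc k →+* _) (genericCoord k) (linPoly M i) = h.act M i := by
    intro M i
    have := h.eval₂_bind₁_linPoly M (X i)
    rwa [bind₁_X_right, eval₂_X] at this
  have hev : ∀ (M : Matrix (Fin 3) (Fin 3) (RatFunc k)) v i,
      eval v (linPoly M i) = M.mulVec v i := by
    intro M v i
    have := eval_bind₁_linPoly M (X i) v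
    rwa [bind₁_X_right, eval_X] at this
  obtain ⟨c, hc⟩ := h.eq_C_mul_of_eval₂_eq_zero
    (Q := linPoly M i * linPoly N j - linPoly M j * linPoly N i)
    (((linPoly_isHomogeneous M i).mul (linPoly_isHomogeneous N j)).sub
      ((linPoly_isHomogeneous M j).mul (linPoly_isHomogeneous N i))) (by
      rw [eval₂_sub, eval₂_mul, eval₂_mul, hlin, hlin, hlin, hlin]
      apply mul_left_cancel₀ hl
      apply mul_left_cancel₀ hl
      linear_combination algebraMap _ _ (F.coord l) * h.act N j * hM l i -
        algebraMap _ _ (F.coord l) * h.act N i * hM l j +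
        algebraMap _ _ (F.coord i) * h.act M l * hN l j -
        algebraMap _ _ (F.coord j) * h.act M l * hN l i)
  refine ⟨c, fun v => ?_⟩
  have := congrArg (eval v) hc
  rwa [map_sub, map_mul, map_mul, map_mul, eval_C, hev, hev, hev, hev] at this

end LinearAction

/-! ### Uniqueness of the representing isometry -/

section Uniqueness

variable {K : Type*} [Field K]

/-- At the basis vector complementary to `i, j` the minor vanishes while `q` does not, so `c = 0`.
Hence `g` maps every vector to a multiple of itself and is a scalar `a`, with `a³ = 1` from the
determinant and `a² = 1` from `q`. -/
theorem eq_one_of_minors {q : QuadraticForm K (Fin 3 → K)} (hq : q.Anisotropic)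
    {g : (Fin 3 → K) ≃ₗ[K] (Fin 3 → K)} (hg : g ∈ specialOrthogonalGroupQuad q)
    (h : ∀ i j, ∃ c, ∀ w, g w i * w j - g w j * w i = c * q w) : g = 1 := by
  have hthird : ∀ i j : Fin 3, ∃ l, l ≠ i ∧ l ≠ j := by decide
  have hpar : ∀ w i j, g w i * w j = g w j * w i := by
    intro w i j
    by_cases hij : i = j
    · rw [hij]
    obtain ⟨c, hc⟩ := h i j
    obtain ⟨l, hli, hlj⟩ := hthird i j
    have h1 := hc (Pi.single l 1)
    rw [Pi.single_eq_of_ne hli.symm, Pi.single_eq_of_ne hlj.symm, mul_zero, mul_zero, sub_zero,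
      eq_comm, mul_eq_zero] at h1
    have hc0 : c = 0 := h1.resolve_right fun h0 => by
      simpa using congrFun (hq _ h0) l
    have := hc w
    rwa [hc0, zero_mul, sub_eq_zero] at this
  have hdiag : ∀ i l, i ≠ l → g (Pi.single l 1) i = 0 := by
    intro i l hil
    have := hpar (Pi.single l 1) i l
    rwa [Pi.single_eq_same, Pi.single_eq_of_ne hil, mul_one, mul_zero] at this
  have hsame : ∀ i j, g (Pi.single i 1) i = g (Pi.single j 1) j := by
    intro i j
    by_cases hij : i = j
    · rw [hij]
    have := hpar (Pi.single i 1 + Pi.single j 1) i j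
    simpa [hdiag i j hij, hdiag j i (Ne.symm hij), Pi.single_eq_of_ne hij,
      Pi.single_eq_of_ne (Ne.symm hij)] using this
  set a := g (Pi.single 0 1) 0 with ha
  have hga : (g : (Fin 3 → K) →ₗ[K] (Fin 3 → K)) = a • LinearMap.id := by
    refine LinearMap.pi_ext' fun i => LinearMap.ext_ring ?_
    ext j
    by_cases hij : j = i
    · subst hij
      simpa using hsame j 0
    · simpa [hij] using hdiag j i hij
  have hgv : ∀ v, g v = a • v := fun v => LinearMap.congr_fun hga v
  have h3 : a ^ 3 = 1 := by
    have h1 : LinearEquiv.det g = 1 := hg.2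
    have h2 := congrArg Units.val h1
    rw [LinearEquiv.coe_det, hga, LinearMap.det_smul, LinearMap.det_id] at h2
    simpa using h2
  have h2 : a * a = 1 := by
    have h1 := hg.1 (Pi.single 0 1)
    rw [hgv, q.map_smul, smul_eq_mul] at h1
    refine mul_right_cancel₀ (b := q (Pi.single 0 1)) (fun h0 => ?_) (h1.trans (one_mul _).symm)
    simpa using congrFun (hq _ h0) 0
  have h1 : a = 1 := by linear_combination h3 - a * h2
  ext1 v
  rw [hgv, h1, one_smul]
  rfl

end Uniqueness
end

noncomputable section

/-! ### The isomorphism and the conclusion -/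

section GroupIso

variable {k : Type*} [Field k] {P : ConicPencil k} {T : Finset (GeomPoint k)}

/-- The matrix of a linear automorphism. -/
abbrev matrixOf {K : Type*} [Field K] (g : (Fin 3 → K) ≃ₗ[K] (Fin 3 → K)) :
    Matrix (Fin 3) (Fin 3) K :=
  LinearMap.toMatrix' (g : (Fin 3 → K) →ₗ[K] (Fin 3 → K))

theorem matrixOf_one {K : Type*} [Field K] :
    matrixOf (1 : (Fin 3 → K) ≃ₗ[K] (Fin 3 → K)) = 1 :=
  LinearMap.toMatrix'_id

theorem matrixOf_mul {K : Type*} [Field K] (f g : (Fin 3 → K) ≃ₗ[K] (Fin 3 → K)) :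
    matrixOf (f * g) = matrixOf f * matrixOf g :=
  LinearMap.toMatrix'_comp (f : (Fin 3 → K) →ₗ[K] (Fin 3 → K)) (g : (Fin 3 → K) →ₗ[K] (Fin 3 → K))

theorem matrixOf_ne_zero {K : Type*} [Field K] (g : (Fin 3 → K) ≃ₗ[K] (Fin 3 → K)) :
    matrixOf g ≠ 0 := by
  intro h0
  have := matrixOf_mul g g⁻¹
  rw [mul_inv_cancel, matrixOf_one, h0, zero_mul] at this
  exact one_ne_zero this

theorem matrixOf_mulVec {K : Type*} [Field K] (g : (Fin 3 → K) ≃ₗ[K] (Fin 3 → K)) (v : Fin 3 → K) :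
    (matrixOf g).mulVec v = g v :=
  LinearMap.toMatrix'_mulVec _ v

theorem ConicPencil.bind₁_matrixOf (P : ConicPencil k)
    {g : (Fin 3 → RatFunc k) ≃ₗ[RatFunc k] (Fin 3 → RatFunc k)}
    (hg : g ∈ specialOrthogonalGroupQuad P.quadForm) :
    bind₁ (linPoly (matrixOf g)) (pencilPoly P.q₁ P.q₂) = C 1 * pencilPoly P.q₁ P.q₂ := by
  apply MvPolynomial.funext
  intro v
  rw [eval_bind₁_linPoly, matrixOf_mulVec, map_mul, eval_C, one_mul]
  exact hg.1 v

theorem DomRatMap.mk_comp_eq_iff {F : DomRatRep k 2 2} :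
    P.fibration.comp (Quotient.mk _ F : DomRatMap k 2 2) = P.fibration ↔
      bind₁ F.coord P.q₁ * P.q₂ = bind₁ F.coord P.q₂ * P.q₁ := by
  refine Quotient.eq.trans ⟨fun h => h 0 1, fun h => ?_⟩
  change ∀ i j : Fin 2, bind₁ F.coord (![P.q₁, P.q₂] i) * ![P.q₁, P.q₂] j =
    bind₁ F.coord (![P.q₁, P.q₂] j) * ![P.q₁, P.q₂] i
  rw [Fin.forall_fin_two]
  simp only [Fin.forall_fin_two, Matrix.cons_val_zero, Matrix.cons_val_one]
  exact ⟨⟨trivial, h⟩, h.symm, trivial⟩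

/-- The rational self-map `f` of the plane is given on the generic fibre by `g`. -/
def GeneralBase.Corresponds (hB : GeneralBase P T) (f : DomRatMap k 2 2)
    (g : (Fin 3 → RatFunc k) ≃ₗ[RatFunc k] (Fin 3 → RatFunc k)) : Prop :=
  ∃ F : DomRatRep k 2 2, f = Quotient.mk _ F ∧
    hB.coprimeForms.Represents F.toRatRep (matrixOf g)

theorem GeneralBase.Corresponds.preserves {hB : GeneralBase P T} {f : DomRatMap k 2 2}
    {g : (Fin 3 → RatFunc k) ≃ₗ[RatFunc k] (Fin 3 → RatFunc k)}
    (h : hB.Corresponds f g) (hg : g ∈ specialOrthogonalGroupQuad P.quadForm) :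
    P.fibration.comp f = P.fibration := by
  obtain ⟨F, rfl, hF⟩ := h
  rw [DomRatMap.mk_comp_eq_iff, hF.preserves_iff (matrixOf_ne_zero g)]
  exact hB.coprimeForms.eval₂_act_pencilPoly (P.bind₁_matrixOf hg)

theorem GeneralBase.Corresponds.mul {hB : GeneralBase P T} {f f' : DomRatMap k 2 2}
    {g g' : (Fin 3 → RatFunc k) ≃ₗ[RatFunc k] (Fin 3 → RatFunc k)}
    (h : hB.Corresponds f g) (h' : hB.Corresponds f' g')
    (hf' : P.fibration.comp f' = P.fibration) : hB.Corresponds (f * f') (g * g') := by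
  obtain ⟨F, rfl, hF⟩ := h
  obtain ⟨F', rfl, hF'⟩ := h'
  refine ⟨F.comp F', rfl, ?_⟩
  rw [matrixOf_mul]
  exact hF.comp hF' (matrixOf_ne_zero g') (DomRatMap.mk_comp_eq_iff.mp hf')

theorem GeneralBase.Corresponds.left_unique {hB : GeneralBase P T} {f f' : DomRatMap k 2 2}
    {g : (Fin 3 → RatFunc k) ≃ₗ[RatFunc k] (Fin 3 → RatFunc k)}
    (h : hB.Corresponds f g) (h' : hB.Corresponds f' g) : f = f' := by
  obtain ⟨F, rfl, hF⟩ := h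
  obtain ⟨F', rfl, hF'⟩ := h'
  exact Quotient.sound (hF.equiv (matrixOf_ne_zero g) hF')

/-- The minors formed from `g v` and `g' v` are multiples of `q v`. Putting `v = g'⁻¹ w` makes them
the minors of `g g'⁻¹ w` and `w`, to which `eq_one_of_minors` applies. -/
theorem GeneralBase.Corresponds.right_unique {hB : GeneralBase P T} {f : DomRatMap k 2 2}
    {g g' : (Fin 3 → RatFunc k) ≃ₗ[RatFunc k] (Fin 3 → RatFunc k)}
    (h : hB.Corresponds f g) (h' : hB.Corresponds f g')
    (hg : g ∈ specialOrthogonalGroupQuad P.quadForm)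
    (hg' : g' ∈ specialOrthogonalGroupQuad P.quadForm) : g = g' := by
  obtain ⟨F, rfl, hF⟩ := h
  obtain ⟨F', hFF', hF'⟩ := h'
  have hF' := hF'.of_equiv (Quotient.exact hFF').symm
  rw [← mul_inv_eq_one]
  refine eq_one_of_minors hB.anisotropic (mul_mem hg (inv_mem hg')) fun i j => ?_
  obtain ⟨c, hc⟩ := hF.exists_minors hF' i j
  refine ⟨c, fun w => ?_⟩
  have h1 := hc (g'⁻¹ w)
  rw [matrixOf_mulVec, matrixOf_mulVec, ← LinearEquiv.mul_apply, ← LinearEquiv.mul_apply,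
    mul_inv_cancel] at h1
  refine h1.trans (congrArg (c * ·) ?_)
  exact (inv_mem hg').1 w

theorem GeneralBase.corresponds_one (hB : GeneralBase P T) : hB.Corresponds 1 1 :=
  ⟨DomRatRep.id k 2, rfl, by
    rw [matrixOf_one]
    exact hB.coprimeForms.represents_id⟩

theorem GeneralBase.exists_corresponds_right (hB : GeneralBase P T)
    {g : (Fin 3 → RatFunc k) ≃ₗ[RatFunc k] (Fin 3 → RatFunc k)}
    (hg : g ∈ specialOrthogonalGroupQuad P.quadForm) : ∃ f, hB.Corresponds f g := by
  obtain ⟨F, hF⟩ := hB.coprimeForms.exists_domRatRep (M := matrixOf g) (N := matrixOf g⁻¹)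
    (by rw [← matrixOf_mul, mul_inv_cancel, matrixOf_one]) (P.bind₁_matrixOf (inv_mem hg))
  exact ⟨_, F, rfl, hF⟩

theorem GeneralBase.exists_birFixing (hB : GeneralBase P T)
    (g : specialOrthogonalGroupQuad P.quadForm) :
    ∃ f : birFixing P.fibration, hB.Corresponds (f : Bir k 2) g := by
  obtain ⟨f, hf⟩ := hB.exists_corresponds_right g.2
  obtain ⟨f', hf'⟩ := hB.exists_corresponds_right (inv_mem g.2)
  have h1 := hf.mul hf' (hf'.preserves (inv_mem g.2))
  have h2 := hf'.mul hf (hf.preserves g.2)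
  rw [mul_inv_cancel] at h1
  rw [inv_mul_cancel] at h2
  exact ⟨⟨⟨f, f', h1.left_unique hB.corresponds_one, h2.left_unique hB.corresponds_one⟩,
    hf.preserves g.2⟩, hf⟩

/-- The base points need not be rational over `k`, so the matrix is found over the algebraic closure
and then descended. -/
theorem GeneralBase.exists_matrix (hB : GeneralBase P T) {F G : DomRatRep k 2 2}
    (hq : bind₁ F.coord P.q₁ * P.q₂ = bind₁ F.coord P.q₂ * P.q₁)
    (hGF : ∀ i j, bind₁ F.coord (G.coord i) * X j = bind₁ F.coord (G.coord j) * X i) :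
    ∃ M : Matrix (Fin 3) (Fin 3) (RatFunc k), M ≠ 0 ∧
      hB.coprimeForms.Represents F.toRatRep M := by
  obtain ⟨𝓕⟩ := hB.nonempty_pencilFrame
  have hmap : ∀ H, bind₁ (fun i => map (algebraMap k (AlgebraicClosure k)) (F.coord i))
      (map (algebraMap k (AlgebraicClosure k)) H) = map (algebraMap k (AlgebraicClosure k))
        (bind₁ F.coord H) := fun H => (map_bind₁ _ _ _).symm
  have hinj : Function.Injective (map (σ := Fin 3) (algebraMap k (AlgebraicClosure k))) :=
    map_injective _ (algebraMap k (AlgebraicClosure k)).injective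
  obtain ⟨M', μ, hμ, hM'⟩ := 𝓕.exists_matrix hB.coprimeForms_map
    (F := fun i => map (algebraMap k (AlgebraicClosure k)) (F.coord i))
    (G := fun i => map (algebraMap k (AlgebraicClosure k)) (G.coord i))
    (fun i => (F.homogeneous i).map _) (fun i => (G.homogeneous i).map _)
    (bind₁_map_injective (bind₁_injective_of_dominant F.homogeneous F.dominant))
    (by rw [hmap, hmap, ← map_mul, ← map_mul, hq])
    (G.exists_ne_zero.imp fun i hi => (map_ne_zero_iff _ hinj).mpr hi)
    (fun i j => by
      rw [hmap, hmap, ← map_X (algebraMap k (AlgebraicClosure k)), ← map_mul, hGF, map_mul, map_X])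
  refine hB.coprimeForms.exists_matrix_of_map hB.coprimeForms_map (M' := M') ?_ fun i j => ?_
  · rintro rfl
    obtain ⟨l, hl⟩ := F.exists_ne_zero
    refine coord_algebraMap_ne_zero ((map_ne_zero_iff _ hinj).mpr hl) ?_
    rw [hM']
    simp [CoprimeForms.act]
  · rw [hM', hM']
    ring

/-- The matrix of `f` sends the generic point to a point of the conic, so `q ∘ M` vanishes at the
generic point and equals `c q`: a similitude, which a scalar brings into the special orthogonal
group. -/
theorem GeneralBase.exists_specialOrthogonal (hB : GeneralBase P T) (f : birFixing P.fibration) :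
    ∃ g : specialOrthogonalGroupQuad P.quadForm, hB.Corresponds (f : Bir k 2) g := by
  obtain ⟨F, hF⟩ := Quotient.exists_rep ((f : Bir k 2) : DomRatMap k 2 2)
  obtain ⟨G, hG⟩ := Quotient.exists_rep (((f : Bir k 2)⁻¹ : Bir k 2) : DomRatMap k 2 2)
  have hq : bind₁ F.coord P.q₁ * P.q₂ = bind₁ F.coord P.q₂ * P.q₁ := by
    rw [← DomRatMap.mk_comp_eq_iff, hF]
    exact f.2
  have hGF : ∀ i j, bind₁ F.coord (G.coord i) * X j = bind₁ F.coord (G.coord j) * X i := by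
    have h1 := (f : Bir k 2).inv_mul
    rw [← hF, ← hG] at h1
    exact Quotient.exact h1
  obtain ⟨M, hM0, hM⟩ := hB.exists_matrix hq hGF
  have hgen := (hM.preserves_iff hM0).mp hq
  rw [← hB.coprimeForms.eval₂_bind₁_linPoly] at hgen
  obtain ⟨c, hc⟩ := hB.coprimeForms.eq_C_mul_of_eval₂_eq_zero
    (Q := bind₁ (linPoly M) (pencilPoly P.q₁ P.q₂))
    ((pencilPoly_isHomogeneous hB.coprimeForms).aeval _ (linPoly_isHomogeneous M)) hgen
  have hcq : ∀ v, P.quadForm (M.mulVecLin v) = c * P.quadForm v := by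
    intro v
    have := congrArg (eval v) hc
    rw [eval_bind₁_linPoly, map_mul, eval_C] at this
    exact this
  -- With multiplier zero every `M v` would be isotropic, hence zero.
  have hc0 : c ≠ 0 := by
    rintro rfl
    apply hM0
    rw [← LinearMap.toMatrix'_toLin' M, Matrix.toLin'_apply', LinearEquiv.map_eq_zero_iff]
    refine LinearMap.ext fun v => ?_
    exact hB.anisotropic _ ((hcq v).trans (zero_mul _))
  obtain ⟨g, hg, d, -, hgd⟩ :=
    exists_smul_mem_specialOrthogonalGroupQuad hB.anisotropic hB.polarBilin_ne_zero hc0 hcq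
  refine ⟨⟨g, hg⟩, F, hF.symm, ?_⟩
  have : matrixOf g = d • M := by
    rw [matrixOf, hgd, map_smul, ← Matrix.toLin'_apply', LinearMap.toMatrix'_toLin']
  change hB.coprimeForms.Represents _ (matrixOf g)
  rw [this]
  exact hM.smul d

/-- `GeneralBase.Corresponds` is multiplicative, total and unique on both sides, hence the graph of
an isomorphism. -/
theorem GeneralBase.nonempty_mulEquiv (hB : GeneralBase P T) :
    Nonempty (birFixing P.fibration ≃* specialOrthogonalGroupQuad P.quadForm) := by
  choose φ hφ using hB.exists_specialOrthogonal
  refine ⟨MulEquiv.ofBijective (MonoidHom.mk' φ fun f f' => ?_) ⟨fun f f' h => ?_, fun g => ?_⟩⟩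
  · exact Subtype.ext ((hφ (f * f')).right_unique ((hφ f).mul (hφ f') f'.2) (φ (f * f')).2
      (φ f * φ f').2)
  · have h : φ f = φ f' := h
    have h1 := hφ f
    rw [h] at h1
    exact Subtype.ext (Units.ext (h1.left_unique (hφ f')))
  · obtain ⟨f, hf⟩ := hB.exists_birFixing g
    exact ⟨f, Subtype.ext ((hφ f).right_unique hf (φ f).2 g.2)⟩

theorem IsProdOfInvolutions.of_mulEquiv {G H : Type*} [Group G] [Group H] (e : G ≃* H) {n : ℕ}
    {g : G} (h : IsProdOfInvolutions n (e g)) : IsProdOfInvolutions n g := by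
  obtain ⟨l, hl, hs, hp⟩ := h
  refine ⟨l.map e.symm, by simpa using hl, fun s hs' => ?_, ?_⟩
  · obtain ⟨t, ht, rfl⟩ := List.mem_map.mp hs'
    rw [MulEquiv.orderOf_eq, hs t ht]
  · rw [← map_list_prod, hp, e.symm_apply_apply]

theorem IsProdOfInvolutions.mono {G : Type*} [Group G] {m n : ℕ} (hmn : m ≤ n) {g : G}
    (h : IsProdOfInvolutions m g) : IsProdOfInvolutions n g := by
  obtain ⟨l, hl, hs, hp⟩ := h
  exact ⟨l, hl.trans hmn, hs, hp⟩

theorem two_ratFunc_eq_zero_iff : (2 : RatFunc k) = 0 ↔ ringChar k = 2 := by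
  rw [← map_ofNat (algebraMap k (RatFunc k)) 2,
    map_eq_zero_iff _ (algebraMap k (RatFunc k)).injective]
  constructor
  · intro h
    have h1 : ringChar k ∣ 2 := (ringChar.spec k 2).mp (by exact_mod_cast h)
    exact ((Nat.dvd_prime Nat.prime_two).mp h1).resolve_left fun h1 => by
      have := ringChar.Nat.cast_ringChar (R := k)
      rw [h1, Nat.cast_one] at this
      exact one_ne_zero this
  · intro h
    have := ringChar.Nat.cast_ringChar (R := k)
    rw [h] at this
    exact_mod_cast this

theorem GeneralBase.structure_birFixing (hB : GeneralBase P T) :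
    P.quadForm.Anisotropic ∧
      (ringChar k ≠ 2 → IsNondegenerateQuad P.quadForm) ∧
      (ringChar k = 2 → HasDefect P.quadForm 1) ∧
      Nonempty (birFixing P.fibration ≃* specialOrthogonalGroupQuad P.quadForm) ∧
      (∀ f : birFixing P.fibration, IsProdOfInvolutions 3 f) ∧
      (ringChar k ≠ 2 → ∀ f : birFixing P.fibration, IsProdOfInvolutions 2 f) := by
  have ha := hB.anisotropic
  have hd : ringChar k = 2 → HasDefect P.quadForm 1 := fun h =>
    hasDefect_one_of_anisotropic (two_ratFunc_eq_zero_iff.mpr h) ha hB.polarBilin_ne_zero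
  obtain ⟨e⟩ := hB.nonempty_mulEquiv
  -- Two involutions suffice in every characteristic; the bound three follows by monotonicity.
  have hinv : ∀ f : birFixing P.fibration, IsProdOfInvolutions 2 f := by
    intro f
    apply IsProdOfInvolutions.of_mulEquiv e
    by_cases h : ringChar k = 2
    · exact isProdOfInvolutions_of_two_eq_zero (two_ratFunc_eq_zero_iff.mpr h) ha (hd h) _
    · exact isProdOfInvolutions_of_two_ne_zero (mt two_ratFunc_eq_zero_iff.mp h) ha _
  exact ⟨ha, fun h => isNondegenerateQuad_of_anisotropic (mt two_ratFunc_eq_zero_iff.mp h) ha, hd,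
    ⟨e⟩, fun f => (hinv f).mono (by norm_num), fun _ => hinv⟩

end GroupIso
end

theorem proposition3p20 (k : Type*) [Field k] [PerfectField k] :
    (∀ (F : Type*) [Field F] [Algebra k F] (P : ConicPencil k), P.IsType4 F →
      P.quadForm.Anisotropic ∧
      (ringChar k ≠ 2 → IsNondegenerateQuad P.quadForm) ∧
      (ringChar k = 2 → HasDefect P.quadForm 1) ∧
      Nonempty (birFixing P.fibration ≃* specialOrthogonalGroupQuad P.quadForm) ∧
      (∀ f : birFixing P.fibration, IsProdOfInvolutions 3 f) ∧
      (ringChar k ≠ 2 → ∀ f : birFixing P.fibration, IsProdOfInvolutions 2 f)) ∧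
    (∀ (L L' : Type*) [Field L] [Algebra k L] [Field L'] [Algebra k L'] (P : ConicPencil k),
      P.IsType22 L L' →
      P.quadForm.Anisotropic ∧
      (ringChar k ≠ 2 → IsNondegenerateQuad P.quadForm) ∧
      (ringChar k = 2 → HasDefect P.quadForm 1) ∧
      Nonempty (birFixing P.fibration ≃* specialOrthogonalGroupQuad P.quadForm) ∧
      (∀ f : birFixing P.fibration, IsProdOfInvolutions 3 f) ∧
      (ringChar k ≠ 2 → ∀ f : birFixing P.fibration, IsProdOfInvolutions 2 f)) := by
  refine ⟨fun F _ _ P hP => ?_, fun L L' _ _ _ _ P hP => ?_⟩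
  · obtain ⟨T, hT⟩ := hP.exists_generalBase
    exact hT.structure_birFixing
  · obtain ⟨T, hT⟩ := hP.exists_generalBase
    exact hT.structure_birFixing
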